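/- Write $e(x)=\exp(2\pi i x)$, let $\mathbb{H}$ be the upper half plane, and let $\mathrm{Mp}_1(\mathbb{Z})$ be the set of pairs $(\gamma,\omega)$ with $\gamma=\begin{pmatrix}a&b\\c&d\end{pmatrix}\in\mathrm{SL}_2(\mathbb{Z})$ and $\omega$ a holomorphic square root of $c\tau+d$ on $\mathbb{H}$. Let $\tilde\Gamma_0(N)\subseteq\mathrm{Mp}_1(\mathbb{Z})$ be the preimage of $\Gamma_0(N)$ and $T=\big(\begin{pmatrix}1&1\\0&1\end{pmatrix},1\big)$. For $k\in\frac12\mathbb{Z}$ and $m\in\mathbb{C}$ put $$(f|_k(\gamma,\omega))(\tau)=\omega(\tau)^{-2k}f(\gamma\tau),\qquad (\phi|_{k,m}(\gamma,\omega))(\tau,z)=\omega(\tau)^{-2k}\,e\Big(\frac{-mcz^2}{c\tau+d}\Big)\,\phi\Big(\gamma\tau,\frac{z}{c\tau+d}\Big),$$ $$(\phi|_{k,m}(\lambda,\mu,\kappa))(\tau,z)=e\big(m(\lambda^2\tau+2\lambda z+\kappa)\big)\,\phi(\tau,z+\lambda\tau+\mu)\quad(\lambda,\mu,\kappa\in\mathbb{Z}).$$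 Let $\chi_\theta$ (on $\tilde\Gamma_0(4)$) and $\chi_\eta$ (on $\mathrm{Mp}_1(\mathbb{Z})$) be the characters by which $\theta(\tau)=\sum_{n\in\mathbb{Z}} e(n^2\tau)$ and the Dedekind eta function $\eta$ transform under $|_{1/2}$. View a Dirichlet character $\chi$ modulo $N$ as the character $(\gamma,\omega)\mapsto\chi(d)$ of $\tilde\Gamma_0(N)$. A weakly holomorphic modular form of weight $k$ for $\tilde\Gamma_0(N)$ and a character $\rho$ is a holomorphic $f:\mathbb{H}\to\mathbb{C}$ with $f|_kg=\rho(g)f$ for all $g\in\tilde\Gamma_0(N)$ such that for some $a\in\mathbb{R}$ one has $(f|_kg)(\tau)\ll\exp(a\,\mathrm{Im}\,\tau)$ as $\mathrm{Im}\,\tau\to\infty$ for all $g\in\mathrm{Mp}_1(\mathbb{Z})$. A weakly holomorphic Jacobi form of weight $k$ and index $m\in\mathbb{C}$ for $\tilde\Gamma_0(N)$ and $\rho$ with possible singularities at $\mathbb{Z}+\tau\mathbb{Z}$ is a meromorphic function $\phi$ on $\mathbb{H}\times\mathbb{C}$, holomorphic where $z\notin\mathbb{Z}+\tau\mathbb{Z}$,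 with $\phi|_{k,m}g=\rho(g)\phi$ for $g\in\tilde\Gamma_0(N)$ and $\phi|_{k,m}(\lambda,\mu,\kappa)=\phi$ for $\lambda,\mu,\kappa\in\mathbb{Z}$, such that for every $g\in\mathrm{Mp}_1(\mathbb{Z})$ and all $x,y\in\mathbb{Q}$ for which $\phi|_{k,m}g$ is regular at $z=x\tau+y$, the function $(\phi|_{k,m}g)(\tau,x\tau+y)$ is $\ll\exp(a\,\mathrm{Im}\,\tau)$ as $\mathrm{Im}\,\tau\to\infty$ for some $a\in\mathbb{R}$. Fourier expansions, with exponents in $\mathbb{Q}$ of bounded denominator, are $f(\tau)=\sum_n c(f;n)e(n\tau)$ and $\phi(\tau,z)=\sum_{n,r}c(\phi;n,r)e(n\tau+rz)$, the latter for positive and sufficiently small $\mathrm{Im}(z)/\mathrm{Im}(\tau)$. Put $c(\phi;n;z)=\sum_r c(\phi;n,r)e(rz)$ for $\mathrm{Im}\,z>0$. We say that $\phi$ specializes to $f$ if $f\ne0$ and, for some $\nu\in\mathbb{Z}$, $\lim_{z\to0}(e(\tfrac z2)-e(-\tfrac z2))^{\nu}\phi(\tau,z)=f(\tau)$ for all $\tau\in\mathbb{H}$;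 then $\nu$ is unique, and we set $\tilde c(\phi;n;z)=(e(\tfrac z2)-e(-\tfrac z2))^{\nu}c(\phi;n;z)$. Fix a number field $K\subset\mathbb{C}$. For a prime $\ell$ let $\mathcal{O}_{K,\ell}$ be the ring of those $x\in K$ for which $sx$ is an algebraic integer for some positive integer $s$ prime to $\ell$. Let $M\ge1$ be an integer and $\beta\in\mathbb{Q}$. The form $f$ has a Ramanujan-type congruence modulo $\ell$ on $M\mathbb{Z}+\beta$ if $c(f;n)\in\ell\,\mathcal{O}_{K,\ell}$ for all $n\in M\mathbb{Z}+\beta$. The form $\phi$ explains the Ramanujan-type congruence modulo $\ell$ of $f$ on $M\mathbb{Z}+\beta$ if $\phi$ specializes to $f$, all $c(\phi;n,r)$ lie in $\mathcal{O}_{K,\ell}$, and for all $n\in M\mathbb{Z}+\beta$ the function $\tilde c(\phi;n;z)$ is a Laurent polynomial in $e(z/D)$ for some integer $D\ge1$ that is divisible, in the ring of such Laurent polynomials, by the $\ell$-th cyclotomic polynomial in $e(z)$. **Theorem.** Let $N\ge1$, let $\chi$ be a Dirichlet character modulo $N$, and let $\rho$ be the character $\chi\chi_\theta$ (in which case $4\mid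 N$) or $\chi\chi_\eta$ of $\tilde\Gamma_0(N)$. Let $f$ be a weakly holomorphic modular form and $\phi$ a weakly holomorphic Jacobi form with possible singularities at $\mathbb{Z}+\tau\mathbb{Z}$, of half-integral or integral weights and $\phi$ of some index $m\in\mathbb{C}$, both for $\tilde\Gamma_0(N)$ and $\rho$. Let $\ell$ be a prime, $M\ge1$ an integer, and $\beta\in\mathbb{Q}$ with $\rho(T)=e(\beta)$. If $\phi$ explains the Ramanujan-type congruence modulo $\ell$ of $f$ on $M\mathbb{Z}+\beta$, then for every $u\in\mathbb{Z}$ with $\gcd(M,u)=1$ the form $f$ has a Ramanujan-type congruence modulo $\ell$ on $M\mathbb{Z}+u^2\beta$, and $\phi$ explains it. -/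

import Mathlib

open UpperHalfPlane hiding I
open Complex Filter Topology MatrixGroups LaurentPolynomial

noncomputable section

namespace RamanujanType

/-- The normalized exponential `e(x) = exp(2πi x)`. -/
def e (x : ℂ) : ℂ := exp (2 * Real.pi * I * x)

/-- `e(x)` as a unit of `ℂ`. -/
def eUnit (x : ℂ) : ℂˣ := Units.mk0 (e x) (exp_ne_zero _)

/-! ### The metaplectic group and slash actions -/

/-- Elements of `Mp₁(ℤ)`: pairs `(γ, ω)` of `γ = (a b; c d)` in `SL₂(ℤ)` and a holomorphic square
root `ω` of `τ ↦ c τ + d` on the upper half plane. -/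
@[ext]
structure Mp where
  γ : SL(2, ℤ)
  ω : ℍ → ℂ
  holo : AnalyticOnNhd ℂ (fun t : ℂ => ω (ofComplex t)) {t : ℂ | 0 < t.im}
  sq : ∀ τ : ℍ, ω τ ^ 2 = ((γ 1 0 : ℤ) : ℂ) * (τ : ℂ) + ((γ 1 1 : ℤ) : ℂ)

/-- The lift `((1 1; 0 1), 1)` of the translation matrix. -/
def Mp.T : Mp where
  γ := ModularGroup.T
  ω := fun _ => 1
  holo := fun _ _ => analyticAt_const
  sq := fun τ => by simp [ModularGroup.T]

/-- The preimage of `Γ₀(N)` in `Mp₁(ℤ)`. -/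
def Gamma0Tilde (N : ℕ) : Set Mp := {g | g.γ ∈ CongruenceSubgroup.Gamma0 N}

/-- The slash action of weight `w / 2` on functions on the upper half plane:
`(f | (γ, ω))(τ) = ω(τ)⁻ʷ f(γτ)`. -/
def slash (w : ℤ) (f : ℍ → ℂ) (g : Mp) (τ : ℍ) : ℂ := g.ω τ ^ (-w) * f (g.γ • τ)

/-- The Jacobi slash action of weight `w / 2` and index `m` of `(γ, ω)` in `Mp₁(ℤ)`. -/
def jacobiSlash (w : ℤ) (m : ℂ) (φ : ℍ → ℂ → ℂ) (g : Mp) (τ : ℍ) (z : ℂ) : ℂ :=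
  g.ω τ ^ (-w) *
    e (m * (-((g.γ 1 0 : ℤ) : ℂ) * z ^ 2 /
      (((g.γ 1 0 : ℤ) : ℂ) * (τ : ℂ) + ((g.γ 1 1 : ℤ) : ℂ)))) *
    φ (g.γ • τ) (z / (((g.γ 1 0 : ℤ) : ℂ) * (τ : ℂ) + ((g.γ 1 1 : ℤ) : ℂ)))

/-- The slash action of index `m` of the element `(l, μ, κ)` of the Heisenberg group `H(ℤ)`. -/
def heisenbergSlash (m : ℂ) (φ : ℍ → ℂ → ℂ) (l μ κ : ℤ) (τ : ℍ) (z : ℂ) : ℂ :=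
  e (m * ((l : ℂ) ^ 2 * (τ : ℂ) + 2 * (l : ℂ) * z + (κ : ℂ))) *
    φ τ (z + (l : ℂ) * (τ : ℂ) + (μ : ℂ))

/-! ### The characters of the Jacobi theta function and the Dedekind eta function -/

/-- The Jacobi theta function `θ(τ) = ∑ₙ e(n² τ)`. (Mathlib's `jacobiTheta` is
`∑ₙ exp(πi n² τ)`.) -/
def theta (τ : ℍ) : ℂ := jacobiTheta (2 * (τ : ℂ))

/-- The Dedekind eta function. -/
def dedekindEta (τ : ℍ) : ℂ := ModularForm.eta (τ : ℂ)

/-- The constant `χ_h(g)` with `h |_{1/2} g = χ_h(g) h`, for a weight `1/2` modular form `h` with a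
character that does not vanish at `i`. The quotient of `h |_{1/2} g` and `h` is constant, and is
read off at the point `i`. -/
def charOf (h : ℍ → ℂ) (g : Mp) : ℂ := slash 1 h g UpperHalfPlane.I / h UpperHalfPlane.I

/-- The character `χ_θ` of `Gamma0Tilde 4` associated with the Jacobi theta function. -/
def chiTheta : Mp → ℂ := charOf theta

/-- The character `χ_η` of `Mp₁(ℤ)` associated with the Dedekind eta function. -/
def chiEta : Mp → ℂ := charOf dedekindEta

/-- The product of the Dirichlet character `χ`, as the character `(γ, ω) ↦ χ(d)` of
`Gamma0Tilde N`, with `v`. -/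
def twist {N : ℕ} (χ : DirichletCharacter ℂ N) (v : Mp → ℂ) (g : Mp) : ℂ :=
  χ ((g.γ 1 1 : ℤ) : ZMod N) * v g

/-! ### Weakly holomorphic modular forms and Jacobi forms -/

/-- Weakly holomorphic modular forms of weight `w / 2` for the group `Γ` and the character `v`. -/
structure IsWeaklyHolomorphicModularForm (Γ : Set Mp) (v : Mp → ℂ) (w : ℤ) (f : ℍ → ℂ) :
    Prop where
  holo : AnalyticOnNhd ℂ (fun t : ℂ => f (ofComplex t)) {t : ℂ | 0 < t.im}
  transform : ∀ g ∈ Γ, ∀ τ : ℍ, slash w f g τ = v g * f τ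
  growth : ∃ a : ℝ, ∀ g : Mp,
    (fun τ : ℍ => slash w f g τ) =O[atImInfty] (fun τ : ℍ => Real.exp (a * τ.im))

/-- The lattice `ℤ + τ ℤ`. -/
def lattice (τ : ℍ) : Set ℂ := {z | ∃ l μ : ℤ, z = (l : ℂ) * (τ : ℂ) + (μ : ℂ)}

/-- Weakly holomorphic Jacobi forms of weight `w / 2` and index `m` with possible singularities at
`ℤ + τ ℤ`, for the semidirect product of `Γ` and `H(ℤ)` and the character of this group that is `v`
on `Γ` and trivial on `H(ℤ)`. The form is represented by a function on `ℍ × ℂ`, whose values on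
the locus `z ∈ ℤ + τ ℤ` are irrelevant. -/
structure IsWeaklyHolomorphicJacobiForm (Γ : Set Mp) (v : Mp → ℂ) (w : ℤ) (m : ℂ)
    (φ : ℍ → ℂ → ℂ) : Prop where
  /-- `φ` is holomorphic off the locus `z ∈ ℤ + τ ℤ`. -/
  regular : ∀ (τ : ℍ) (z : ℂ), z ∉ lattice τ →
    AnalyticAt ℂ (fun p : ℂ × ℂ => φ (ofComplex p.1) p.2) ((τ : ℂ), z)
  /-- `φ` is meromorphic along each component `z = l τ + μ` of this locus. -/
  meromorphic : ∀ (τ : ℍ) (l μ : ℤ), ∃ (j : ℕ) (h : ℂ × ℂ → ℂ),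
    AnalyticAt ℂ h ((τ : ℂ), (l : ℂ) * (τ : ℂ) + (μ : ℂ)) ∧
    ∀ᶠ p in 𝓝 (((τ : ℂ), (l : ℂ) * (τ : ℂ) + (μ : ℂ)) : ℂ × ℂ),
      p.2 - ((l : ℂ) * p.1 + (μ : ℂ)) ≠ 0 →
        φ (ofComplex p.1) p.2 = h p / (p.2 - ((l : ℂ) * p.1 + (μ : ℂ))) ^ j
  transform : ∀ g ∈ Γ, ∀ (τ : ℍ) (z : ℂ), z ∉ lattice τ →
    jacobiSlash w m φ g τ z = v g * φ τ z
  transform_heisenberg : ∀ (l μ κ : ℤ) (τ : ℍ) (z : ℂ), z ∉ lattice τ →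
    heisenbergSlash m φ l μ κ τ z = φ τ z
  /-- At each torsion point `x τ + y` at which the transform of `φ` by `g` is regular, with
  values `s(τ)`, it grows at most like `exp(a Im(τ))` for some real `a`. -/
  growth : ∀ (g : Mp) (x y : ℚ) (s : ℍ → ℂ),
    (∀ τ : ℍ, Tendsto (fun z : ℂ => jacobiSlash w m φ g τ z)
      (𝓝[≠] ((x : ℂ) * (τ : ℂ) + (y : ℂ))) (𝓝 (s τ))) →
    ∃ a : ℝ, s =O[atImInfty] (fun τ : ℍ => Real.exp (a * τ.im))

/-! ### Fourier expansions -/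

/-- `f(τ) = ∑ₙ c(n) e(n τ)`, where `n` runs through rational numbers with bounded denominator. -/
def IsFourierExpansion (f : ℍ → ℂ) (c : ℚ → ℂ) : Prop :=
  (∃ D : ℕ, 0 < D ∧ ∀ n, c n ≠ 0 → ∃ a : ℤ, n = a / D) ∧
  ∀ τ : ℍ, HasSum (fun n : ℚ => c n * e ((n : ℂ) * (τ : ℂ))) (f τ)

/-- `φ(τ, z) = ∑_{n, r} c(n, r) e(n τ + r z)` for positive and sufficiently small `Im(z) / Im(τ)`,
where `n` and `r` run through rational numbers with bounded denominator. -/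
def IsJacobiFourierExpansion (φ : ℍ → ℂ → ℂ) (c : ℚ → ℚ → ℂ) : Prop :=
  (∃ D : ℕ, 0 < D ∧ ∀ n r, c n r ≠ 0 → (∃ a : ℤ, n = a / D) ∧ ∃ b : ℤ, r = b / D) ∧
  ∃ ε : ℝ, 0 < ε ∧ ∀ (τ : ℍ) (z : ℂ), 0 < z.im / τ.im → z.im / τ.im < ε →
    HasSum (fun p : ℚ × ℚ => c p.1 p.2 * e ((p.1 : ℂ) * (τ : ℂ) + (p.2 : ℂ) * z)) (φ τ z)

/-- `c(n; z) = ∑_r c(n, r) e(r z)`, for `Im(z) > 0`. -/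
def coeffAt (c : ℚ → ℚ → ℂ) (n : ℚ) (z : ℂ) : ℂ := ∑' r : ℚ, c n r * e ((r : ℂ) * z)

/-- The leading Fourier coefficient `(e(z/2) - e(-z/2))^ν c(n; z)`, for `Im(z) > 0`. -/
def leadingCoeff (ν : ℤ) (c : ℚ → ℚ → ℂ) (n : ℚ) (z : ℂ) : ℂ :=
  (e (z / 2) - e (-z / 2)) ^ ν * coeffAt c n z

/-- The function `F` on the upper half plane is a Laurent polynomial `P` in `e(z/D)` for some
positive integer `D`, and the `ℓ`-th cyclotomic polynomial in `e(z) = e(z/D)^D` divides `P` in the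
ring of these Laurent polynomials. -/
def CyclotomicDvd (ℓ : ℕ) (F : ℂ → ℂ) : Prop :=
  ∃ D : ℕ, 0 < D ∧ ∃ P : ℂ[T;T⁻¹],
    (∀ z : ℂ, 0 < z.im → F z = LaurentPolynomial.eval₂ (RingHom.id ℂ) (eUnit (z / D)) P) ∧
    Polynomial.toLaurent (Polynomial.expand ℂ D (Polynomial.cyclotomic ℓ ℂ)) ∣ P

/-- `x` lies in the localization `𝓞_{K,ℓ}` at `ℓ` of the ring of integers of `K`. -/
def IsLocallyIntegral (K : IntermediateField ℚ ℂ) (ℓ : ℕ) (x : ℂ) : Prop :=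
  x ∈ K ∧ ∃ s : ℕ, ¬ ℓ ∣ s ∧ IsIntegral ℤ ((s : ℂ) * x)

/-! ### Explainable Ramanujan-type congruences -/

/-- The arithmetic progression `M ℤ + β`. -/
def progression (M : ℕ) (β : ℚ) : Set ℚ := {n | ∃ j : ℤ, n = M * j + β}

/-- `f` has a Ramanujan-type congruence modulo `ℓ` on `M ℤ + β`: its Fourier coefficients `c(n)`
for `n ∈ M ℤ + β` lie in `ℓ 𝓞_{K,ℓ}`. -/
def HasRamanujanTypeCongruence (K : IntermediateField ℚ ℂ) (ℓ : ℕ) (f : ℍ → ℂ) (M : ℕ) (β : ℚ) :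
    Prop :=
  ∃ c : ℚ → ℂ, IsFourierExpansion f c ∧
    ∀ n ∈ progression M β, ∃ y : ℂ, IsLocallyIntegral K ℓ y ∧ c n = ℓ * y

/-- `φ` specializes to `f`, and has order `-ν` at `z = 0`: the leading term of the Laurent
expansion of `φ` around `z = 0`, with respect to the local parameter `e(z/2) - e(-z/2)`, is the
`(-ν)`-th one, and has coefficient `f`. -/
def SpecializesTo (φ : ℍ → ℂ → ℂ) (ν : ℤ) (f : ℍ → ℂ) : Prop :=
  f ≠ 0 ∧ ∀ τ : ℍ,
    Tendsto (fun z : ℂ => (e (z / 2) - e (-z / 2)) ^ ν * φ τ z) (𝓝[≠] 0) (𝓝 (f τ))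

/-- The weakly holomorphic Jacobi form `φ` explains the Ramanujan-type congruence modulo `ℓ` of `f`
on `M ℤ + β`: it specializes to `f`, its Fourier coefficients are `ℓ`-integral, and the `ℓ`-th
cyclotomic polynomial in `e(z)` divides its leading Fourier coefficients with
index `n ∈ M ℤ + β`. -/
def Explains (K : IntermediateField ℚ ℂ) (ℓ : ℕ) (φ : ℍ → ℂ → ℂ) (f : ℍ → ℂ) (M : ℕ) (β : ℚ) :
    Prop :=
  ∃ (ν : ℤ) (c : ℚ → ℚ → ℂ), SpecializesTo φ ν f ∧ IsJacobiFourierExpansion φ c ∧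
    (∀ n r, IsLocallyIntegral K ℓ (c n r)) ∧
    ∀ n ∈ progression M β, CyclotomicDvd ℓ (leadingCoeff ν c n)

end RamanujanType

end

open RamanujanType

/-!
Let `φ` be a Jacobi form of index `m` that specializes to `f`, and consider its leading term
`F(τ, z) = (e(z/2) - e(-z/2))^ν φ(τ, z)`, extended by `f(τ)` to `z = 0`. For a real point `z`, the
Fourier coefficient of `F(·, z)` with index `n` is the value at `z` of the leading coefficient
`c̃(φ; n; z)`. The argument turns divisibility by the cyclotomic polynomial into the vanishing of
these Fourier coefficients at torsion points, and moves the latter from one progression to another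
by a single family of modular transformations.

**Leading coefficients.** `F` is holomorphic on the tube `|Im z| < Im τ`. By the elliptic
transformation law, `φ` times a power of the odd theta function is, for fixed `τ`, a theta function
of some degree. It is determined by its values at finitely many torsion points, so the growth
condition at torsion points bounds `φ` on the lines `Im z = x Im τ` and `Im z = (x - 1) Im τ` for a
suitable `0 < x < 1` (`HasLeadingTerm.exists_growth`). Moving the lines of integration to infinity
inside the tube, one finds that the Fourier coefficients in `τ` of `F` are Laurent polynomials in
`e(z/2)` (`HasLeadingTerm.exists_laurent`). As `Φ_ℓ(X²)` is separable, it divides such a Laurent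
polynomial if and only if the latter vanishes at `z = h/ℓ` for all `h` prime to `ℓ`
(`CyclotomicDvd.eq_zero`, `expand_cyclotomic_dvd`).

**Transfer.** Let `γ = (a b; M²c d)` with `ℓ² ∣ c`. At `ℓ`-torsion points the exponential factors of
the modular and the elliptic transformation cancel, because `m` is an integer, and `γ` relates the
values at `a h/ℓ` to those at `h/ℓ` (`apply_smul_torsion`). The matrices
`γ_j = (1 a²j/M; 0 1) γ (1 -j/M; 0 1)` are integral, and `γ_j (τ + j/M) = γ τ + a²j/M`. The theta and
eta multipliers agree on all `γ_j` when `c` is divisible by a suitable number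
(`IsThetaCoefficient.charOf_ofPos_eq`): both multipliers come from theta series `∑ X(n) e(n² τ/κ)`,
for which Poisson summation expresses the multiplier by a quadratic Gauss sum; for the eta function
this uses the pentagonal number theorem. Hence translations of `F(·, a h/ℓ)` by `a² j/M` correspond to
translations of `F(·, h/ℓ)` by `j/M`, with one common factor. Averaging over `j` against the
additive character `j ↦ e(-j u²β/M)`, where `a ≡ u` modulo `M`, annihilates the former if its Fourier
coefficients vanish on `M ℤ + β`, and isolates the progression `M ℤ + u²β` in the latter
(`fourierInt_eq_zero_of_shift`, `HasLeadingTerm.tubeCoeff_eq_zero`).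

**The congruence.** If `Φ_ℓ(X²)` divides a leading coefficient, then the quotient is `ℓ`-integral,
since division by monic polynomials preserves integrality. The Fourier coefficient of `f` is the
value at `X = 1`, which is divisible by `Φ_ℓ(1) = ℓ` (`exists_eval_one_eq`).
-/

noncomputable section

namespace RamanujanType


/-! ### The normalized exponential -/

lemma e_add (x y : ℂ) : e (x + y) = e x * e y := by
  simp only [e, mul_add, Complex.exp_add]

lemma e_neg (x : ℂ) : e (-x) = (e x)⁻¹ := by
  simp only [e, mul_neg, Complex.exp_neg]

lemma e_sub (x y : ℂ) : e (x - y) = e x / e y := by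
  rw [sub_eq_add_neg, e_add, e_neg, div_eq_mul_inv]

@[simp] lemma e_zero : e 0 = 1 := by simp [e]

lemma e_ne_zero (x : ℂ) : e x ≠ 0 := exp_ne_zero _

@[simp] lemma e_intCast (k : ℤ) : e k = 1 := by
  rw [e, Complex.exp_eq_one_iff]
  exact ⟨k, by ring⟩

lemma e_eq_one_iff {x : ℂ} : e x = 1 ↔ ∃ k : ℤ, x = k := by
  rw [e, Complex.exp_eq_one_iff]
  have h : (2 * Real.pi * I : ℂ) ≠ 0 := Complex.two_pi_I_ne_zero
  refine exists_congr fun k => ⟨fun hk => ?_, fun hk => by rw [hk]; ring⟩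
  apply mul_left_cancel₀ h
  rw [hk]; ring

lemma e_eq_e_iff {x y : ℂ} : e x = e y ↔ ∃ k : ℤ, x = y + k := by
  rw [← div_eq_one_iff_eq (e_ne_zero y), ← e_sub, e_eq_one_iff]
  exact exists_congr fun k => sub_eq_iff_eq_add'

lemma e_add_intCast (x : ℂ) (k : ℤ) : e (x + k) = e x := by
  rw [e_add, e_intCast, mul_one]

lemma e_intCast_mul (k : ℤ) (x : ℂ) : e (k * x) = e x ^ k := by
  rw [e, e, ← Complex.exp_int_mul]; congr 1; ring

lemma e_natCast_mul (k : ℕ) (x : ℂ) : e (k * x) = e x ^ k := by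
  rw [← zpow_natCast, ← e_intCast_mul]; push_cast; rfl

lemma norm_e (x : ℂ) : ‖e x‖ = Real.exp (-2 * Real.pi * x.im) := by
  rw [e, Complex.norm_exp]; congr 1; simp

@[fun_prop] lemma differentiable_e : Differentiable ℂ e := by unfold e; fun_prop

@[fun_prop] lemma continuous_e : Continuous e := differentiable_e.continuous

/-! ### Fourier coefficients on horizontal lines -/

/-- The Fourier coefficient of `F` with frequency `n` on the horizontal line `Im z = y`, where `F`
has period `D` on this line. It is normalized such that it does not depend on `y` as long as `F` is
holomorphic. -/
def fourierInt (D : ℕ) (F : ℂ → ℂ) (y : ℝ) (n : ℚ) : ℂ :=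
  (D : ℂ)⁻¹ * ∫ x in (0 : ℝ)..D, F (x + y * I) * e (-(n * (x + y * I)))

lemma fourierInt_congr {D : ℕ} {F G : ℂ → ℂ} {y : ℝ} (n : ℚ)
    (h : ∀ x : ℝ, F (x + y * I) = G (x + y * I)) : fourierInt D F y n = fourierInt D G y n := by
  simp only [fourierInt, h]

lemma e_neg_rat_mul_add_nat {D : ℕ} (hD : 0 < D) (k : ℤ) (z : ℂ) :
    e (-(((k / D : ℚ) : ℂ) * (z + D))) = e (-(((k / D : ℚ) : ℂ) * z)) := by
  have hD' : (D : ℂ) ≠ 0 := by exact_mod_cast hD.ne'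
  rw [← e_add_intCast _ k]
  congr 1
  push_cast
  field_simp
  ring

/-- Moving the line of integration does not change the Fourier coefficients of a holomorphic
function. -/
lemma fourierInt_eq_of_differentiableAt {D : ℕ} (hD : 0 < D) {F : ℂ → ℂ} {y₁ y₂ : ℝ}
    (hF : ∀ z : ℂ, z.im ∈ Set.uIcc y₁ y₂ → DifferentiableAt ℂ F z)
    (hper : ∀ z : ℂ, z.im ∈ Set.uIcc y₁ y₂ → F (z + D) = F z) (k : ℤ) :
    fourierInt D F y₁ (k / D) = fourierInt D F y₂ (k / D) := by
  have key := Complex.integral_boundary_rect_eq_zero_of_differentiableOn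
    (fun z => F z * e (-(((k / D : ℚ) : ℂ) * z))) (y₁ * I) (D + y₂ * I) (by
      intro z hz
      rw [Complex.mem_reProdIm] at hz
      have hz2 : z.im ∈ Set.uIcc y₁ y₂ := by simpa using hz.2
      exact ((hF z hz2).mul (by fun_prop)).differentiableWithinAt)
  simp only [mul_re, ofReal_re, Complex.I_re, mul_zero, ofReal_im, Complex.I_im, mul_one, sub_self, mul_im,
    add_zero, zero_add, add_re, natCast_re, add_im, natCast_im, ofReal_zero, ofReal_natCast] at key
  have hside : (∫ y : ℝ in y₁..y₂, F (D + y * I) * e (-(((k / D : ℚ) : ℂ) * (D + y * I)))) =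
      ∫ y : ℝ in y₁..y₂, F (y * I) * e (-(((k / D : ℚ) : ℂ) * (y * I))) := by
    refine intervalIntegral.integral_congr fun y hy => ?_
    rw [add_comm (D : ℂ), hper _ (by simpa using hy), e_neg_rat_mul_add_nat hD]
  rw [hside, add_sub_assoc, sub_self, add_zero, sub_eq_zero] at key
  simp only [fourierInt, key]

lemma norm_fourierInt_le {D : ℕ} (hD : 0 < D) {F : ℂ → ℂ} {y C : ℝ} (n : ℚ)
    (hC : ∀ x : ℝ, x ∈ Set.Icc (0 : ℝ) D → ‖F (x + y * I)‖ ≤ C) :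
    ‖fourierInt D F y n‖ ≤ C * Real.exp (2 * Real.pi * n * y) := by
  have hD' : (0 : ℝ) < D := by exact_mod_cast hD
  have h := intervalIntegral.norm_integral_le_of_norm_le_const (a := (0 : ℝ)) (b := D)
    (f := fun x : ℝ => F (x + y * I) * e (-(n * (x + y * I))))
    (C := C * Real.exp (2 * Real.pi * n * y)) (by
      intro x hx
      rw [Set.uIoc_of_le hD'.le] at hx
      rw [norm_mul, norm_e]
      have : (-((n : ℂ) * (x + y * I))).im = -(n * y) := by simp
      rw [this, show -2 * Real.pi * -(n * y) = 2 * Real.pi * n * y by ring]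
      exact mul_le_mul_of_nonneg_right (hC x ⟨hx.1.le, hx.2⟩) (Real.exp_pos _).le)
  rw [fourierInt, norm_mul, norm_inv, Complex.norm_natCast]
  rw [sub_zero, abs_of_pos hD'] at h
  calc (D : ℝ)⁻¹ * _ ≤ (D : ℝ)⁻¹ * (C * Real.exp (2 * Real.pi * n * y) * D) := by gcongr
    _ = _ := by field_simp

/-- The Fourier series of a continuous periodic function represents it, if it is summable. -/
lemma hasSum_fourierInt_of_summable {D : ℕ} (hD : 0 < D) {F : ℂ → ℂ} {y : ℝ}
    (hc : Continuous fun x : ℝ => F (x + y * I))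
    (hper : ∀ x : ℝ, F (x + y * I + D) = F (x + y * I))
    (hs : Summable fun k : ℤ => fourierInt D F y (k / D) * e ((k / D : ℚ) * (y * I))) (x : ℝ) :
    HasSum (fun k : ℤ => fourierInt D F y (k / D) * e ((k / D : ℚ) * (x + y * I)))
      (F (x + y * I)) := by
  have hD' : (0 : ℝ) < D := by exact_mod_cast hD
  have hD'' : (D : ℂ) ≠ 0 := by exact_mod_cast hD.ne'
  have : Fact ((0 : ℝ) < D) := ⟨hD'⟩
  have hp : Function.Periodic (fun x : ℝ => F (x + y * I)) (D : ℝ) := by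
    intro x
    dsimp only
    rw [← hper x]
    congr 1
    push_cast
    ring
  let g : C(AddCircle (D : ℝ), ℂ) := ⟨hp.lift, continuous_coinduced_dom.mpr hc⟩
  have hg : ∀ x : ℝ, g (x : AddCircle (D : ℝ)) = F (x + y * I) := fun x => rfl
  have hcoef : ∀ k : ℤ, fourierCoeff g k =
      fourierInt D F y (k / D) * e ((k / D : ℚ) * (y * I)) := by
    intro k
    rw [fourierCoeff_eq_intervalIntegral _ _ 0, fourierInt, zero_add]
    rw [mul_assoc, ← intervalIntegral.integral_mul_const]
    rw [Complex.real_smul]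
    congr 1
    · simp
    refine intervalIntegral.integral_congr fun t _ => ?_
    rw [hg, fourier_coe_apply, smul_eq_mul, mul_comm, mul_assoc (F _), ← e_add]
    congr 1
    rw [e]
    congr 1
    push_cast
    field_simp
    ring
  have h := has_pointwise_sum_fourier_series_of_summable (f := g) ((summable_congr hcoef).mpr hs)
    (x : AddCircle (D : ℝ))
  rw [hg] at h
  convert h using 2 with k
  rw [hcoef, fourier_coe_apply, smul_eq_mul, mul_assoc]
  congr 1
  rw [mul_add, e_add, mul_comm]
  congr 1
  rw [e]
  congr 1
  push_cast
  field_simp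

lemma summable_pow_natAbs {ρ : ℝ} (h0 : 0 ≤ ρ) (h1 : ρ < 1) :
    Summable fun k : ℤ => ρ ^ k.natAbs := by
  refine Summable.of_nat_of_neg ?_ ?_ <;>
  simpa using summable_geometric_of_lt_one h0 h1

/-- A function that is holomorphic and periodic on a horizontal strip has a Fourier expansion. -/
lemma hasSum_fourierInt {D : ℕ} (hD : 0 < D) {F : ℂ → ℂ} {y₁ y₂ : ℝ}
    (hF : ∀ z : ℂ, y₁ < z.im → z.im < y₂ → DifferentiableAt ℂ F z)
    (hper : ∀ z : ℂ, y₁ < z.im → z.im < y₂ → F (z + D) = F z)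
    {y : ℝ} (hy₁ : y₁ < y) (hy₂ : y < y₂) {z : ℂ} (hz₁ : y₁ < z.im) (hz₂ : z.im < y₂) :
    HasSum (fun k : ℤ => fourierInt D F y (k / D) * e ((k / D : ℚ) * z)) (F z) := by
  have hD' : (0 : ℝ) < D := by exact_mod_cast hD
  have hmove : ∀ y' : ℝ, y₁ < y' → y' < y₂ → ∀ k : ℤ,
      fourierInt D F y' (k / D) = fourierInt D F z.im (k / D) := by
    intro y' h1 h2 k
    have hsub : ∀ t ∈ Set.uIcc y' z.im, y₁ < t ∧ t < y₂ := by
      intro t ht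
      rw [Set.mem_uIcc] at ht
      rcases ht with h | h
      · exact ⟨h1.trans_le h.1, h.2.trans_lt hz₂⟩
      · exact ⟨hz₁.trans_le h.1, h.2.trans_lt h2⟩
    exact fourierInt_eq_of_differentiableAt hD (fun w hw => hF w (hsub _ hw).1 (hsub _ hw).2)
      (fun w hw => hper w (hsub _ hw).1 (hsub _ hw).2) k
  simp only [hmove y hy₁ hy₂]
  have hcont : ∀ y' : ℝ, y₁ < y' → y' < y₂ → Continuous fun x : ℝ => F (x + y' * I) := by
    intro y' h1 h2
    rw [continuous_iff_continuousAt]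
    intro x
    have hx : DifferentiableAt ℂ F (x + y' * I) := hF _ (by simpa using h1) (by simpa using h2)
    exact ContinuousAt.comp (f := fun x : ℝ => (x + y' * I : ℂ)) hx.continuousAt (by fun_prop)
  have hbd : ∀ y' : ℝ, y₁ < y' → y' < y₂ → ∃ C : ℝ, 0 ≤ C ∧
      ∀ k : ℤ, ‖fourierInt D F z.im (k / D)‖ ≤ C * Real.exp (2 * Real.pi * (k / D : ℚ) * y') := by
    intro y' h1 h2
    obtain ⟨C, hC⟩ := (isCompact_Icc (a := (0 : ℝ)) (b := D)).exists_bound_of_continuousOn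
      (hcont y' h1 h2).continuousOn
    refine ⟨max C 0, le_max_right _ _, fun k => ?_⟩
    rw [← hmove y' h1 h2]
    exact norm_fourierInt_le hD _ fun x hx => (hC x hx).trans (le_max_left _ _)
  obtain ⟨ya, ha1, ha2⟩ := exists_between hz₁
  obtain ⟨yb, hb1, hb2⟩ := exists_between hz₂
  obtain ⟨Ca, hCa0, hCa⟩ := hbd ya ha1 (ha2.trans hz₂)
  obtain ⟨Cb, hCb0, hCb⟩ := hbd yb (hz₁.trans hb1) hb2
  set δ := min (z.im - ya) (yb - z.im) with hδ
  have hδ0 : 0 < δ := lt_min (by linarith) (by linarith)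
  have hz : ((z.re : ℝ) : ℂ) + (z.im : ℝ) * I = z := Complex.re_add_im z
  have hs : Summable fun k : ℤ =>
      fourierInt D F z.im (k / D) * e ((k / D : ℚ) * ((z.im : ℝ) * I)) := by
    refine Summable.of_norm_bounded
      (g := fun k : ℤ => (max Ca Cb) * (Real.exp (-2 * Real.pi * δ / D)) ^ k.natAbs)
      ((summable_pow_natAbs (Real.exp_pos _).le (Real.exp_lt_one_iff.mpr ?_)).mul_left _) ?_
    · rw [div_neg_iff]
      exact Or.inr ⟨by nlinarith [Real.pi_pos], hD'⟩
    intro k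
    rw [norm_mul, norm_e, ← Real.exp_nat_mul]
    have him : (((k / D : ℚ) : ℂ) * ((z.im : ℝ) * I)).im = k / D * z.im := by
      have h0 : ((k : ℂ) / D) = ((k / D : ℝ) : ℂ) := by push_cast; rfl
      push_cast
      rw [h0]
      simp
    rw [him]
    rcases le_total 0 k with hk | hk
    · have hk' : ((k.natAbs : ℕ) : ℝ) = k := by
        rw [Nat.cast_natAbs, abs_of_nonneg hk]
      calc _ ≤ Ca * Real.exp (2 * Real.pi * (k / D : ℚ) * ya) *
            Real.exp (-2 * Real.pi * (k / D * z.im)) := by gcongr; exact hCa k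
        _ ≤ _ := by
          rw [mul_assoc, ← Real.exp_add]
          refine mul_le_mul (le_max_left _ _) (Real.exp_le_exp.mpr ?_) (Real.exp_pos _).le
            (hCa0.trans (le_max_left _ _))
          rw [hk']
          have h1 : δ ≤ z.im - ya := min_le_left _ _
          have h2 : (0 : ℝ) ≤ 2 * Real.pi * (k / D) := by
            have : (0 : ℝ) ≤ k := by exact_mod_cast hk
            positivity
          push_cast
          calc _ = -(2 * Real.pi * (k / D) * (z.im - ya)) := by ring
            _ ≤ -(2 * Real.pi * (k / D) * δ) := by gcongr
            _ = _ := by ring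
    · have hk' : ((k.natAbs : ℕ) : ℝ) = -k := by
        rw [Nat.cast_natAbs, abs_of_nonpos hk, Int.cast_neg]
      calc _ ≤ Cb * Real.exp (2 * Real.pi * (k / D : ℚ) * yb) *
            Real.exp (-2 * Real.pi * (k / D * z.im)) := by gcongr; exact hCb k
        _ ≤ _ := by
          rw [mul_assoc, ← Real.exp_add]
          refine mul_le_mul (le_max_right _ _) (Real.exp_le_exp.mpr ?_) (Real.exp_pos _).le
            (hCb0.trans (le_max_right _ _))
          rw [hk']
          have h1 : δ ≤ yb - z.im := min_le_right _ _
          have h2 : (0 : ℝ) ≤ 2 * Real.pi * (-k / D) := by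
            have : (k : ℝ) ≤ 0 := by exact_mod_cast hk
            have : (0 : ℝ) ≤ -k := by linarith
            positivity
          push_cast
          calc _ = -(2 * Real.pi * (-k / D) * (yb - z.im)) := by ring
            _ ≤ -(2 * Real.pi * (-k / D) * δ) := by gcongr
            _ = _ := by ring
  have h := hasSum_fourierInt_of_summable hD (hcont z.im hz₁ hz₂)
    (fun x => hper _ (by simpa using hz₁) (by simpa using hz₂)) hs z.re
  rwa [hz] at h

lemma integral_e_int {D : ℕ} (hD : 0 < D) (k : ℤ) :
    (∫ x in (0 : ℝ)..D, e ((k / D : ℚ) * x)) = if k = 0 then (D : ℂ) else 0 := by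
  have hD'' : (D : ℂ) ≠ 0 := by exact_mod_cast hD.ne'
  split_ifs with h
  · subst h
    simp
  · have hk : (k : ℂ) ≠ 0 := by exact_mod_cast h
    have hc : (2 * Real.pi * I * (k / D) : ℂ) ≠ 0 :=
      mul_ne_zero Complex.two_pi_I_ne_zero (div_ne_zero hk hD'')
    have h1 := integral_exp_mul_complex (a := 0) (b := D) hc
    have h2 : ∀ x : ℝ, e ((k / D : ℚ) * x) = Complex.exp (2 * Real.pi * I * (k / D) * x) := by
      intro x
      rw [e]
      push_cast
      congr 1
      ring
    simp only [h2, h1]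
    have h3 : Complex.exp (2 * Real.pi * I * (k / D) * ((D : ℝ) : ℂ)) = 1 := by
      rw [← e_intCast k, e]
      congr 1
      push_cast
      field_simp
    rw [h3]
    simp

/-- Termwise integration of a Fourier expansion. -/
lemma fourierInt_of_hasSum {D : ℕ} (hD : 0 < D) {F : ℂ → ℂ} {y : ℝ} {c : ℤ → ℂ}
    (h : ∀ x : ℝ, HasSum (fun k : ℤ => c k * e ((k / D : ℚ) * (x + y * I))) (F (x + y * I)))
    (k : ℤ) : fourierInt D F y (k / D) = c k := by
  have hD' : (D : ℂ) ≠ 0 := by exact_mod_cast hD.ne'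
  have hnorm : ∀ (j : ℤ) (x : ℝ), ‖c j * e ((j / D : ℚ) * (x + y * I))‖ =
      ‖c j * e ((j / D : ℚ) * (y * I))‖ := by
    intro j x
    rw [mul_add, e_add, norm_mul, norm_mul, norm_mul, norm_e (((j / D : ℚ) : ℂ) * x)]
    simp
  have hs : Summable fun j : ℤ => ‖c j * e ((j / D : ℚ) * (y * I))‖ := by
    have := (h 0).summable.norm
    simpa using this
  have hint := intervalIntegral.hasSum_integral_of_dominated_convergence
    (μ := MeasureTheory.volume) (a := 0) (b := D)
    (F := fun (j : ℤ) (x : ℝ) =>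
      c j * e ((j / D : ℚ) * (x + y * I)) * e (-((k / D : ℚ) * (x + y * I))))
    (f := fun x : ℝ => F (x + y * I) * e (-((k / D : ℚ) * (x + y * I))))
    (bound := fun j _ => ‖c j * e ((j / D : ℚ) * (y * I))‖ * ‖e (-((k / D : ℚ) * (y * I)))‖)
    (fun j => Continuous.aestronglyMeasurable (by fun_prop))
    (fun j => Eventually.of_forall fun x _ => by
      rw [norm_mul, hnorm, mul_add, neg_add, e_add, norm_mul _ (e (-(_ * (y * I)))),
        norm_e (-(((k / D : ℚ) : ℂ) * x))]
      simp)
    (Eventually.of_forall fun x _ => hs.mul_right _)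
    intervalIntegrable_const
    (Eventually.of_forall fun x _ => (h x).mul_right _)
  have hterm : ∀ j : ℤ, (∫ x in (0 : ℝ)..D,
      c j * e ((j / D : ℚ) * (x + y * I)) * e (-((k / D : ℚ) * (x + y * I)))) =
      if j = k then c k * D else 0 := by
    intro j
    have h1 : ∀ x : ℝ, c j * e ((j / D : ℚ) * (x + y * I)) * e (-((k / D : ℚ) * (x + y * I))) =
        (c j * e (((j - k : ℤ) / D : ℚ) * (y * I))) * e (((j - k : ℤ) / D : ℚ) * x) := by
      intro x
      rw [mul_assoc, mul_assoc, ← e_add, ← e_add]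
      congr 2
      push_cast
      ring
    simp only [h1]
    rw [intervalIntegral.integral_const_mul, integral_e_int hD]
    by_cases hjk : j = k
    · subst hjk
      simp
    · rw [if_neg (sub_ne_zero.mpr hjk), if_neg hjk, mul_zero]
  simp only [hterm] at hint
  have := hint.unique (hasSum_ite_eq k (c k * D))
  rw [fourierInt, this]
  field_simp

/-- A continuous periodic function on a line with vanishing Fourier coefficients vanishes. -/
lemma eq_zero_of_fourierInt_eq_zero {D : ℕ} (hD : 0 < D) {F : ℂ → ℂ} {y : ℝ}
    (hc : Continuous fun x : ℝ => F (x + y * I))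
    (hper : ∀ x : ℝ, F (x + y * I + D) = F (x + y * I))
    (h0 : ∀ k : ℤ, fourierInt D F y (k / D) = 0) (x : ℝ) : F (x + y * I) = 0 := by
  have := hasSum_fourierInt_of_summable hD hc hper (by simp [h0, summable_zero]) x
  simp only [h0, zero_mul] at this
  exact this.unique hasSum_zero

lemma fourierInt_const_mul (D : ℕ) (F : ℂ → ℂ) (y : ℝ) (n : ℚ) (a : ℂ) :
    fourierInt D (fun z => a * F z) y n = a * fourierInt D F y n := by
  simp only [fourierInt, mul_assoc]
  rw [intervalIntegral.integral_const_mul]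
  ring

lemma fourierInt_sum {ι : Type*} (s : Finset ι) (D : ℕ) (F : ι → ℂ → ℂ) (y : ℝ) (n : ℚ)
    (hc : ∀ i ∈ s, Continuous fun x : ℝ => F i (x + y * I)) :
    fourierInt D (fun z => ∑ i ∈ s, F i z) y n = ∑ i ∈ s, fourierInt D (F i) y n := by
  simp only [fourierInt, Finset.sum_mul]
  rw [intervalIntegral.integral_finsetSum, Finset.mul_sum]
  intro i hi
  apply Continuous.intervalIntegrable
  exact (hc i hi).mul (by fun_prop)

lemma fourierInt_add_real {D : ℕ} (hD : 0 < D) {F : ℂ → ℂ} {y : ℝ}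
    (hper : ∀ x : ℝ, F (x + y * I + D) = F (x + y * I)) (t : ℝ) (k : ℤ) :
    fourierInt D (fun z => F (z + t)) y (k / D) =
      e ((k / D : ℚ) * t) * fourierInt D F y (k / D) := by
  set G : ℝ → ℂ := fun x => F (x + y * I) * e (-((k / D : ℚ) * (x + y * I))) with hG
  have hp : Function.Periodic G D := by
    intro x
    simp only [hG]
    have : ((x + (D : ℝ) : ℝ) : ℂ) + y * I = x + y * I + D := by push_cast; ring
    rw [this, hper, e_neg_rat_mul_add_nat hD]
  have h1 : ∀ x : ℝ, F (x + y * I + t) * e (-((k / D : ℚ) * (x + y * I))) =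
      e ((k / D : ℚ) * t) * G (x + t) := by
    intro x
    simp only [hG]
    rw [mul_left_comm, ← e_add]
    congr 2
    · push_cast; ring
    · push_cast; ring
  simp only [fourierInt, h1]
  rw [intervalIntegral.integral_const_mul,
    intervalIntegral.integral_comp_add_right (fun x => G x) t]
  have := hp.intervalIntegral_add_eq t 0
  rw [zero_add, add_comm ((D : ℝ)) t, this, zero_add]
  ring

/-- A series over the rational numbers whose terms are supported on `(1/D) ℤ` as a series over the
integers. -/
lemma hasSum_rat_iff {D : ℕ} (hD : 0 < D) {c : ℚ → ℂ} (hc : ∀ n, c n ≠ 0 → ∃ k : ℤ, n = k / D)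
    (g : ℚ → ℂ) (S : ℂ) :
    HasSum (fun n : ℚ => c n * g n) S ↔
      HasSum (fun k : ℤ => c ((k : ℚ) / D) * g ((k : ℚ) / D)) S := by
  have hD' : (D : ℚ) ≠ 0 := by exact_mod_cast hD.ne'
  have hinj : Function.Injective fun k : ℤ => (k : ℚ) / D := by
    intro a b hab
    simpa [div_left_inj' hD'] using hab
  rw [← hinj.hasSum_iff]
  · rfl
  · intro n hn
    by_contra h
    obtain ⟨k, hk⟩ := hc n (left_ne_zero_of_mul h)
    exact hn ⟨k, hk.symm⟩


/-! ### The leading term of a Jacobi form as a function on a tube around the real axis -/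

/-- The local parameter `e(z/2) - e(-z/2)` at the integers. -/
def sinFactor (z : ℂ) : ℂ := e (z / 2) - e (-z / 2)

@[fun_prop] lemma differentiable_sinFactor : Differentiable ℂ sinFactor := by
  unfold sinFactor; fun_prop

@[fun_prop] lemma continuous_sinFactor : Continuous sinFactor :=
  differentiable_sinFactor.continuous

lemma sinFactor_eq_zero_iff {z : ℂ} : sinFactor z = 0 ↔ ∃ k : ℤ, z = k := by
  rw [sinFactor, sub_eq_zero, e_eq_e_iff]
  refine exists_congr fun k => ⟨fun h => ?_, fun h => by rw [h]; ring⟩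
  linear_combination h

@[simp] lemma sinFactor_intCast (k : ℤ) : sinFactor k = 0 := sinFactor_eq_zero_iff.mpr ⟨k, rfl⟩

lemma e_neg_intCast_div_two (k : ℤ) : e (-(k / 2 : ℂ)) = e (k / 2) := by
  rw [← e_add_intCast _ k]; congr 1; ring

lemma sinFactor_add_intCast (z : ℂ) (k : ℤ) : sinFactor (z + k) = e (k / 2) * sinFactor z := by
  rw [sinFactor, sinFactor, add_div, e_add, neg_add, add_div, e_add, neg_div (2 : ℂ) (k : ℂ),
    e_neg_intCast_div_two]
  ring

lemma sinFactor_add_two (z : ℂ) : sinFactor (z + 2) = sinFactor z := by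
  have h := sinFactor_add_intCast z 2
  have h1 : e (((2 : ℤ) : ℂ) / 2) = 1 := by
    have := e_intCast 1
    rw [← this]; congr 1; push_cast; norm_num
  rw [h1, one_mul] at h
  exact_mod_cast h

lemma mem_lattice_iff_of_abs_im_lt {τ : ℍ} {z : ℂ} (h : |z.im| < τ.im) :
    z ∈ lattice τ ↔ sinFactor z = 0 := by
  rw [sinFactor_eq_zero_iff]
  constructor
  · rintro ⟨l, μ, rfl⟩
    have h1 : ((l : ℂ) * (τ : ℂ) + μ).im = l * τ.im := by simp
    rw [h1, abs_mul, abs_of_pos τ.im_pos] at h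
    have h2 : |(l : ℝ)| < 1 := by
      by_contra hc
      nlinarith [τ.im_pos]
    have h3 : |l| < 1 := by exact_mod_cast h2
    rw [Int.abs_lt_one_iff] at h3
    subst h3
    exact ⟨μ, by simp⟩
  · rintro ⟨k, rfl⟩
    exact ⟨0, k, by simp⟩

lemma eventually_sinFactor_ne_zero (k : ℤ) : ∀ᶠ z in 𝓝[≠] (k : ℂ), sinFactor z ≠ 0 := by
  have h : ∀ᶠ z : ℂ in 𝓝 (k : ℂ), dist z k < 1 := Metric.ball_mem_nhds _ one_pos
  filter_upwards [h.filter_mono nhdsWithin_le_nhds, self_mem_nhdsWithin] with z hz hne h0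
  obtain ⟨j, rfl⟩ := sinFactor_eq_zero_iff.mp h0
  have h1 : ((j : ℤ) : ℂ) - k = ((j - k : ℤ) : ℂ) := by push_cast; rfl
  rw [dist_eq_norm, h1, Complex.norm_intCast] at hz
  have h2 : |j - k| < 1 := by exact_mod_cast hz
  rw [Int.abs_lt_one_iff, sub_eq_zero] at h2
  exact hne (by simp [h2])

/-- The properties of a weakly holomorphic Jacobi form `φ` with leading term `f` of order `-ν` at
`z = 0` that determine the Fourier expansion of this leading term. Here, `e(β)` is the common
eigenvalue of `φ` and `f` under the translation `τ ↦ τ + 1`. -/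
structure HasLeadingTerm (φ : ℍ → ℂ → ℂ) (ν : ℤ) (f : ℍ → ℂ) (β : ℚ) : Prop where
  regular : ∀ (τ : ℍ) (z : ℂ), z ∉ lattice τ →
    AnalyticAt ℂ (fun p : ℂ × ℂ => φ (ofComplex p.1) p.2) ((τ : ℂ), z)
  holo : AnalyticOnNhd ℂ (fun t : ℂ => f (ofComplex t)) {t : ℂ | 0 < t.im}
  tendsto : ∀ τ : ℍ, Tendsto (fun z : ℂ => sinFactor z ^ ν * φ τ z) (𝓝[≠] 0) (𝓝 (f τ))
  add_int : ∀ (τ : ℍ) (z : ℂ), z ∉ lattice τ → ∀ k : ℤ, φ τ (z + k) = φ τ z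
  translate : ∀ (τ : ℍ) (z : ℂ), z ∉ lattice τ → φ ((1 : ℝ) +ᵥ τ) z = e β * φ τ z
  translate_leading : ∀ τ : ℍ, f ((1 : ℝ) +ᵥ τ) = e β * f τ

/-- The function `(e(z/2) - e(-z/2))^ν φ(t, z)`, extended to the integers. -/
def leadingTerm (φ : ℍ → ℂ → ℂ) (ν : ℤ) (f : ℍ → ℂ) (t z : ℂ) : ℂ :=
  if sinFactor z = 0 then e (z / 2) ^ ν * f (ofComplex t) else sinFactor z ^ ν * φ (ofComplex t) z

section LeadingTerm

variable {φ : ℍ → ℂ → ℂ} {ν : ℤ} {f : ℍ → ℂ} {β : ℚ}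

lemma leadingTerm_of_ne {z : ℂ} (hz : sinFactor z ≠ 0) (t : ℂ) :
    leadingTerm φ ν f t z = sinFactor z ^ ν * φ (ofComplex t) z := if_neg hz

lemma leadingTerm_intCast (k : ℤ) (t : ℂ) :
    leadingTerm φ ν f t k = e (k / 2) ^ ν * f (ofComplex t) := if_pos (sinFactor_intCast k)

lemma coe_ofComplex {t : ℂ} (ht : 0 < t.im) : ((ofComplex t : ℍ) : ℂ) = t := by
  rw [ofComplex_apply_of_im_pos ht]

lemma ofComplex_im {t : ℂ} (ht : 0 < t.im) : (ofComplex t).im = t.im := by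
  rw [ofComplex_apply_of_im_pos ht]; rfl

lemma not_mem_lattice_ofComplex {t z : ℂ} (h : |z.im| < t.im) (hz : sinFactor z ≠ 0) :
    z ∉ lattice (ofComplex t) := by
  have ht : 0 < t.im := (abs_nonneg _).trans_lt h
  rwa [mem_lattice_iff_of_abs_im_lt (by rwa [ofComplex_im ht])]

lemma ofComplex_add_one {t : ℂ} (ht : 0 < t.im) :
    ofComplex (t + 1) = (1 : ℝ) +ᵥ ofComplex t := by
  apply UpperHalfPlane.ext
  rw [coe_ofComplex (by simpa using ht), UpperHalfPlane.coe_vadd, coe_ofComplex ht]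
  push_cast
  ring

/-- The tube on which the leading term is considered. -/
def tube : Set (ℂ × ℂ) := {p | |p.2.im| < p.1.im}

namespace HasLeadingTerm

variable (h : HasLeadingTerm φ ν f β)
include h

lemma tendsto_intCast {t : ℂ} (ht : 0 < t.im) (k : ℤ) :
    Tendsto (fun z => sinFactor z ^ ν * φ (ofComplex t) z) (𝓝[≠] (k : ℂ))
      (𝓝 (leadingTerm φ ν f t k)) := by
  rw [leadingTerm_intCast]
  have hmap : Tendsto (fun z : ℂ => z - k) (𝓝[≠] (k : ℂ)) (𝓝[≠] 0) := by
    refine tendsto_nhdsWithin_iff.mpr ⟨?_, ?_⟩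
    · have : Tendsto (fun z : ℂ => z - k) (𝓝 (k : ℂ)) (𝓝 ((k : ℂ) - k)) :=
        (continuous_id.sub continuous_const).tendsto _
      rw [sub_self] at this
      exact this.mono_left nhdsWithin_le_nhds
    · filter_upwards [self_mem_nhdsWithin] with z hz
      exact sub_ne_zero.mpr hz
  refine (((h.tendsto (ofComplex t)).comp hmap).const_mul (e (k / 2) ^ ν)).congr' ?_
  have him : ∀ᶠ z : ℂ in 𝓝 (k : ℂ), |z.im| < t.im := by
    apply (continuous_abs.comp Complex.continuous_im).continuousAt.eventually_lt_const
    simpa using ht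
  filter_upwards [him.filter_mono nhdsWithin_le_nhds, eventually_sinFactor_ne_zero k] with z hz hs
  have hs' : sinFactor (z - k) ≠ 0 := by
    intro h0
    obtain ⟨j, hj⟩ := sinFactor_eq_zero_iff.mp h0
    exact hs (sinFactor_eq_zero_iff.mpr ⟨j + k, by push_cast; rw [← hj]; ring⟩)
  have h1 := h.add_int (ofComplex t) (z - k) (not_mem_lattice_ofComplex (by simpa using hz) hs') k
  have h2 := sinFactor_add_intCast (z - k) k
  rw [sub_add_cancel] at h1 h2
  rw [Function.comp_apply, h1, h2, mul_zpow, mul_assoc]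

lemma analyticAt {t z : ℂ} (hp : |z.im| < t.im) (hz : sinFactor z ≠ 0) :
    AnalyticAt ℂ (fun p : ℂ × ℂ => leadingTerm φ ν f p.1 p.2) (t, z) := by
  have ht : 0 < t.im := (abs_nonneg _).trans_lt hp
  have h1 := h.regular (ofComplex t) z (not_mem_lattice_ofComplex hp hz)
  rw [coe_ofComplex ht] at h1
  have h2 : AnalyticAt ℂ (fun p : ℂ × ℂ => sinFactor p.2 ^ ν) (t, z) := by
    have h3 : AnalyticAt ℂ sinFactor z := differentiable_sinFactor.analyticAt z
    have h4 : AnalyticAt ℂ (fun p : ℂ × ℂ => sinFactor p.2) (t, z) :=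
      AnalyticAt.fun_comp (f := fun p : ℂ × ℂ => p.2) h3 analyticAt_snd
    exact h4.zpow hz
  refine (h2.mul h1).congr ?_
  have h5 : ∀ᶠ p : ℂ × ℂ in 𝓝 (t, z), sinFactor p.2 ≠ 0 :=
    (continuous_sinFactor.comp continuous_snd).continuousAt.eventually_ne hz
  filter_upwards [h5] with p hp
  exact (leadingTerm_of_ne hp _).symm

lemma differentiableAt_snd {t z : ℂ} (hp : |z.im| < t.im) :
    DifferentiableAt ℂ (leadingTerm φ ν f t) z := by
  have hoff : ∀ z : ℂ, |z.im| < t.im → sinFactor z ≠ 0 →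
      DifferentiableAt ℂ (leadingTerm φ ν f t) z := by
    intro z hz hs
    have := (h.analyticAt hz hs).differentiableAt
    exact DifferentiableAt.comp (g := fun p : ℂ × ℂ => leadingTerm φ ν f p.1 p.2)
      (f := fun z => (t, z)) z this (by fun_prop)
  by_cases hs : sinFactor z = 0
  · obtain ⟨k, rfl⟩ := sinFactor_eq_zero_iff.mp hs
    refine (analyticAt_of_differentiable_on_punctured_nhds_of_continuousAt ?_ ?_).differentiableAt
    · have him : ∀ᶠ z : ℂ in 𝓝 (k : ℂ), |z.im| < t.im :=
        (continuous_abs.comp Complex.continuous_im).continuousAt.eventually_lt_const hp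
      filter_upwards [him.filter_mono nhdsWithin_le_nhds, eventually_sinFactor_ne_zero k]
        with z hz hs
      exact hoff z hz hs
    · rw [continuousAt_iff_punctured_nhds]
      refine (h.tendsto_intCast ((abs_nonneg _).trans_lt hp) k).congr' ?_
      filter_upwards [eventually_sinFactor_ne_zero k] with z hz
      exact (leadingTerm_of_ne hz _).symm
  · exact hoff z hp hs

lemma differentiableAt_leading {t : ℂ} (ht : 0 < t.im) :
    DifferentiableAt ℂ (fun t : ℂ => f (ofComplex t)) t := (h.holo t ht).differentiableAt

lemma differentiableAt_fst {t z : ℂ} (hp : |z.im| < t.im) :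
    DifferentiableAt ℂ (fun t => leadingTerm φ ν f t z) t := by
  by_cases hs : sinFactor z = 0
  · obtain ⟨k, rfl⟩ := sinFactor_eq_zero_iff.mp hs
    simp only [leadingTerm_intCast]
    exact (h.differentiableAt_leading ((abs_nonneg _).trans_lt hp)).const_mul _
  · exact DifferentiableAt.comp (g := fun p : ℂ × ℂ => leadingTerm φ ν f p.1 p.2)
      (f := fun t => (t, z)) t (h.analyticAt hp hs).differentiableAt (by fun_prop)

/-- At an integer `k`, the maximum principle on a small disc around `k` bounds the leading term by
its values on the boundary of the disc, where it is jointly continuous; continuity at `k` follows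
from the Schwarz lemma. -/
lemma continuousAt {p : ℂ × ℂ} (hp : p ∈ tube) :
    ContinuousAt (fun p : ℂ × ℂ => leadingTerm φ ν f p.1 p.2) p := by
  obtain ⟨t₀, z⟩ := p
  by_cases hs : sinFactor z = 0
  swap
  · exact (h.analyticAt hp hs).continuousAt
  obtain ⟨k, rfl⟩ := sinFactor_eq_zero_iff.mp hs
  have ht₀ : 0 < t₀.im := (abs_nonneg _).trans_lt hp
  set r : ℝ := min (1 / 2) (t₀.im / 2) with hr
  have hr0 : 0 < r := lt_min (by norm_num) (by linarith)
  have hr1 : r ≤ 1 / 2 := min_le_left _ _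
  have hr2 : r ≤ t₀.im / 2 := min_le_right _ _
  have him : ∀ t ∈ Metric.closedBall t₀ (t₀.im / 4), ∀ z ∈ Metric.closedBall (k : ℂ) r,
      |z.im| < t.im := by
    intro t ht z hz
    rw [mem_closedBall_iff_norm] at ht hz
    have h1 := (Complex.abs_im_le_norm (t - t₀)).trans ht
    have h2 := (Complex.abs_im_le_norm (z - k)).trans hz
    simp only [sub_im, intCast_im, sub_zero] at h1 h2
    have := (abs_le.mp h1).1
    linarith
  have hcomp : IsCompact (Metric.closedBall t₀ (t₀.im / 4) ×ˢ Metric.sphere (k : ℂ) r) :=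
    (isCompact_closedBall _ _).prod (isCompact_sphere _ _)
  obtain ⟨B, hB⟩ := hcomp.exists_bound_of_continuousOn
    (f := fun p : ℂ × ℂ => leadingTerm φ ν f p.1 p.2) (by
      rintro ⟨t, z⟩ ⟨ht, hz⟩
      refine (h.analyticAt (him t ht z (Metric.sphere_subset_closedBall hz)) ?_).continuousAt
        |>.continuousWithinAt
      intro h0
      obtain ⟨j, hj⟩ := sinFactor_eq_zero_iff.mp h0
      have h1 : ((j : ℤ) : ℂ) - k = ((j - k : ℤ) : ℂ) := by push_cast; rfl
      rw [show z = j from hj, mem_sphere_iff_norm, h1, Complex.norm_intCast] at hz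
      have h2 : |((j - k : ℤ) : ℝ)| < 1 := by rw [hz]; linarith
      have h3 : |j - k| < 1 := by exact_mod_cast h2
      rw [Int.abs_lt_one_iff] at h3
      rw [h3] at hz
      simp at hz
      linarith)
  have hbound : ∀ t ∈ Metric.closedBall t₀ (t₀.im / 4), ∀ z ∈ Metric.ball (k : ℂ) r,
      ‖leadingTerm φ ν f t z‖ ≤ B := by
    intro t ht z hz
    refine Complex.norm_le_of_forall_mem_frontier_norm_le (U := Metric.ball (k : ℂ) r)
      Metric.isBounded_ball ?_ ?_ (subset_closure hz)
    · apply DifferentiableOn.diffContOnCl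
      rw [closure_ball _ hr0.ne']
      exact fun w hw => (h.differentiableAt_snd (him t ht w hw)).differentiableWithinAt
    · intro w hw
      rw [frontier_ball _ hr0.ne'] at hw
      exact hB (t, w) ⟨ht, hw⟩
  have hk : (k : ℂ) ∈ Metric.ball (k : ℂ) r := Metric.mem_ball_self hr0
  have hschwarz : ∀ t ∈ Metric.closedBall t₀ (t₀.im / 4), ∀ z ∈ Metric.ball (k : ℂ) r,
      dist (leadingTerm φ ν f t z) (leadingTerm φ ν f t k) ≤ (2 * B) / r * dist z k := by
    intro t ht z hz
    refine Complex.dist_le_div_mul_dist_of_mapsTo_ball (fun w hw => ?_) (fun w hw => ?_) hz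
    · exact (h.differentiableAt_snd (him t ht w
        (Metric.ball_subset_closedBall hw))).differentiableWithinAt
    · rw [mem_closedBall_iff_norm]
      have h1 := hbound t ht w hw
      have h2 := hbound t ht k hk
      linarith [norm_sub_le (leadingTerm φ ν f t w) (leadingTerm φ ν f t k)]
  have hcf : Tendsto (fun p : ℂ × ℂ => leadingTerm φ ν f p.1 k) (𝓝 (t₀, (k : ℂ)))
      (𝓝 (leadingTerm φ ν f t₀ k)) := by
    have h1 := (h.differentiableAt_fst (t := t₀) (z := k) hp).continuousAt
    exact h1.tendsto.comp continuousAt_fst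
  rw [ContinuousAt]
  have hdiff : Tendsto (fun p : ℂ × ℂ => leadingTerm φ ν f p.1 p.2 - leadingTerm φ ν f p.1 k)
      (𝓝 (t₀, (k : ℂ))) (𝓝 0) := by
    refine squeeze_zero_norm' (a := fun p : ℂ × ℂ => (2 * B) / r * dist p.2 k) ?_ ?_
    · have hn : Metric.closedBall t₀ (t₀.im / 4) ×ˢ Metric.ball (k : ℂ) r ∈ 𝓝 (t₀, (k : ℂ)) :=
        prod_mem_nhds (Metric.closedBall_mem_nhds _ (by linarith)) (Metric.ball_mem_nhds _ hr0)
      filter_upwards [hn] with p hp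
      rw [← dist_eq_norm]
      exact hschwarz p.1 hp.1 p.2 hp.2
    · have : Continuous fun p : ℂ × ℂ => (2 * B) / r * dist p.2 k := by fun_prop
      simpa using this.tendsto (t₀, (k : ℂ))
  simpa using hdiff.add hcf

lemma leadingTerm_add_two {t z : ℂ} (hp : |z.im| < t.im) :
    leadingTerm φ ν f t (z + 2) = leadingTerm φ ν f t z := by
  by_cases hs : sinFactor z = 0
  · rw [leadingTerm, if_pos (by rwa [sinFactor_add_two]), leadingTerm, if_pos hs, add_div, e_add]
    have : e (2 / 2) = 1 := by rw [div_self two_ne_zero]; exact_mod_cast e_intCast 1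
    rw [this, mul_one]
  · rw [leadingTerm, if_neg (by rwa [sinFactor_add_two]), leadingTerm, if_neg hs,
      sinFactor_add_two]
    have := h.add_int _ _ (not_mem_lattice_ofComplex hp hs) 2
    push_cast at this
    rw [this]

lemma leadingTerm_translate {t z : ℂ} (hp : |z.im| < t.im) :
    leadingTerm φ ν f (t + 1) z = e β * leadingTerm φ ν f t z := by
  have ht : 0 < t.im := (abs_nonneg _).trans_lt hp
  rw [leadingTerm, leadingTerm, ofComplex_add_one ht]
  split_ifs with hs
  · rw [h.translate_leading, mul_left_comm]
  · rw [h.translate _ _ (not_mem_lattice_ofComplex hp hs), mul_left_comm]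

lemma leadingTerm_add_nat {D : ℕ} (hD : ∃ k : ℤ, β * D = k) {t z : ℂ} (hp : |z.im| < t.im) :
    leadingTerm φ ν f (t + D) z = leadingTerm φ ν f t z := by
  have hn : ∀ n : ℕ, leadingTerm φ ν f (t + n) z = e β ^ n * leadingTerm φ ν f t z := by
    intro n
    induction n with
    | zero => simp
    | succ n ih =>
      have h1 : |z.im| < (t + n).im := by simpa using hp
      rw [Nat.cast_succ, ← add_assoc, h.leadingTerm_translate h1, ih, pow_succ]
      ring
  obtain ⟨k, hk⟩ := hD
  rw [hn, ← e_natCast_mul]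
  have : (D : ℂ) * β = k := by rw [mul_comm]; exact_mod_cast congrArg (fun x : ℚ => (x : ℂ)) hk
  rw [this, e_intCast, one_mul]

end HasLeadingTerm

/-- The Fourier coefficient with frequency `n` in the first variable, on the line `Im t = Y`, of the
leading term. -/
def tubeCoeff (φ : ℍ → ℂ → ℂ) (ν : ℤ) (f : ℍ → ℂ) (D : ℕ) (Y : ℝ) (n : ℚ) (z : ℂ) : ℂ :=
  fourierInt D (fun t => leadingTerm φ ν f t z) Y n

lemma mem_tube_of_lines {x x' y Y : ℝ} (hy : |y| < Y) :
    ((x + Y * I : ℂ), (x' + y * I : ℂ)) ∈ tube := by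
  simpa [tube] using hy

namespace HasLeadingTerm

variable (h : HasLeadingTerm φ ν f β)
include h

lemma continuous_lines {y Y : ℝ} (hy : |y| < Y) :
    Continuous fun p : ℝ × ℝ => leadingTerm φ ν f (p.1 + Y * I) (p.2 + y * I) := by
  rw [continuous_iff_continuousAt]
  intro p
  exact ContinuousAt.comp (g := fun p : ℂ × ℂ => leadingTerm φ ν f p.1 p.2)
    (f := fun p : ℝ × ℝ => ((p.1 + Y * I : ℂ), (p.2 + y * I : ℂ)))
    (h.continuousAt (mem_tube_of_lines hy)) (by fun_prop)

lemma tubeCoeff_eq {D : ℕ} (hD : 0 < D) (hβ : ∃ k : ℤ, β * D = k) {Y₁ Y₂ : ℝ} {z : ℂ}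
    (h₁ : |z.im| < Y₁) (h₂ : |z.im| < Y₂) (k : ℤ) :
    tubeCoeff φ ν f D Y₁ (k / D) z = tubeCoeff φ ν f D Y₂ (k / D) z := by
  have hY : ∀ t ∈ Set.uIcc Y₁ Y₂, |z.im| < t := fun t ht => (lt_min h₁ h₂).trans_le ht.1
  exact fourierInt_eq_of_differentiableAt hD (fun t ht => h.differentiableAt_fst (hY _ ht))
    (fun t ht => h.leadingTerm_add_nat hβ (hY _ ht)) k

lemma continuous_tubeCoeff (D : ℕ) {y Y : ℝ} (hy : |y| < Y) (n : ℚ) :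
    Continuous fun x : ℝ => tubeCoeff φ ν f D Y n (x + y * I) := by
  have hc : Continuous (Function.uncurry fun x t : ℝ =>
      leadingTerm φ ν f (t + Y * I) (x + y * I) * e (-(n * (t + Y * I)))) := by
    have h1 := (h.continuous_lines hy).comp continuous_swap
    exact h1.mul (continuous_e.comp (by fun_prop))
  exact continuous_const.mul
    (intervalIntegral.continuous_parametric_intervalIntegral_of_continuous' hc _ _)

lemma tubeCoeff_add_two (D : ℕ) {Y : ℝ} {z : ℂ} (hz : |z.im| < Y) (n : ℚ) :
    tubeCoeff φ ν f D Y n (z + 2) = tubeCoeff φ ν f D Y n z :=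
  fourierInt_congr _ fun x => h.leadingTerm_add_two (by simpa using hz)

/-- The Fourier coefficients in both variables are independent of the line of integration. -/
lemma fourierInt_tubeCoeff_eq (D : ℕ) {Y y₁ y₂ : ℝ} (h₁ : |y₁| < Y) (h₂ : |y₂| < Y) (n : ℚ)
    (k : ℤ) : fourierInt 2 (tubeCoeff φ ν f D Y n) y₁ (k / (2 : ℕ)) =
      fourierInt 2 (tubeCoeff φ ν f D Y n) y₂ (k / (2 : ℕ)) := by
  have hswap : ∀ y : ℝ, |y| < Y → fourierInt 2 (tubeCoeff φ ν f D Y n) y (k / (2 : ℕ)) =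
      fourierInt D (fun t => fourierInt 2 (leadingTerm φ ν f t) y (k / (2 : ℕ))) Y n := by
    intro y hy
    simp only [fourierInt, tubeCoeff]
    simp only [mul_assoc, ← intervalIntegral.integral_mul_const, intervalIntegral.integral_const_mul]
    rw [MeasureTheory.intervalIntegral_intervalIntegral_swap]
    · rw [mul_left_comm]
      refine congrArg _ (congrArg _ (intervalIntegral.integral_congr fun x _ =>
        intervalIntegral.integral_congr fun x' _ => ?_))
      ring
    · have hc : Continuous (Function.uncurry fun x t : ℝ =>
          leadingTerm φ ν f (t + Y * I) (x + y * I) * (e (-(n * (t + Y * I))) *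
            e (-(((k / (2 : ℕ) : ℚ) : ℂ) * (x + y * I))))) := by
        have h1 := (h.continuous_lines hy).comp continuous_swap
        exact h1.mul ((continuous_e.comp (by fun_prop)).mul (continuous_e.comp (by fun_prop)))
      exact (hc.continuousOn.integrableOn_compact (isCompact_uIcc.prod isCompact_uIcc)).mono_set
        (Set.prod_mono Set.uIoc_subset_uIcc Set.uIoc_subset_uIcc)
  rw [hswap _ h₁, hswap _ h₂]
  refine fourierInt_congr _ fun x => ?_
  have hy : ∀ t ∈ Set.uIcc y₁ y₂, |t| < Y := by
    intro t ht
    rw [abs_lt] at *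
    rw [Set.mem_uIcc] at ht
    constructor <;> rcases ht with ht | ht <;> linarith
  refine fourierInt_eq_of_differentiableAt two_pos (fun z hz => h.differentiableAt_snd ?_)
    (fun z hz => ?_) k
  · simpa using hy _ hz
  · exact_mod_cast h.leadingTerm_add_two (by simpa using hy _ hz)

end HasLeadingTerm

end LeadingTerm


/-! ### Bilateral series dominated by their central term -/

/-- A series `∑ u k` over the integers with `|u k| ≤ |u 0| ρ^|k|` and `ρ ≤ 1/5` is within half of
its central term of this term. -/
lemma norm_sub_le_of_dominated {u : ℤ → ℂ} {S : ℂ} {ρ : ℝ} (h0 : 0 ≤ ρ) (h1 : ρ ≤ 1 / 5)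
    (hu : ∀ k, ‖u k‖ ≤ ‖u 0‖ * ρ ^ k.natAbs) (hs : HasSum u S) : ‖S - u 0‖ ≤ ‖u 0‖ / 2 := by
  have h2 := hasSum_ite_sub_hasSum hs 0
  have hg : HasSum (fun k : ℤ => ρ ^ k.natAbs) ((1 - ρ)⁻¹ + ρ * (1 - ρ)⁻¹) := by
    have hgeo := hasSum_geometric_of_lt_one h0 (by linarith)
    refine HasSum.of_nat_of_neg_add_one (f := fun k : ℤ => ρ ^ k.natAbs) (by simpa using hgeo) ?_
    have : ∀ n : ℕ, ρ ^ (-((n : ℤ) + 1)).natAbs = ρ * ρ ^ n := by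
      intro n
      rw [Int.natAbs_neg, ← pow_succ']
      rfl
    simp only [this]
    exact hgeo.mul_left ρ
  have hg2 := (hasSum_ite_sub_hasSum hg 0).mul_left ‖u 0‖
  have h3 := h2.norm_le_of_bounded hg2 (by
    intro k
    split_ifs with hk
    · simp
    · exact hu k)
  refine h3.trans ?_
  have h4 : (1 - ρ)⁻¹ + ρ * (1 - ρ)⁻¹ - 1 ≤ 1 / 2 := by
    have : (0 : ℝ) < 1 - ρ := by linarith
    rw [show (1 - ρ)⁻¹ + ρ * (1 - ρ)⁻¹ - 1 = (2 * ρ) / (1 - ρ) by field_simp; ring,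
      div_le_iff₀ this]
    linarith
  have h5 : ((0 : ℤ).natAbs) = 0 := rfl
  rw [h5, pow_zero]
  nlinarith [norm_nonneg (u 0)]

lemma norm_le_of_dominated {u : ℤ → ℂ} {S : ℂ} {ρ : ℝ} (h0 : 0 ≤ ρ) (h1 : ρ ≤ 1 / 5)
    (hu : ∀ k, ‖u k‖ ≤ ‖u 0‖ * ρ ^ k.natAbs) (hs : HasSum u S) :
    ‖S‖ ≤ 3 / 2 * ‖u 0‖ ∧ ‖u 0‖ / 2 ≤ ‖S‖ := by
  have h := norm_sub_le_of_dominated h0 h1 hu hs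
  constructor
  · linarith [norm_sub_norm_le S (u 0)]
  · have := norm_sub_norm_le (u 0) S
    rw [norm_sub_rev] at this
    linarith

/-! ### The odd Jacobi theta function -/

/-- The odd Jacobi theta function, up to an exponential factor. It is a holomorphic function in `z`
that vanishes at the lattice points. -/
def oddTheta (τ z : ℂ) : ℂ := jacobiTheta₂ (z + 1 / 2 + τ / 2) τ

lemma oddTheta_add_one (τ z : ℂ) : oddTheta τ (z + 1) = oddTheta τ z := by
  rw [oddTheta, oddTheta, ← jacobiTheta₂_add_left (z + 1 / 2 + τ / 2)]
  congr 1
  ring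

lemma oddTheta_add_self (τ z : ℂ) : oddTheta τ (z + τ) = -e (-τ - z) * oddTheta τ z := by
  have h1 : z + τ + 1 / 2 + τ / 2 = (z + 1 / 2 + τ / 2) + τ := by ring
  rw [oddTheta, h1, jacobiTheta₂_add_left', oddTheta]
  congr 1
  have h2 : -Real.pi * I * (τ + 2 * (z + 1 / 2 + τ / 2)) =
      2 * Real.pi * I * (-τ - z) + -(Real.pi * I) := by ring
  rw [h2, Complex.exp_add, Complex.exp_neg, Complex.exp_pi_mul_I, e]
  norm_num

lemma oddTheta_zero (τ : ℂ) : oddTheta τ 0 = 0 := by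
  have h1 := oddTheta_add_self τ (-τ)
  have h2 : oddTheta τ (-τ) = oddTheta τ 0 := by
    rw [oddTheta, oddTheta, ← jacobiTheta₂_neg_left, ← jacobiTheta₂_add_left]
    congr 1
    ring
  -- both the evenness of `jacobiTheta₂` and quasi-periodicity relate the values at `-τ` and `0`
  have h3 : e (-τ - -τ) = 1 := by rw [sub_self, e_zero]
  rw [neg_add_cancel, h2, h3] at h1
  have h4 : (2 : ℂ) * oddTheta τ 0 = 0 := by linear_combination h1
  simpa using h4

lemma oddTheta_intCast (τ : ℂ) (k : ℤ) : oddTheta τ k = 0 := by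
  have h : ∀ n : ℕ, ∀ z, oddTheta τ (z + n) = oddTheta τ z := by
    intro n
    induction n with
    | zero => simp
    | succ n ih => intro z; rw [Nat.cast_succ, ← add_assoc, oddTheta_add_one, ih]
  rcases Int.eq_nat_or_neg k with ⟨n, rfl | rfl⟩
  · have := h n 0
    rw [zero_add, oddTheta_zero] at this
    exact_mod_cast this
  · have := h n (-n)
    rw [neg_add_cancel, oddTheta_zero] at this
    push_cast
    exact this.symm

lemma differentiableAt_oddTheta {τ : ℂ} (hτ : 0 < τ.im) (z : ℂ) :
    DifferentiableAt ℂ (oddTheta τ) z :=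
  DifferentiableAt.comp (g := fun z => jacobiTheta₂ z τ) (f := fun z => z + 1 / 2 + τ / 2) z
    (differentiableAt_jacobiTheta₂_fst _ hτ) (by fun_prop)

/-- On a line `Im z = x Im τ` with `0 < x ≤ 1/2`, one term of the odd theta series dominates. -/
lemma oddTheta_bounds {τ z : ℂ} {x : ℝ} (hτ : 0 < τ.im) (hx : x ≤ 1 / 2)
    (hz : z.im = x * τ.im) (hρ : Real.exp (-2 * Real.pi * (x * τ.im)) ≤ 1 / 5) :
    ‖oddTheta τ z‖ ≤ 3 / 2 * Real.exp (2 * Real.pi * (x * τ.im)) ∧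
      Real.exp (2 * Real.pi * (x * τ.im)) / 2 ≤ ‖oddTheta τ z‖ := by
  set z' := z + 1 / 2 + τ / 2 with hz'
  have hs : HasSum (fun k : ℤ => jacobiTheta₂_term (k - 1) z' τ) (oddTheta τ z) := by
    have := hasSum_jacobiTheta₂_term z' hτ
    exact (Equiv.hasSum_iff (Equiv.subRight (1 : ℤ))).mpr this
  have him : z'.im = (x + 1 / 2) * τ.im := by
    have h1 : (τ / 2).im = τ.im / 2 := by
      rw [show τ / 2 = ((1 / 2 : ℝ) : ℂ) * τ by push_cast; ring, Complex.im_ofReal_mul]; ring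
    have h2 : (1 / 2 : ℂ).im = 0 := by
      rw [show (1 / 2 : ℂ) = ((1 / 2 : ℝ) : ℂ) by push_cast; ring, Complex.ofReal_im]
    rw [hz', add_im, add_im, h1, h2, hz]
    ring
  have hterm : ∀ k : ℤ, ‖jacobiTheta₂_term (k - 1) z' τ‖ =
      Real.exp (2 * Real.pi * (x * τ.im)) *
        Real.exp (-Real.pi * τ.im * (k ^ 2 - k + 2 * k * x)) := by
    intro k
    rw [norm_jacobiTheta₂_term, him, ← Real.exp_add]
    congr 1
    push_cast
    ring
  have h0 : ‖jacobiTheta₂_term ((0 : ℤ) - 1) z' τ‖ = Real.exp (2 * Real.pi * (x * τ.im)) := by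
    rw [hterm]; simp
  have := norm_le_of_dominated (u := fun k : ℤ => jacobiTheta₂_term (k - 1) z' τ)
    (Real.exp_pos _).le hρ (by
      intro k
      rw [h0, hterm]
      refine mul_le_mul_of_nonneg_left ?_ (Real.exp_pos _).le
      rw [← Real.exp_nat_mul, Real.exp_le_exp, Nat.cast_natAbs]
      have hk : (|k| : ℤ) * (2 * x) ≤ (k : ℝ) ^ 2 - k + 2 * k * x := by
        rcases lt_trichotomy k 0 with h | h | h
        · rw [abs_of_neg h]
          have : (k : ℝ) ≤ -1 := by exact_mod_cast Int.le_sub_one_of_lt h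
          push_cast
          nlinarith
        · subst h; simp
        · rw [abs_of_pos h]
          have : (1 : ℝ) ≤ k := by exact_mod_cast h
          nlinarith
      have hpos : 0 < Real.pi * τ.im := mul_pos Real.pi_pos hτ
      nlinarith) hs
  simpa only [h0] using this

/-- The theta function compensates a pole of order at most `ν` at an integer. -/
lemma tendsto_oddTheta_pow_mul_sinFactor {τ : ℂ} (hτ : 0 < τ.im) {K : ℕ} {ν : ℤ} (hK : ν < K)
    (hK0 : 0 < K) (k : ℤ) :
    Tendsto (fun z => oddTheta τ z ^ K * sinFactor z ^ (-ν)) (𝓝[≠] (k : ℂ)) (𝓝 0) := by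
  obtain ⟨n, hn⟩ : ∃ n : ℕ, (n : ℤ) = max ν 0 := ⟨(max ν 0).toNat, by simp⟩
  obtain ⟨j, hj⟩ : ∃ j : ℕ, (j : ℤ) = n - ν := ⟨(n - ν).toNat, by
    rw [Int.toNat_of_nonneg]; rw [hn]; exact sub_nonneg.mpr (le_max_left _ _)⟩
  have hnK : n < K := by omega
  have hslope : Tendsto (fun z => oddTheta τ z / sinFactor z) (𝓝[≠] (k : ℂ))
      (𝓝 (deriv (oddTheta τ) k / deriv sinFactor k)) := by
    have h1 := (hasDerivAt_iff_tendsto_slope.mp (differentiableAt_oddTheta hτ k).hasDerivAt)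
    have h2 := (hasDerivAt_iff_tendsto_slope.mp (differentiable_sinFactor k).hasDerivAt)
    have hne : deriv sinFactor k ≠ 0 := by
      have : HasDerivAt sinFactor (e (k / 2) * (2 * Real.pi * I)) k := by
        have h3 : HasDerivAt sinFactor
            (Complex.exp (2 * Real.pi * I * (k / 2)) * (2 * Real.pi * I * (1 / 2)) -
              Complex.exp (2 * Real.pi * I * (-k / 2)) * (2 * Real.pi * I * (-1 / 2))) k := by
          unfold sinFactor e
          exact (((hasDerivAt_id (k : ℂ)).div_const 2).const_mul _).cexp.sub
            ((((hasDerivAt_id (k : ℂ)).neg.div_const 2)).const_mul _).cexp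
        convert h3 using 1
        have h4 := e_neg_intCast_div_two k
        rw [← neg_div] at h4
        change _ = e (k / 2) * _ - e (-k / 2) * _
        rw [h4]
        ring
      rw [this.deriv]
      exact mul_ne_zero (e_ne_zero _) Complex.two_pi_I_ne_zero
    refine (h1.div h2 hne).congr' ?_
    filter_upwards [self_mem_nhdsWithin] with z hz
    have hz' : z - k ≠ 0 := sub_ne_zero.mpr hz
    simp only [Pi.div_apply, slope_def_field, oddTheta_intCast, sinFactor_intCast, sub_zero]
    field_simp
  have hθ : Tendsto (oddTheta τ) (𝓝[≠] (k : ℂ)) (𝓝 0) := by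
    have := (differentiableAt_oddTheta hτ k).continuousAt.tendsto
    rw [oddTheta_intCast] at this
    exact this.mono_left nhdsWithin_le_nhds
  have hs : Tendsto sinFactor (𝓝[≠] (k : ℂ)) (𝓝 0) := by
    have := (differentiable_sinFactor k).continuousAt.tendsto
    rw [sinFactor_intCast] at this
    exact this.mono_left nhdsWithin_le_nhds
  have h := ((hslope.pow n).mul (hθ.pow (K - n))).mul (hs.pow j)
  rw [zero_pow (by omega : K - n ≠ 0), mul_zero, zero_mul] at h
  refine h.congr' ?_
  filter_upwards [eventually_sinFactor_ne_zero k] with z hz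
  have h1 : sinFactor z ^ (-ν) = sinFactor z ^ j / sinFactor z ^ n := by
    rw [← zpow_natCast, ← zpow_natCast, ← zpow_sub₀ hz]
    congr 1
    omega
  rw [h1, div_pow, ← Nat.add_sub_cancel' hnK.le, pow_add, Nat.add_sub_cancel_left]
  ring


/-! ### Growth of quasi-periodic functions along a line -/

/-- Orthogonality of the characters of `ℤ/nℤ`. -/
lemma sum_e_mul_div {n : ℕ} (hn : 0 < n) (a : ℤ) :
    ∑ j ∈ Finset.range n, e ((a : ℂ) * j / n) = if (n : ℤ) ∣ a then (n : ℂ) else 0 := by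
  have hn' : (n : ℂ) ≠ 0 := by exact_mod_cast hn.ne'
  have h1 : ∀ j : ℕ, e ((a : ℂ) * j / n) = e (a / n) ^ j := by
    intro j
    rw [← e_natCast_mul]
    congr 1
    ring
  simp only [h1]
  have hiff : e ((a : ℂ) / n) = 1 ↔ (n : ℤ) ∣ a := by
    rw [e_eq_one_iff]
    refine exists_congr fun k => ?_
    rw [div_eq_iff hn']
    constructor
    · intro h
      rw [mul_comm]
      exact_mod_cast h
    · rintro rfl
      push_cast
      ring
  split_ifs with h
  · rw [hiff.mpr h]
    simp
  · have h2 : e ((a : ℂ) / n) ≠ 1 := fun hc => h (hiff.mp hc)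
    rw [geom_sum_eq h2, ← e_natCast_mul, mul_div_cancel₀ _ hn', e_intCast, sub_self, zero_div]

/-- Functions that behave on the strip `|Im z| < Im τ` like a theta function of index `L`: they are
holomorphic, of period one, and quasi-periodic under translation by `τ`. -/
structure IsQuasiPeriodic (τ : ℂ) (L : ℕ) (J : ℤ) (Θ : ℂ → ℂ) : Prop where
  im_pos : 0 < τ.im
  differentiableAt : ∀ z : ℂ, |z.im| < τ.im → DifferentiableAt ℂ Θ z
  add_one : ∀ z : ℂ, |z.im| < τ.im → Θ (z + 1) = Θ z
  add_self : ∀ z : ℂ, -τ.im < z.im → z.im < 0 → Θ (z + τ) = e (-(L + J) * τ - 2 * L * z) * Θ z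

namespace IsQuasiPeriodic

variable {τ : ℂ} {L : ℕ} {J : ℤ} {Θ : ℂ → ℂ} (h : IsQuasiPeriodic τ L J Θ)
include h

lemma hasSum {z : ℂ} (hz : |z.im| < τ.im) :
    HasSum (fun k : ℤ => fourierInt 1 Θ 0 k * e (k * z)) (Θ z) := by
  have := hasSum_fourierInt (D := 1) one_pos (F := Θ) (y₁ := -τ.im) (y₂ := τ.im)
    (fun z h1 h2 => h.differentiableAt z (abs_lt.mpr ⟨h1, h2⟩))
    (fun z h1 h2 => by rw [Nat.cast_one]; exact h.add_one z (abs_lt.mpr ⟨h1, h2⟩))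
    (y := 0) (by linarith [h.im_pos]) h.im_pos (abs_lt.mp hz).1 (abs_lt.mp hz).2
  simpa using this

lemma fourierInt_add (r : ℤ) :
    fourierInt 1 Θ 0 ((r + 2 * L : ℤ) : ℚ) = e ((r + L + J) * τ) * fourierInt 1 Θ 0 r := by
  have hpos := h.im_pos
  set y : ℝ := -τ.im / 2 with hy
  have him : ∀ x : ℝ, (x + y * I : ℂ).im = y := fun x => by simp
  have h1 : ∀ x : ℝ, HasSum (fun k : ℤ => (fourierInt 1 Θ 0 k * e (k * τ)) *
      e (((k / (1 : ℕ) : ℚ) : ℂ) * (x + y * I))) (Θ (x + y * I + τ)) := by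
    intro x
    have := h.hasSum (z := x + y * I + τ) (by
      rw [add_im, him, abs_lt]; constructor <;> linarith)
    convert this using 2 with k
    rw [mul_assoc, ← e_add]
    congr 2
    push_cast
    ring
  have h2 : ∀ x : ℝ, HasSum (fun k : ℤ => (e (-(L + J) * τ) * fourierInt 1 Θ 0 (k + 2 * L : ℤ)) *
      e (((k / (1 : ℕ) : ℚ) : ℂ) * (x + y * I))) (Θ (x + y * I + τ)) := by
    intro x
    rw [h.add_self _ (by rw [him]; linarith) (by rw [him]; linarith), e_sub]
    have h3 := h.hasSum (z := x + y * I) (by rw [him, abs_lt]; constructor <;> linarith)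
    have h4 : HasSum (fun k : ℤ => fourierInt 1 Θ 0 ((k + 2 * L : ℤ) : ℚ) *
        e (((k + 2 * L : ℤ) : ℂ) * (x + y * I))) (Θ (x + y * I)) :=
      (Equiv.hasSum_iff (f := fun k : ℤ => fourierInt 1 Θ 0 k * e (k * (x + y * I)))
        (Equiv.addRight (2 * L : ℤ))).mpr h3
    have h5 := h4.mul_left (e (-(L + J) * τ) / e (2 * L * (x + y * I)))
    refine Eq.mp (congrArg (fun F => HasSum F _) (funext fun k => ?_)) h5
    have h6 : e (((k + 2 * L : ℤ) : ℂ) * (x + y * I)) =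
        e (((k / (1 : ℕ) : ℚ) : ℂ) * (x + y * I)) * e (2 * L * (x + y * I)) := by
      rw [← e_add]
      congr 1
      push_cast
      ring
    rw [h6]
    generalize e (((k / (1 : ℕ) : ℚ) : ℂ) * (x + y * I)) = E
    have hne := e_ne_zero (2 * L * (x + y * I))
    generalize e (2 * L * (x + y * I)) = E' at hne ⊢
    generalize e (-(L + J) * τ) = E''
    field_simp
  have h3 := (fourierInt_of_hasSum one_pos (F := fun z => Θ (z + τ)) h1 r).symm.trans
    (fourierInt_of_hasSum one_pos (F := fun z => Θ (z + τ)) h2 r)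
  have h4 : e (-(L + J) * τ) * e ((L + J) * τ) = 1 := by
    rw [← e_add, ← e_zero]; congr 1; ring
  have h5 : e ((r + L + J) * τ) = e (r * τ) * e ((L + J) * τ) := by
    rw [← e_add]; congr 1; ring
  rw [h5]
  linear_combination (-e ((L + J) * τ)) * h3 - fourierInt 1 Θ 0 ((r + 2 * L : ℤ) : ℚ) * h4

lemma fourierInt_add_mul (r k : ℤ) :
    fourierInt 1 Θ 0 ((r + 2 * L * k : ℤ) : ℚ) =
      e ((L * k ^ 2 + (r + J) * k) * τ) * fourierInt 1 Θ 0 r := by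
  have hstep : ∀ j : ℤ, fourierInt 1 Θ 0 ((r + 2 * L * (j + 1) : ℤ) : ℚ) =
      e ((r + 2 * L * j + L + J) * τ) * fourierInt 1 Θ 0 ((r + 2 * L * j : ℤ) : ℚ) := by
    intro j
    have := h.fourierInt_add (r + 2 * L * j)
    rw [show r + 2 * L * (j + 1) = r + 2 * L * j + 2 * L by ring, this]
    push_cast
    rfl
  induction k using Int.induction_on with
  | zero => simp
  | succ k ih =>
    rw [hstep, ih, ← mul_assoc, ← e_add]
    congr 2
    push_cast
    ring
  | pred k ih =>
    have h1 := hstep (-k - 1)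
    rw [sub_add_cancel, ih] at h1
    apply mul_left_cancel₀ (e_ne_zero ((r + 2 * L * ((-k - 1 : ℤ) : ℂ) + L + J) * τ))
    rw [← h1, ← mul_assoc, ← e_add]
    congr 2
    push_cast
    ring

/-- The part of the Fourier expansion of `Θ` that is supported on one residue class modulo `2L` is a
finite average of translates of `Θ`. -/
lemma hasSum_component (hL : 0 < L) (r : ℤ) {z : ℂ} (hz : |z.im| < τ.im) :
    HasSum (fun k : ℤ => fourierInt 1 Θ 0 ((r + 2 * L * k : ℤ) : ℚ) * e ((r + 2 * L * k) * z))
      (((2 * L : ℕ) : ℂ)⁻¹ * ∑ j ∈ Finset.range (2 * L),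
        e (-r * j / (2 * L : ℕ)) * Θ (z + j / (2 * L : ℕ))) := by
  have hL2 : 0 < 2 * L := by omega
  have hL' : ((2 * L : ℕ) : ℂ) ≠ 0 := by exact_mod_cast hL2.ne'
  have him : ∀ j : ℕ, ((j : ℂ) / (2 * L : ℕ)).im = 0 := by
    intro j
    rw [show (j : ℂ) / (2 * L : ℕ) = ((j / (2 * L : ℕ) : ℝ) : ℂ) by push_cast; rfl,
      Complex.ofReal_im]
  have h1 := (hasSum_sum (s := Finset.range (2 * L)) fun j _ =>
    (h.hasSum (z := z + j / (2 * L : ℕ)) (by rwa [add_im, him, add_zero])).mul_left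
      (e (-r * j / (2 * L : ℕ)))).mul_left ((2 * L : ℕ) : ℂ)⁻¹
  have h2 : ∀ k : ℤ, ((2 * L : ℕ) : ℂ)⁻¹ * ∑ j ∈ Finset.range (2 * L),
      e (-r * j / (2 * L : ℕ)) * (fourierInt 1 Θ 0 k * e (k * (z + j / (2 * L : ℕ)))) =
      if ((2 * L : ℕ) : ℤ) ∣ k - r then fourierInt 1 Θ 0 k * e (k * z) else 0 := by
    intro k
    have h3 : ∀ j : ℕ, e (-r * j / (2 * L : ℕ)) *
        (fourierInt 1 Θ 0 k * e (k * (z + j / (2 * L : ℕ)))) =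
        (fourierInt 1 Θ 0 k * e (k * z)) * e (((k - r : ℤ) : ℂ) * j / (2 * L : ℕ)) := by
      intro j
      rw [mul_left_comm, mul_assoc, ← e_add, ← e_add]
      congr 2
      push_cast
      ring
    simp only [h3]
    rw [← Finset.mul_sum, sum_e_mul_div hL2]
    split_ifs
    · field_simp
    · simp
  simp only [h2] at h1
  have hinj : Function.Injective fun k : ℤ => r + 2 * L * k := by
    intro a b hab
    have : (2 * L : ℤ) ≠ 0 := by exact_mod_cast hL2.ne'
    simpa [this, hL.ne'] using hab
  rw [← hinj.hasSum_iff] at h1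
  · refine Eq.mp (congrArg (fun F => HasSum F _) (funext fun k => ?_)) h1
    rw [Function.comp_apply, if_pos]
    · push_cast
      rfl
    · exact ⟨k, by push_cast; ring⟩
  · intro k hk
    rw [if_neg]
    rintro ⟨j, hj⟩
    refine hk ⟨j, ?_⟩
    push_cast at hj
    dsimp only
    rw [← hj]
    ring

/-- On the line `Im z = Im τ / (8L)`, each component is dominated by one term of its Fourier
expansion if `Im τ` is large. Its absolute value thus is essentially constant on this line, so that
`Θ` is bounded by its values at `2L` points. -/
lemma norm_le (hL : 0 < L) (hρ : Real.exp (-2 * Real.pi * (τ.im / 4)) ≤ 1 / 5) {z z₀ : ℂ}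
    (hz : z.im = τ.im / (8 * L)) (hz₀ : z₀.im = τ.im / (8 * L)) :
    ‖Θ z‖ ≤ 3 * ∑ j ∈ Finset.range (2 * L), ‖Θ (z₀ + j / (2 * L : ℕ))‖ := by
  have hL2 : 0 < 2 * L := by omega
  have hL' : ((2 * L : ℕ) : ℂ) ≠ 0 := by exact_mod_cast hL2.ne'
  have hL1 : (1 : ℝ) ≤ L := by exact_mod_cast hL
  have hpos := h.im_pos
  set A : ℤ → ℂ → ℂ := fun r z => ((2 * L : ℕ) : ℂ)⁻¹ * ∑ j ∈ Finset.range (2 * L),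
        e (-r * j / (2 * L : ℕ)) * Θ (z + j / (2 * L : ℕ)) with hA
  have hlt : |τ.im / (8 * L)| < τ.im := by
    rw [abs_of_pos (by positivity), div_lt_iff₀ (by positivity)]
    nlinarith
  have hdom : ∀ r : ℤ, -(L : ℝ) ≤ r + J → (r : ℝ) + J ≤ L - 1 → ∀ z : ℂ, z.im = τ.im / (8 * L) →
      ‖A r z‖ ≤ 3 / 2 * (‖fourierInt 1 Θ 0 r‖ * Real.exp (-2 * Real.pi * (r * τ.im / (8 * L)))) ∧
      (‖fourierInt 1 Θ 0 r‖ * Real.exp (-2 * Real.pi * (r * τ.im / (8 * L)))) / 2 ≤ ‖A r z‖ := by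
    intro r hr1 hr2 z hz
    have hs := h.hasSum_component hL r (z := z) (by rwa [hz])
    have hterm : ∀ k : ℤ, ‖fourierInt 1 Θ 0 ((r + 2 * L * k : ℤ) : ℚ) *
        e ((r + 2 * L * k) * z)‖ =
        ‖fourierInt 1 Θ 0 r‖ * Real.exp (-2 * Real.pi * (r * τ.im / (8 * L))) *
          Real.exp (-2 * Real.pi * ((L * k ^ 2 + (r + J + 1 / 4) * k) * τ.im)) := by
      intro k
      rw [h.fourierInt_add_mul, norm_mul, norm_mul, norm_e, norm_e]
      have e1 : ((L * k ^ 2 + (r + J) * k : ℂ) * τ).im = (L * k ^ 2 + (r + J) * k) * τ.im := by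
        rw [show (L * k ^ 2 + (r + J) * k : ℂ) = ((L * k ^ 2 + (r + J) * k : ℝ) : ℂ) by
          push_cast; rfl, Complex.im_ofReal_mul]
      have e2 : ((r + 2 * L * k : ℂ) * z).im = (r + 2 * L * k) * (τ.im / (8 * L)) := by
        rw [show (r + 2 * L * k : ℂ) = ((r + 2 * L * k : ℝ) : ℂ) by push_cast; rfl,
          Complex.im_ofReal_mul, hz]
      rw [e1, e2, mul_comm (Real.exp _), mul_assoc ‖_‖, mul_assoc ‖_‖, ← Real.exp_add,
        ← Real.exp_add]
      congr 2
      field_simp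
      ring
    have h0 : ‖fourierInt 1 Θ 0 ((r + 2 * L * (0 : ℤ) : ℤ) : ℚ) *
        e ((r + 2 * L * ((0 : ℤ) : ℂ)) * z)‖ =
        ‖fourierInt 1 Θ 0 r‖ * Real.exp (-2 * Real.pi * (r * τ.im / (8 * L))) := by
      rw [hterm]; simp
    have := norm_le_of_dominated (u := fun k : ℤ => fourierInt 1 Θ 0 ((r + 2 * L * k : ℤ) : ℚ) *
      e ((r + 2 * L * k) * z)) (Real.exp_pos _).le hρ (by
        intro k
        rw [h0, hterm]
        refine mul_le_mul_of_nonneg_left ?_ (by positivity)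
        rw [← Real.exp_nat_mul, Real.exp_le_exp, Nat.cast_natAbs]
        have hk : ((|k| : ℤ) : ℝ) / 4 ≤ L * k ^ 2 + (r + J + 1 / 4) * k := by
          rcases lt_trichotomy k 0 with h | h | h
          · rw [abs_of_neg h]
            have : (k : ℝ) ≤ -1 := by exact_mod_cast Int.le_sub_one_of_lt h
            push_cast
            nlinarith [mul_nonneg (by linarith : (0 : ℝ) ≤ L - 1 - (r + J))
              (by linarith : (0 : ℝ) ≤ -k), mul_nonneg (by linarith : (0 : ℝ) ≤ L)
              (mul_nonneg (by linarith : (0 : ℝ) ≤ -k) (by linarith : (0 : ℝ) ≤ -k - 1))]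
          · subst h; simp
          · rw [abs_of_pos h]
            have : (1 : ℝ) ≤ k := by exact_mod_cast h
            nlinarith [mul_nonneg (by linarith : (0 : ℝ) ≤ (r + J) + L)
              (by linarith : (0 : ℝ) ≤ k), mul_nonneg (by linarith : (0 : ℝ) ≤ L)
              (mul_nonneg (by linarith : (0 : ℝ) ≤ k) (by linarith : (0 : ℝ) ≤ k - 1))]
        have hpos : 0 < Real.pi * τ.im := mul_pos Real.pi_pos hpos
        nlinarith) hs
    simpa only [h0] using this
  have hA0 : ∀ r : ℤ, ‖A r z₀‖ ≤ ((2 * L : ℕ) : ℝ)⁻¹ *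
      ∑ j ∈ Finset.range (2 * L), ‖Θ (z₀ + j / (2 * L : ℕ))‖ := by
    intro r
    rw [hA]
    dsimp only
    rw [norm_mul, norm_inv, Complex.norm_natCast]
    refine mul_le_mul_of_nonneg_left ((norm_sum_le _ _).trans_eq ?_) (by positivity)
    refine Finset.sum_congr rfl fun j _ => ?_
    rw [norm_mul, norm_e]
    have : (-(r : ℂ) * j / (2 * L : ℕ)).im = 0 := by
      rw [show -(r : ℂ) * j / (2 * L : ℕ) = ((-r * j / (2 * L : ℕ) : ℝ) : ℂ) by push_cast; rfl,
        Complex.ofReal_im]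
    rw [this]
    simp
  have hinv : Θ z = ∑ i ∈ Finset.range (2 * L), A ((i : ℤ) - L - J) z := by
    simp only [hA]
    rw [← Finset.mul_sum, Finset.sum_comm]
    have h3 : ∀ j ∈ Finset.range (2 * L), (∑ i ∈ Finset.range (2 * L),
        e (-(((i : ℤ) - L - J : ℤ) : ℂ) * j / (2 * L : ℕ)) * Θ (z + j / (2 * L : ℕ))) =
        if j = 0 then ((2 * L : ℕ) : ℂ) * Θ z else 0 := by
      intro j hj
      have h4 : ∀ i : ℕ, e (-(((i : ℤ) - L - J : ℤ) : ℂ) * j / (2 * L : ℕ)) *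
          Θ (z + j / (2 * L : ℕ)) = (e ((L + J) * j / (2 * L : ℕ)) * Θ (z + j / (2 * L : ℕ))) *
          e (((-j : ℤ) : ℂ) * i / (2 * L : ℕ)) := by
        intro i
        rw [mul_right_comm, ← e_add]
        congr 2
        push_cast
        ring
      simp only [h4]
      rw [← Finset.mul_sum, sum_e_mul_div hL2]
      by_cases hj0 : j = 0
      · subst hj0
        simp [mul_comm]
      · rw [if_neg, if_neg hj0, mul_zero]
        rw [dvd_neg]
        intro hd
        have := Int.le_of_dvd (by omega) hd
        rw [Finset.mem_range] at hj
        omega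
    rw [Finset.sum_congr rfl h3, Finset.sum_ite_eq' , if_pos (Finset.mem_range.mpr hL2)]
    field_simp
  rw [hinv]
  refine (norm_sum_le _ _).trans ?_
  have hcomp : ∀ i ∈ Finset.range (2 * L), ‖A ((i : ℤ) - L - J) z‖ ≤
      3 * (((2 * L : ℕ) : ℝ)⁻¹ * ∑ j ∈ Finset.range (2 * L), ‖Θ (z₀ + j / (2 * L : ℕ))‖) := by
    intro i hi
    have hi' : (i : ℝ) + 1 ≤ 2 * L := by exact_mod_cast Finset.mem_range.mp hi
    have hr1 : -(L : ℝ) ≤ (((i : ℤ) - L - J : ℤ) : ℝ) + J := by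
      push_cast
      linarith [(Nat.cast_nonneg i : (0 : ℝ) ≤ i)]
    have hr2 : (((i : ℤ) - L - J : ℤ) : ℝ) + J ≤ L - 1 := by
      push_cast
      linarith
    have h1 := (hdom _ hr1 hr2 z hz).1
    have h2 := (hdom _ hr1 hr2 z₀ hz₀).2
    linarith [hA0 ((i : ℤ) - L - J)]
  refine (Finset.sum_le_sum hcomp).trans_eq ?_
  rw [Finset.sum_const, Finset.card_range, nsmul_eq_mul]
  have : ((2 * L : ℕ) : ℝ) ≠ 0 := by exact_mod_cast hL2.ne'
  field_simp

end IsQuasiPeriodic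


/-! ### Growth of Jacobi forms along lines -/

lemma sinFactor_ne_zero_of_im_ne_zero {z : ℂ} (hz : z.im ≠ 0) : sinFactor z ≠ 0 := by
  intro h
  obtain ⟨k, rfl⟩ := sinFactor_eq_zero_iff.mp h
  simp at hz

section Growth

variable {φ : ℍ → ℂ → ℂ} {ν : ℤ} {f : ℍ → ℂ} {β : ℚ}

/-- Multiplication by a power of the odd theta function clears the poles of a Jacobi form. -/
lemma HasLeadingTerm.isQuasiPeriodic (h : HasLeadingTerm φ ν f β) {m : ℤ}
    (hell : ∀ (τ : ℍ) (z : ℂ), z ∉ lattice τ → e (m * (τ + 2 * z)) * φ τ (z + τ) = φ τ z)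
    {J L : ℕ} (hJ : ν < (2 * J : ℕ)) (hJ0 : 0 < J) (hL : (L : ℤ) = m + J) (τ : ℍ) :
    IsQuasiPeriodic τ L J
      (fun z => if sinFactor z = 0 then 0 else φ τ z * oddTheta τ z ^ (2 * J)) := by
  set Θ : ℂ → ℂ := fun z => if sinFactor z = 0 then 0 else φ τ z * oddTheta τ z ^ (2 * J) with hΘ
  have hτ : 0 < (τ : ℂ).im := τ.im_pos
  have hoff : ∀ z, |z.im| < (τ : ℂ).im → sinFactor z ≠ 0 → DifferentiableAt ℂ Θ z := by
    intro z hz hs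
    have h1 := (h.regular τ z (by rwa [mem_lattice_iff_of_abs_im_lt hz])).differentiableAt
    have h2 : DifferentiableAt ℂ (fun z => φ τ z) z := by
      have := DifferentiableAt.comp (g := fun p : ℂ × ℂ => φ (ofComplex p.1) p.2)
        (f := fun z => ((τ : ℂ), z)) z h1 (by fun_prop)
      simpa [Function.comp_def] using this
    refine (h2.mul ((differentiableAt_oddTheta hτ z).pow (2 * J))).congr_of_eventuallyEq ?_
    filter_upwards [continuous_sinFactor.continuousAt.eventually_ne hs] with w hw
    simp [hΘ, hw]
  refine ⟨hτ, fun z hz => ?_, fun z hz => ?_, fun z hz1 hz2 => ?_⟩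
  · by_cases hs : sinFactor z = 0
    swap
    · exact hoff z hz hs
    obtain ⟨k, rfl⟩ := sinFactor_eq_zero_iff.mp hs
    refine (analyticAt_of_differentiable_on_punctured_nhds_of_continuousAt ?_ ?_).differentiableAt
    · have him : ∀ᶠ z : ℂ in 𝓝 (k : ℂ), |z.im| < (τ : ℂ).im :=
        (continuous_abs.comp Complex.continuous_im).continuousAt.eventually_lt_const hz
      filter_upwards [him.filter_mono nhdsWithin_le_nhds, eventually_sinFactor_ne_zero k]
        with z hz hs
      exact hoff z hz hs
    · rw [continuousAt_iff_punctured_nhds]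
      have h1 := (h.tendsto_intCast hτ k).mul
        (tendsto_oddTheta_pow_mul_sinFactor hτ hJ (by omega) k)
      rw [mul_zero] at h1
      have h2 : Θ k = 0 := by simp [hΘ]
      rw [h2]
      refine h1.congr' ?_
      filter_upwards [eventually_sinFactor_ne_zero k] with w hw
      simp only [hΘ, if_neg hw, ofComplex_apply]
      rw [zpow_neg]
      have := zpow_ne_zero ν hw
      field_simp
  · have h1 := sinFactor_add_intCast z 1
    push_cast at h1
    simp only [hΘ, h1, mul_eq_zero, e_ne_zero, false_or]
    by_cases hs : sinFactor z = 0
    · simp [hs]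
    · have h2 := h.add_int τ z (by rwa [mem_lattice_iff_of_abs_im_lt hz]) 1
      push_cast at h2
      rw [if_neg hs, if_neg hs, h2, oddTheta_add_one]
  · have hs : sinFactor z ≠ 0 := sinFactor_ne_zero_of_im_ne_zero (by linarith)
    have hs' : sinFactor (z + τ) ≠ 0 :=
      sinFactor_ne_zero_of_im_ne_zero (by rw [add_im]; linarith)
    simp only [hΘ, if_neg hs, if_neg hs']
    rw [← hell τ z (by rwa [mem_lattice_iff_of_abs_im_lt (abs_lt.mpr ⟨hz1, by
      change z.im < (τ : ℂ).im; linarith⟩)]), oddTheta_add_self, mul_pow]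
    have h1 : (-e (-τ - z)) ^ (2 * J) = e (-(2 * J) * (τ + z)) := by
      rw [pow_mul, neg_sq, ← pow_mul, ← e_natCast_mul]
      congr 1
      push_cast
      ring
    have h2 : e (-(L + (J : ℤ)) * τ - 2 * L * z) * e (m * (τ + 2 * z)) =
        e (-(2 * J) * (τ + z)) := by
      rw [← e_add]
      congr 1
      have : (L : ℂ) = m + J := by exact_mod_cast congrArg (fun x : ℤ => (x : ℂ)) hL
      rw [this]
      push_cast
      ring
    rw [h1, ← h2]
    ring

lemma exp_neg_two_pi_le {t : ℝ} (ht : 1 ≤ t) : Real.exp (-2 * Real.pi * t) ≤ 1 / 5 := by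
  have h1 : (4 : ℝ) ≤ 2 * Real.pi * t := by nlinarith [Real.pi_gt_three]
  have h2 : (5 : ℝ) ≤ Real.exp (2 * Real.pi * t) := by linarith [Real.add_one_le_exp (2 * Real.pi * t)]
  rw [show -2 * Real.pi * t = -(2 * Real.pi * t) by ring, Real.exp_neg, one_div]
  exact inv_anti₀ (by norm_num) h2

/-- The growth condition at torsion points implies a growth condition that is uniform on two lines
on opposite sides of the real axis. -/
lemma HasLeadingTerm.exists_growth (h : HasLeadingTerm φ ν f β) {m : ℤ}
    (hell : ∀ (τ : ℍ) (z : ℂ), z ∉ lattice τ → e (m * (τ + 2 * z)) * φ τ (z + τ) = φ τ z)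
    (hgrow : ∀ x y : ℚ, 0 < x → x < 1 → ∃ a : ℝ,
      (fun τ : ℍ => φ τ (x * τ + y)) =O[atImInfty] (fun τ : ℍ => Real.exp (a * τ.im))) :
    ∃ x : ℝ, 0 < x ∧ x < 1 ∧ ∃ C a Y : ℝ, ∀ τ : ℍ, Y ≤ τ.im → ∀ z : ℂ,
      (z.im = x * τ.im ∨ z.im = (x - 1) * τ.im) → ‖φ τ z‖ ≤ C * Real.exp (a * τ.im) := by
  set J : ℕ := ν.natAbs + m.natAbs + 1 with hJ
  obtain ⟨L, hL⟩ : ∃ L : ℕ, (L : ℤ) = m + J := ⟨(m + J).toNat, by omega⟩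
  have hL0 : 0 < L := by omega
  have hL1 : (1 : ℝ) ≤ L := by exact_mod_cast hL0
  have hq := h.isQuasiPeriodic hell (J := J) (by omega) (by omega) hL
  set x : ℝ := 1 / (8 * L) with hx
  have hx0 : 0 < x := by positivity
  have hx1 : x ≤ 1 / 8 := by
    rw [hx]; apply one_div_le_one_div_of_le <;> linarith
  have hpoint : ∀ j : ℕ, ∃ C a Y : ℝ, ∀ τ : ℍ, Y ≤ τ.im →
      ‖φ τ (x * τ + j / (2 * L : ℕ))‖ ≤ C * Real.exp (a * τ.im) := by
    intro j
    obtain ⟨a, ha⟩ := hgrow (1 / (8 * L)) (j / (2 * L : ℕ)) (by positivity) (by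
      rw [div_lt_one (by positivity)]
      have : (1 : ℚ) ≤ L := by exact_mod_cast hL0
      linarith)
    obtain ⟨C, hC⟩ := ha.bound
    obtain ⟨Y, hY⟩ := (atImInfty_mem _).mp hC
    refine ⟨C, a, Y, fun τ hτ => ?_⟩
    have h1 := hY τ hτ
    simp only [Set.mem_ofPred_eq, Real.norm_eq_abs, Real.abs_exp] at h1
    convert h1 using 3
    rw [hx]
    push_cast
    rfl
  choose C a Y hCaY using hpoint
  set C' := ∑ j ∈ Finset.range (2 * L), |C j| with hC'
  set a' := ∑ j ∈ Finset.range (2 * L), |a j| with ha'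
  set Y' := ∑ j ∈ Finset.range (2 * L), |Y j| + 8 * L with hY'
  have hY'L : 8 * (L : ℝ) ≤ Y' := by
    have : 0 ≤ ∑ j ∈ Finset.range (2 * L), |Y j| := Finset.sum_nonneg fun _ _ => abs_nonneg _
    linarith
  set B : ℝ := (2 * Real.pi * x + 1) * (2 * J : ℕ) with hB
  have hline : ∀ τ : ℍ, Y' ≤ τ.im → ∀ z : ℂ, z.im = x * τ.im →
      ‖φ τ z‖ ≤ 3 * ((2 * L : ℕ) * C') * Real.exp ((a' + B) * τ.im) := by
    intro τ hτ z hz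
    have hτ0 := τ.im_pos
    have hτ8 : 8 * (L : ℝ) ≤ τ.im := hY'L.trans hτ
    have hxτ : 1 ≤ x * τ.im := by
      rw [hx, one_div, ← div_eq_inv_mul, one_le_div (by positivity)]
      exact hτ8
    have hxL : x * τ.im = τ.im / (8 * L) := by rw [hx]; ring
    have hnl : ∀ z : ℂ, z.im = x * τ.im → sinFactor z ≠ 0 := fun z hz =>
      sinFactor_ne_zero_of_im_ne_zero (by rw [hz]; positivity)
    have hθ : ∀ z : ℂ, z.im = x * τ.im → ‖oddTheta τ z‖ ≤ Real.exp ((2 * Real.pi * x + 1) * τ.im) ∧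
        1 ≤ ‖oddTheta τ z‖ := by
      intro z hz
      obtain ⟨h1, h2⟩ := oddTheta_bounds (τ := τ) (z := z) (x := x) hτ0 (by linarith) hz
        (exp_neg_two_pi_le hxτ)
      constructor
      · refine h1.trans ?_
        rw [show (2 * Real.pi * x + 1) * τ.im = τ.im + 2 * Real.pi * (x * τ.im) by ring,
          Real.exp_add]
        refine mul_le_mul_of_nonneg_right ?_ (Real.exp_pos _).le
        linarith [Real.add_one_le_exp τ.im]
      · refine le_trans ?_ h2
        change 1 ≤ Real.exp (2 * Real.pi * (x * τ.im)) / 2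
        have := Real.add_one_le_exp (2 * Real.pi * (x * τ.im))
        nlinarith [Real.pi_gt_three]
    have hz₀ : ∀ j : ℕ, ((x * τ + j / (2 * L : ℕ) : ℂ)).im = x * τ.im := by
      intro j
      rw [add_im, Complex.im_ofReal_mul, show (j : ℂ) / (2 * L : ℕ) =
        ((j / (2 * L : ℕ) : ℝ) : ℂ) by push_cast; rfl, Complex.ofReal_im, add_zero]
      rfl
    have hz₀' : ((x * τ : ℂ)).im = x * τ.im := by rw [Complex.im_ofReal_mul]; rfl
    have hmain := (hq τ).norm_le hL0 (exp_neg_two_pi_le (by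
      change 1 ≤ τ.im / 4; linarith)) (z := z) (z₀ := x * τ) (hz.trans hxL) (hz₀'.trans hxL)
    rw [if_neg (hnl z hz)] at hmain
    have hterm : ∀ j ∈ Finset.range (2 * L),
        ‖(if sinFactor (x * τ + j / (2 * L : ℕ)) = 0 then 0 else
          φ τ (x * τ + j / (2 * L : ℕ)) * oddTheta τ (x * τ + j / (2 * L : ℕ)) ^ (2 * J))‖ ≤
        C' * Real.exp ((a' + B) * τ.im) := by
      intro j hj
      rw [if_neg (hnl _ (hz₀ j)), norm_mul, norm_pow, add_mul, Real.exp_add, ← mul_assoc]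
      have hYj : Y j ≤ τ.im := by
        have h1 : |Y j| ≤ ∑ j ∈ Finset.range (2 * L), |Y j| :=
          Finset.single_le_sum (f := fun j => |Y j|) (fun _ _ => abs_nonneg _) hj
        linarith [le_abs_self (Y j)]
      have hCj : |C j| ≤ C' :=
        Finset.single_le_sum (f := fun j => |C j|) (fun _ _ => abs_nonneg _) hj
      have haj : |a j| ≤ a' :=
        Finset.single_le_sum (f := fun j => |a j|) (fun _ _ => abs_nonneg _) hj
      refine mul_le_mul ((hCaY j τ hYj).trans ?_) ?_ (by positivity) (by positivity)
      · refine mul_le_mul ((le_abs_self _).trans hCj) (Real.exp_le_exp.mpr ?_)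
          (Real.exp_pos _).le ((abs_nonneg _).trans hCj)
        exact mul_le_mul_of_nonneg_right ((le_abs_self _).trans haj) hτ0.le
      · refine (pow_le_pow_left₀ (norm_nonneg _) (hθ _ (hz₀ j)).1 _).trans_eq ?_
        rw [← Real.exp_nat_mul, hB]
        congr 1
        ring
    have hsum := Finset.sum_le_sum hterm
    rw [Finset.sum_const, Finset.card_range, nsmul_eq_mul] at hsum
    have hle : ‖φ τ z‖ ≤ ‖φ τ z * oddTheta τ z ^ (2 * J)‖ := by
      rw [norm_mul, norm_pow]
      exact le_mul_of_one_le_right (norm_nonneg _) (one_le_pow₀ (hθ z hz).2)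
    linarith
  refine ⟨x, hx0, by linarith, 3 * ((2 * L : ℕ) * C'), a' + B + 6 * Real.pi * |(m : ℝ)|, Y',
    fun τ hτ z hz => ?_⟩
  have hτ0 := τ.im_pos
  have hC0 : 0 ≤ C' := Finset.sum_nonneg fun _ _ => abs_nonneg _
  rcases hz with hz | hz
  · refine (hline τ hτ z hz).trans ?_
    refine mul_le_mul_of_nonneg_left (Real.exp_le_exp.mpr ?_) (by positivity)
    have : 0 ≤ 6 * Real.pi * |(m : ℝ)| := by positivity
    nlinarith
  · have hzτ : (z + τ).im = x * τ.im := by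
      rw [add_im, hz]; change (x - 1) * τ.im + τ.im = _; ring
    have hnl : z ∉ lattice τ := by
      rw [mem_lattice_iff_of_abs_im_lt]
      · exact sinFactor_ne_zero_of_im_ne_zero (by rw [hz]; nlinarith)
      · rw [hz, abs_mul, abs_of_pos hτ0, abs_of_neg (by linarith)]
        nlinarith
    rw [← hell τ z hnl, norm_mul, norm_e]
    have him : ((m : ℂ) * (τ + 2 * z)).im = m * ((2 * x - 1) * τ.im) := by
      rw [show (m : ℂ) = ((m : ℝ) : ℂ) by push_cast; rfl, Complex.im_ofReal_mul, add_im]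
      have : (2 * z).im = 2 * z.im := by
        rw [show (2 : ℂ) = ((2 : ℝ) : ℂ) by push_cast; rfl, Complex.im_ofReal_mul]
      rw [this, hz]
      change (m : ℝ) * (τ.im + 2 * ((x - 1) * τ.im)) = _
      ring
    rw [him, mul_comm, add_mul _ (6 * Real.pi * |(m : ℝ)|), Real.exp_add,
      ← mul_assoc (3 * ((2 * L : ℕ) * C'))]
    refine mul_le_mul (hline τ hτ _ hzτ) (Real.exp_le_exp.mpr ?_) (Real.exp_pos _).le
      (by positivity)
    have h1 : -(m * (2 * x - 1)) ≤ |(m : ℝ)| := by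
      calc -(m * (2 * x - 1)) ≤ |m * (2 * x - 1)| := neg_le_abs _
        _ = |(m : ℝ)| * |2 * x - 1| := abs_mul _ _
        _ ≤ |(m : ℝ)| * 1 := by
          gcongr
          rw [abs_le]; constructor <;> linarith
        _ = _ := mul_one _
    have h2 : 0 ≤ |(m : ℝ)| := abs_nonneg _
    have h3 : 0 < Real.pi * τ.im := mul_pos Real.pi_pos hτ0
    nlinarith

end Growth


/-! ### The leading Fourier coefficients are Laurent polynomials -/

lemma sinFactor_bounds {z : ℂ} (hz : 1 ≤ |z.im|) :
    1 ≤ ‖sinFactor z‖ ∧ ‖sinFactor z‖ ≤ Real.exp (2 * Real.pi * |z.im|) := by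
  have h1 : ‖e (z / 2)‖ = Real.exp (-(Real.pi * z.im)) := by
    rw [norm_e, div_ofNat_im]; congr 1; ring
  have h2 : ‖e (-z / 2)‖ = Real.exp (Real.pi * z.im) := by
    rw [norm_e, div_ofNat_im, neg_im]; congr 1; ring
  have hpos : 3 ≤ Real.pi * |z.im| := by nlinarith [Real.pi_gt_three]
  have hbig : 4 ≤ Real.exp (Real.pi * |z.im|) := by
    linarith [Real.add_one_le_exp (Real.pi * |z.im|)]
  have hsmall : Real.exp (-(Real.pi * |z.im|)) ≤ 1 := Real.exp_le_one_iff.mpr (by linarith)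
  have hsq : Real.exp (2 * Real.pi * |z.im|) = Real.exp (Real.pi * |z.im|) ^ 2 := by
    rw [← Real.exp_nat_mul]; congr 1; push_cast; ring
  have hsub := norm_sub_le (e (z / 2)) (e (-z / 2))
  have hrev := abs_norm_sub_norm_le (e (z / 2)) (e (-z / 2))
  rw [h1, h2] at hsub hrev
  rw [hsq]
  change 1 ≤ ‖e (z / 2) - e (-z / 2)‖ ∧ ‖e (z / 2) - e (-z / 2)‖ ≤ _
  rcases abs_cases z.im with ⟨h, _⟩ | ⟨h, _⟩ <;> rw [h] at hbig hsmall ⊢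
  · rw [abs_le] at hrev
    constructor <;> nlinarith
  · rw [mul_neg] at hbig hsmall ⊢
    rw [neg_neg] at hsmall
    rw [abs_le] at hrev
    constructor <;> nlinarith

lemma norm_sinFactor_zpow_le {z : ℂ} (hz : 1 ≤ |z.im|) (ν : ℤ) :
    ‖sinFactor z ^ ν‖ ≤ Real.exp (2 * Real.pi * |(ν : ℝ)| * |z.im|) := by
  obtain ⟨h1, h2⟩ := sinFactor_bounds hz
  rw [norm_zpow]
  obtain ⟨n, rfl | rfl⟩ := ν.eq_nat_or_neg
  · rw [zpow_natCast]
    refine (pow_le_pow_left₀ (norm_nonneg _) h2 n).trans_eq ?_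
    rw [← Real.exp_nat_mul]
    congr 1
    simp only [Int.cast_natCast, Nat.abs_cast]
    ring
  · rw [zpow_neg, zpow_natCast]
    refine (inv_le_one_of_one_le₀ (one_le_pow₀ h1)).trans (Real.one_le_exp ?_)
    positivity

section Laurent

variable {φ : ℍ → ℂ → ℂ} {ν : ℤ} {f : ℍ → ℂ} {β : ℚ}

lemma eq_zero_of_norm_le_exp {d : ℂ} {C A Y₀ : ℝ} (hA : A < 0)
    (h : ∀ Y, Y₀ ≤ Y → ‖d‖ ≤ C * Real.exp (A * Y)) : d = 0 := by
  have ht : Tendsto (fun Y : ℝ => C * Real.exp (A * Y)) atTop (𝓝 (C * 0)) :=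
    (Real.tendsto_exp_atBot.comp ((tendsto_const_mul_atBot_of_neg hA).mpr tendsto_id)).const_mul C
  rw [mul_zero] at ht
  have := ge_of_tendsto ht ((eventually_ge_atTop Y₀).mono h)
  simpa using this

/-- The Fourier coefficients in the first variable of the leading term are Laurent polynomials in
`e(z/2)`: moving the two lines of integration to infinity inside the tube shows that all but
finitely many of their Fourier coefficients vanish. -/
lemma HasLeadingTerm.exists_laurent (h : HasLeadingTerm φ ν f β)
    (hg : ∃ x : ℝ, 0 < x ∧ x < 1 ∧ ∃ C a Y : ℝ, ∀ τ : ℍ, Y ≤ τ.im → ∀ z : ℂ,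
      (z.im = x * τ.im ∨ z.im = (x - 1) * τ.im) → ‖φ τ z‖ ≤ C * Real.exp (a * τ.im))
    {D : ℕ} (hD : 0 < D) (hβ : ∃ k : ℤ, β * D = k) (j : ℤ) :
    ∃ P : ℂ[T;T⁻¹], ∀ (Y : ℝ) (z : ℂ), |z.im| < Y →
      tubeCoeff φ ν f D Y (j / D) z =
        LaurentPolynomial.eval₂ (RingHom.id ℂ) (eUnit (z / 2)) P := by
  obtain ⟨x, hx0, hx1, C, a, Y₀, hC⟩ := hg
  set n : ℚ := j / D with hn
  set d : ℤ → ℂ := fun k => fourierInt 2 (tubeCoeff φ ν f D 1 n) (0 : ℝ) (k / (2 : ℕ)) with hd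
  have hdY : ∀ (Y y : ℝ), |y| < Y → ∀ k : ℤ,
      fourierInt 2 (tubeCoeff φ ν f D Y n) y (k / (2 : ℕ)) = d k := by
    intro Y y hy k
    have hY : 0 < Y := (abs_nonneg _).trans_lt hy
    rw [h.fourierInt_tubeCoeff_eq D hy (y₂ := 0) (by simpa using hY)]
    refine fourierInt_congr _ fun t => ?_
    exact h.tubeCoeff_eq hD hβ (by simpa using hY) (by simp) j
  set A : ℝ := a + 2 * Real.pi * |(ν : ℝ)| + 2 * Real.pi * n with hA
  set Y₁ : ℝ := max Y₀ (1 / x + 1 / (1 - x)) with hY₁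
  have hx1' : 0 < 1 - x := by linarith
  have hbound : ∀ Y, Y₁ ≤ Y → ∀ y : ℝ, (y = x * Y ∨ y = (x - 1) * Y) → ∀ k : ℤ,
      ‖d k‖ ≤ |C| * Real.exp ((A * Y + Real.pi * k * y)) := by
    intro Y hY y hy k
    have hYx : 1 / x + 1 / (1 - x) ≤ Y := (le_max_right _ _).trans hY
    have hpx : 0 < 1 / x := by positivity
    have hpx' : 0 < 1 / (1 - x) := by positivity
    have hY0 : 0 < Y := by linarith
    have hxY : 1 ≤ x * Y := by
      have : 1 / x ≤ Y := by linarith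
      rwa [div_le_iff₀' hx0] at this
    have hxY' : 1 ≤ (1 - x) * Y := by
      have : 1 / (1 - x) ≤ Y := by linarith
      rwa [div_le_iff₀' hx1'] at this
    have hy1 : 1 ≤ |y| ∧ |y| < Y := by
      rcases hy with rfl | rfl
      · rw [abs_of_pos (by positivity)]
        constructor <;> nlinarith
      · rw [abs_of_neg (by nlinarith)]
        constructor <;> nlinarith
    rw [← hdY Y y hy1.2 k]
    have h1 : ∀ s t : ℝ, ‖leadingTerm φ ν f (t + Y * I) (s + y * I)‖ ≤
        |C| * Real.exp ((a + 2 * Real.pi * |(ν : ℝ)|) * Y) := by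
      intro s t
      have him : ((s : ℂ) + y * I).im = y := by simp
      have htim : ((t : ℂ) + Y * I).im = Y := by simp
      have hs : sinFactor (s + y * I) ≠ 0 := sinFactor_ne_zero_of_im_ne_zero (by
        rw [him]; intro h0; rw [h0, abs_zero] at hy1; linarith)
      have hτim := ofComplex_im (t := t + Y * I) (by rw [htim]; exact hY0)
      rw [leadingTerm_of_ne hs, norm_mul, mul_comm, add_mul, Real.exp_add, ← mul_assoc]
      rw [htim] at hτim
      refine mul_le_mul ?_ ?_ (norm_nonneg _) (by positivity)
      · refine (hC (ofComplex (t + Y * I)) ?_ _ ?_).trans ?_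
        · rw [hτim]; exact (le_max_left _ _).trans hY
        · rw [him, hτim]; exact hy
        · rw [hτim]
          exact mul_le_mul_of_nonneg_right (le_abs_self _) (Real.exp_pos _).le
      · refine (norm_sinFactor_zpow_le (by rw [him]; exact hy1.1) ν).trans (Real.exp_le_exp.mpr ?_)
        rw [him]
        exact mul_le_mul_of_nonneg_left hy1.2.le (by positivity)
    have h2 : ∀ s : ℝ, ‖tubeCoeff φ ν f D Y n (s + y * I)‖ ≤ |C| * Real.exp (A * Y) := by
      intro s
      refine (norm_fourierInt_le hD n fun t _ => h1 s t).trans_eq ?_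
      rw [mul_assoc, ← Real.exp_add, hA]
      congr 2
      ring
    refine (norm_fourierInt_le two_pos _ fun t _ => h2 t).trans_eq ?_
    rw [mul_assoc, ← Real.exp_add]
    congr 2
    push_cast
    ring
  obtain ⟨R, hR⟩ := exists_nat_gt (|A| / (Real.pi * x) + |A| / (Real.pi * (1 - x)))
  have hR1 : |A| < Real.pi * x * R := by
    have : 0 ≤ |A| / (Real.pi * (1 - x)) := by positivity
    rw [← div_lt_iff₀' (by positivity)]
    linarith
  have hR2 : |A| < Real.pi * (1 - x) * R := by
    have : 0 ≤ |A| / (Real.pi * x) := by positivity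
    rw [← div_lt_iff₀' (by positivity)]
    linarith
  have hzero : ∀ k : ℤ, k ∉ Finset.Icc (-(R : ℤ)) R → d k = 0 := by
    intro k hk
    rw [Finset.mem_Icc, not_and_or, not_le, not_le] at hk
    rcases hk with hk | hk
    · have hk' : (k : ℝ) ≤ -R := by exact_mod_cast hk.le
      refine eq_zero_of_norm_le_exp (A := A + Real.pi * k * x) ?_ fun Y hY =>
        (hbound Y hY (x * Y) (Or.inl rfl) k).trans_eq (by congr 2; ring)
      have : Real.pi * x * k ≤ Real.pi * x * (-R) := by gcongr
      linarith [le_abs_self A]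
    · have hk' : (R : ℝ) ≤ k := by exact_mod_cast hk.le
      refine eq_zero_of_norm_le_exp (A := A + Real.pi * k * (x - 1)) ?_ fun Y hY =>
        (hbound Y hY ((x - 1) * Y) (Or.inr rfl) k).trans_eq (by congr 2; ring)
      have : Real.pi * (1 - x) * R ≤ Real.pi * (1 - x) * k := by gcongr
      linarith [le_abs_self A]
  refine ⟨∑ k ∈ Finset.Icc (-(R : ℤ)) R, LaurentPolynomial.C (d k) * T k, fun Y z hz => ?_⟩
  have hzz : (z.re : ℂ) + z.im * I = z := Complex.re_add_im z
  have hsupp : ∀ k ∉ Finset.Icc (-(R : ℤ)) R, ∀ w : ℂ,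
      fourierInt 2 (tubeCoeff φ ν f D Y n) z.im (k / (2 : ℕ)) * e ((k / (2 : ℕ) : ℚ) * w) = 0 := by
    intro k hk w
    rw [hdY Y _ hz, hzero k hk, zero_mul]
  have hsum := hasSum_fourierInt_of_summable two_pos (h.continuous_tubeCoeff D hz n)
    (fun s => by exact_mod_cast h.tubeCoeff_add_two D (by simpa using hz) n)
    (hasSum_sum_of_ne_finset_zero fun k hk => hsupp k hk _).summable z.re
  rw [hzz] at hsum
  rw [hsum.unique (hasSum_sum_of_ne_finset_zero fun k hk => hsupp k hk _), map_sum]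
  refine Finset.sum_congr rfl fun k _ => ?_
  rw [hdY Y _ hz, LaurentPolynomial.eval₂_C_mul_T, RingHom.id_apply, Units.val_zpow_eq_zpow_val]
  change _ = d k * e (z / 2) ^ k
  rw [← e_intCast_mul]
  congr 2
  push_cast
  ring

end Laurent


/-! ### Theta series for the Jacobi theta function and the Dedekind eta function -/

/-- The theta series `∑ₙ X(n) e(n² τ / κ)`. -/
def thetaSeries (κ : ℕ) (X : ℤ → ℂ) (τ : ℂ) : ℂ := ∑' n : ℤ, X n * e (n ^ 2 * τ / κ)

lemma e_sq_mul_div (n : ℤ) (τ : ℂ) (κ : ℕ) :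
    e (n ^ 2 * τ / κ) = jacobiTheta₂_term n 0 (2 * τ / κ) := by
  rw [e, jacobiTheta₂_term]
  congr 1
  ring

lemma summable_thetaSeries {κ : ℕ} (hκ : 0 < κ) {X : ℤ → ℂ} (hX : ∀ n, ‖X n‖ ≤ 1) {τ : ℂ}
    (hτ : 0 < τ.im) : Summable fun n : ℤ => X n * e (n ^ 2 * τ / κ) := by
  have h : 0 < (2 * τ / κ).im := by
    rw [Complex.div_natCast_im, show (2 : ℂ) = ((2 : ℝ) : ℂ) by norm_num, Complex.im_ofReal_mul]
    positivity
  refine (hasSum_jacobiTheta₂_term 0 h).summable.norm.of_norm_bounded fun n => ?_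
  rw [norm_mul, e_sq_mul_div]
  exact mul_le_of_le_one_left (norm_nonneg _) (hX n)

/-- The even quadratic character modulo `12`. -/
def chi12 (n : ℤ) : ℂ :=
  ((if (n : ZMod 12) = 1 ∨ (n : ZMod 12) = 11 then 1 else
    if (n : ZMod 12) = 5 ∨ (n : ZMod 12) = 7 then -1 else 0 : ℤ) : ℂ)

lemma chi12_add_twelve (n : ℤ) : chi12 (n + 12) = chi12 n := by
  have : ((n + 12 : ℤ) : ZMod 12) = n := by
    push_cast
    rw [show (12 : ZMod 12) = 0 from rfl, add_zero]
  rw [chi12, chi12, this]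

lemma chi12_mul (a b : ℤ) : chi12 (a * b) = chi12 a * chi12 b := by
  rw [chi12, chi12, chi12, ← Int.cast_mul, Int.cast_inj, Int.cast_mul]
  generalize (a : ZMod 12) = a
  generalize (b : ZMod 12) = b
  revert a b
  decide

lemma chi12_neg (a : ℤ) : chi12 (-a) = chi12 a := by
  rw [chi12, chi12, Int.cast_inj, Int.cast_neg]
  generalize (a : ZMod 12) = a
  revert a
  decide

/-- On multiples `r` of `6`, the shifts of `chi12` are proportional to each other. -/
lemma chi12_sub_of_six_dvd {r : ℤ} (hr : 6 ∣ r) (t : ℤ) :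
    chi12 (r - t) = chi12 t * chi12 (r - 1) := by
  obtain ⟨s, rfl⟩ := hr
  rw [chi12, chi12, chi12, ← Int.cast_mul, Int.cast_inj]
  push_cast
  generalize (s : ZMod 12) = s
  generalize (t : ZMod 12) = t
  revert s t
  decide

lemma norm_chi12_le (n : ℤ) : ‖chi12 n‖ ≤ 1 := by
  rw [chi12]
  split_ifs <;> simp

lemma chi12_eq_zero {n : ℤ} (h1 : n % 6 ≠ 1) (h5 : n % 6 ≠ 5) : chi12 n = 0 := by
  have key : ∀ k : ℤ, (k = 1 ∨ k = 11 ∨ k = 5 ∨ k = 7) → (n : ZMod 12) ≠ (k : ZMod 12) := by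
    intro k hk h
    rw [ZMod.intCast_eq_intCast_iff_dvd_sub] at h
    push_cast at h
    omega
  have k1 := key 1 (by simp)
  have k2 := key 11 (by simp)
  have k3 := key 5 (by simp)
  have k4 := key 7 (by simp)
  push_cast at k1 k2 k3 k4
  simp [chi12, k1, k2, k3, k4]

lemma chi12_add_six {n : ℤ} (h : n % 6 = 1 ∨ n % 6 = 5) : chi12 (n + 6) = -chi12 n := by
  have h12 : (n : ZMod 12) = ((n % 12 : ℤ) : ZMod 12) := by
    rw [ZMod.intCast_eq_intCast_iff_dvd_sub]
    push_cast
    omega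
  have hn : n % 12 = 1 ∨ n % 12 = 5 ∨ n % 12 = 7 ∨ n % 12 = 11 := by omega
  rw [chi12, chi12, ← Int.cast_neg, Int.cast_inj, Int.cast_add, h12]
  rcases hn with hr | hr | hr | hr <;> rw [hr] <;> decide

lemma chi12_six_mul_add_one (k : ℕ) : chi12 (6 * k + 1) = (-1) ^ k := by
  induction k with
  | zero => simp [chi12]
  | succ k ih =>
    rw [show 6 * ((k + 1 : ℕ) : ℤ) + 1 = 6 * k + 1 + 6 by push_cast; ring,
      chi12_add_six (by omega), ih, pow_succ]
    ring

lemma chi12_six_mul_add_five (k : ℕ) : chi12 (6 * k + 5) = -(-1) ^ k := by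
  induction k with
  | zero => simp [chi12]; decide
  | succ k ih =>
    rw [show 6 * ((k + 1 : ℕ) : ℤ) + 5 = 6 * k + 5 + 6 by push_cast; ring,
      chi12_add_six (by omega), ih, pow_succ]
    ring

/-- A series over `ℤ` may be summed over the residue classes modulo `q` separately. -/
lemma hasSum_of_residues {q : ℕ} (hq : 0 < q) {F : ℤ → ℂ} {S : ℕ → ℂ}
    (h : ∀ r ∈ Finset.range q, HasSum (fun k : ℤ => F (r + q * k)) (S r)) :
    HasSum F (∑ r ∈ Finset.range q, S r) := by
  have hq' : (q : ℤ) ≠ 0 := by exact_mod_cast hq.ne'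
  have hq0 : (0 : ℤ) < q := by exact_mod_cast hq
  have h1 : ∀ r ∈ Finset.range q,
      HasSum (fun n : ℤ => if n % q = r then F n else 0) (S r) := by
    intro r hr
    have hr' : (r : ℤ) < q := by exact_mod_cast Finset.mem_range.mp hr
    have hmod : ∀ k : ℤ, ((r : ℤ) + q * k) % q = r := fun k => by
      rw [Int.add_mul_emod_self_left, Int.emod_eq_of_lt (by positivity) hr']
    have hinj : Function.Injective fun k : ℤ => (r : ℤ) + q * k := fun a b hab => by
      simpa [hq.ne'] using hab
    rw [← hinj.hasSum_iff]
    · refine Eq.mp (congrArg (fun G => HasSum G _) (funext fun k => ?_)) (h r hr)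
      simp only [Function.comp_apply, hmod, if_true]
    · intro n hn
      rw [if_neg]
      intro h2
      exact hn ⟨n / q, by rw [← h2]; exact Int.emod_add_mul_ediv n q⟩
  have h2 := hasSum_sum h1
  refine Eq.mp (congrArg (fun G => HasSum G _) (funext fun n => ?_)) h2
  have hn0 := Int.emod_nonneg n hq'
  have hn1 := Int.emod_lt_of_pos n hq0
  rw [Finset.sum_eq_single (n % q).toNat]
  · rw [if_pos (by omega)]
  · intro r _ hr
    rw [if_neg (by omega)]
  · intro hr
    rw [Finset.mem_range] at hr
    omega

/-- Euler's pentagonal number theorem at a point of the open unit disc. -/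
lemma tprod_one_sub_pow_eq_tsum {x : ℂ} (hx : ‖x‖ < 1) :
    HasSum (fun k : ℕ => (-1) ^ k * (x ^ pentagonal (-k) - x ^ pentagonal (k + 1)))
      (∏' n : ℕ, (1 - x ^ (n + 1))) := by
  set r := ‖x‖ with hr
  have hr0 : 0 ≤ r := norm_nonneg x
  have hgeo := summable_geometric_of_lt_one hr0 hx
  set B : ℝ := Real.exp (∑' n : ℕ, r ^ n) with hB
  have hprod : ∀ k n : ℕ, ‖∏ i ∈ Finset.range (n + 1), (1 - x ^ (k + i + 1))‖ ≤ B := by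
    intro k n
    rw [norm_prod]
    calc ∏ i ∈ Finset.range (n + 1), ‖1 - x ^ (k + i + 1)‖
        ≤ ∏ i ∈ Finset.range (n + 1), Real.exp (r ^ i) := by
          refine Finset.prod_le_prod (fun _ _ => norm_nonneg _) fun i _ => ?_
          refine (norm_sub_le _ _).trans ?_
          rw [norm_one, norm_pow, add_comm]
          refine le_trans ?_ (Real.add_one_le_exp _)
          gcongr ?_ + 1
          exact pow_le_pow_of_le_one hr0 hx.le (by omega)
      _ = Real.exp (∑ i ∈ Finset.range (n + 1), r ^ i) := (Real.exp_sum _ _).symm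
      _ ≤ B := Real.exp_le_exp.mpr (hgeo.sum_le_tsum _ fun i _ => pow_nonneg hr0 i)
  have hterm : ∀ k n : ℕ,
      ‖x ^ ((k + 1) * n) * ∏ i ∈ Finset.range (n + 1), (1 - x ^ (k + i + 1))‖ ≤ r ^ n * B := by
    intro k n
    rw [norm_mul, norm_pow]
    refine mul_le_mul (pow_le_pow_of_le_one hr0 hx.le ?_) (hprod k n) (norm_nonneg _)
      (by positivity)
    nlinarith
  have hpent : ∀ k : ℕ, k ≤ pentagonal (-k) ∧ k ≤ pentagonal (k + 1) := by
    intro k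
    have h1 := two_mul_natCast_pentagonal_neg k
    have h2 := two_mul_natCast_pentagonal (k + 1)
    constructor
    · zify
      nlinarith
    · zify
      nlinarith
  have hrhs : Summable fun k : ℕ => (-1) ^ k * (x ^ pentagonal (-k) - x ^ pentagonal (k + 1)) := by
    refine (hgeo.mul_left 2).of_norm_bounded fun k => ?_
    rw [norm_mul, norm_pow, norm_neg, norm_one, one_pow, one_mul, two_mul]
    refine (norm_sub_le _ _).trans ?_
    rw [norm_pow, norm_pow]
    exact add_le_add (pow_le_pow_of_le_one hr0 hx.le (hpent k).1)
      (pow_le_pow_of_le_one hr0 hx.le (hpent k).2)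
  rw [Pentagonal.tprod_one_sub_pow]
  · exact hrhs.hasSum
  · exact tendsto_pow_atTop_nhds_zero_of_norm_lt_one hx
  · exact fun k => (hgeo.mul_right B).of_norm_bounded (hterm k)
  · intro k
    have := (multipliable_one_add_of_summable (f := fun n : ℕ => -x ^ (n + k + 1)) (by
      have h1 := (hgeo.mul_right (r ^ (k + 1)))
      refine h1.congr fun n => ?_
      rw [norm_neg, norm_pow, ← pow_add, add_assoc]))
    simpa [sub_eq_add_neg] using this
  · exact hrhs
  · have hT : ∀ k : ℕ, ‖∑' n : ℕ, x ^ ((k + 1) * n) *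
        ∏ i ∈ Finset.range (n + 1), (1 - x ^ (k + i + 1))‖ ≤ ∑' n : ℕ, r ^ n * B := fun k =>
      tsum_of_norm_bounded (hgeo.mul_right B).hasSum (hterm k)
    have h0 : Tendsto (fun k : ℕ => r ^ k * ∑' n : ℕ, r ^ n * B) atTop (𝓝 0) := by
      simpa using (tendsto_pow_atTop_nhds_zero_of_lt_one hr0 hx).mul_const (∑' n : ℕ, r ^ n * B)
    refine squeeze_zero_norm (fun k => ?_) h0
    rw [norm_mul, norm_mul, norm_pow, norm_pow, norm_neg, norm_one, one_pow, one_mul]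
    refine mul_le_mul (pow_le_pow_of_le_one hr0 hx.le ?_) (hT k) (norm_nonneg _) (by positivity)
    rw [Nat.le_div_iff_mul_le two_pos]
    nlinarith

/-- By Euler's pentagonal number theorem, twice the Dedekind eta function is a theta series. -/
lemma thetaSeries_chi12 {τ : ℂ} (hτ : 0 < τ.im) :
    thetaSeries 24 chi12 τ = 2 * ModularForm.eta τ := by
  set F : ℤ → ℂ := fun n => chi12 n * e (n ^ 2 * τ / (24 : ℕ)) with hF
  have hFs : Summable F := summable_thetaSeries (by norm_num) norm_chi12_le hτ
  have hFneg : ∀ n, F (-n) = F n := by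
    intro n
    simp only [hF, chi12_neg]
    push_cast
    rw [neg_sq]
  have hinj : ∀ r : ℤ, Function.Injective fun k : ℤ => 6 * k + r := by
    intro r a b hab
    simpa using hab
  have hs : ∀ r : ℤ, Summable fun k : ℤ => F (6 * k + r) := fun r => hFs.comp_injective (hinj r)
  have hsn : ∀ r : ℤ, Summable fun k : ℕ => F (6 * k + r) := fun r =>
    (hs r).comp_injective Nat.cast_injective
  have heta : ModularForm.eta τ = ∑' k : ℕ, F (6 * k + 1) + ∑' k : ℕ, F (6 * k + 5) := by
    have hq : ‖e τ‖ < 1 := by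
      rw [norm_e, Real.exp_lt_one_iff]
      nlinarith [Real.pi_pos, mul_pos Real.pi_pos hτ]
    rw [← (hsn 1).tsum_add (hsn 5)]
    have h1 : ModularForm.eta τ = e (τ / 24) * ∏' n : ℕ, (1 - e τ ^ (n + 1)) := by
      rw [ModularForm.eta]
      congr 1
      · simp only [Function.Periodic.qParam, e]
        congr 1
        push_cast
        ring
      · refine tprod_congr fun n => ?_
        rw [ModularForm.eta_q_eq_pow]
        rfl
    rw [h1, ← (tprod_one_sub_pow_eq_tsum hq).tsum_eq, ← tsum_mul_left]
    refine tsum_congr fun k => ?_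
    have p1 : e (τ / 24) * e τ ^ pentagonal (-k) = e ((6 * k + 1) ^ 2 * τ / 24) := by
      rw [← e_natCast_mul, ← e_add]
      congr 1
      have : (2 : ℂ) * pentagonal (-k) = k * (3 * k + 1) := by
        exact_mod_cast congrArg (fun n : ℤ => (n : ℂ)) (two_mul_natCast_pentagonal_neg k)
      linear_combination (τ / 2) * this
    have p2 : e (τ / 24) * e τ ^ pentagonal (k + 1) = e ((6 * k + 5) ^ 2 * τ / 24) := by
      rw [← e_natCast_mul, ← e_add]
      congr 1
      have : (2 : ℂ) * pentagonal (k + 1) = (k + 1) * (3 * (k + 1) - 1) := by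
        exact_mod_cast congrArg (fun n : ℤ => (n : ℂ)) (two_mul_natCast_pentagonal (k + 1))
      linear_combination (τ / 2) * this
    simp only [hF, chi12_six_mul_add_one, chi12_six_mul_add_five]
    push_cast
    rw [← p1, ← p2]
    ring
  have hfib : ∀ r s : ℤ, r + s = 6 → HasSum (fun k : ℤ => F (6 * k + r))
      (∑' k : ℕ, F (6 * k + r) + ∑' k : ℕ, F (6 * k + s)) := by
    intro r s hrs
    refine HasSum.of_nat_of_neg_add_one (hsn r).hasSum ?_
    have : (fun k : ℕ => F (6 * -((k : ℤ) + 1) + r)) = fun k : ℕ => F (6 * k + s) := by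
      funext k
      rw [← hFneg]
      congr 1
      omega
    rw [this]
    exact (hsn s).hasSum
  have h1 := hfib 1 5 rfl
  have h5 := hfib 5 1 rfl
  rw [← heta] at h1
  rw [add_comm, ← heta] at h5
  have key := hasSum_of_residues (q := 6) (by norm_num) (F := F)
    (S := fun r => if r = 1 ∨ r = 5 then ModularForm.eta τ else 0) (by
      intro r hr
      have hr6 := Finset.mem_range.mp hr
      by_cases hr1 : r = 1
      · subst hr1
        simpa [add_comm] using h1
      by_cases hr5 : r = 5
      · subst hr5
        simpa [add_comm] using h5
      have hz : ∀ k : ℤ, F (r + (6 : ℕ) * k) = 0 := fun k => by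
        simp only [hF]
        rw [chi12_eq_zero, zero_mul] <;> push_cast <;> omega
      simp only [hr1, hr5, hz, or_false, if_false]
      exact hasSum_zero)
  refine key.tsum_eq.trans ?_
  simp [Finset.sum_range_succ]
  ring


/-! ### Transformation of theta series under matrices with large lower left entry -/

lemma sum_range_comp_perm {q : ℕ} (hq : 0 < q) {g : ℤ → ℂ} (hg : ∀ n, g (n + q) = g n)
    (σ : Equiv.Perm (ZMod q)) {s : ℤ → ℤ} (hs : ∀ r : ℤ, (s r : ZMod q) = σ r) :
    ∑ r ∈ Finset.range q, g (s r) = ∑ r ∈ Finset.range q, g r := by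
  have : NeZero q := ⟨hq.ne'⟩
  have hcongr : ∀ a b : ℤ, (a : ZMod q) = b → g a = g b := by
    intro a b hab
    obtain ⟨k, hk⟩ := (ZMod.intCast_eq_intCast_iff_dvd_sub a b q).mp hab
    have hp : Function.Periodic g q := hg
    rw [eq_add_of_sub_eq hk, add_comm, mul_comm]
    exact ((hp.int_mul k) a).symm
  have key : ∀ F : ZMod q → ℂ, ∑ r ∈ Finset.range q, F ((r : ℤ) : ZMod q) = ∑ x, F x := by
    intro F
    refine Finset.sum_bij' (fun r _ => ((r : ℤ) : ZMod q)) (fun x _ => x.val)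
      (fun _ _ => Finset.mem_univ _) (fun x _ => Finset.mem_range.mpr x.val_lt) ?_ ?_
      (fun _ _ => rfl)
    · intro r hr
      rw [Int.cast_natCast, ZMod.val_natCast_of_lt (Finset.mem_range.mp hr)]
    · intro x _
      simp
  have hG : ∀ n : ℤ, g n = g (((n : ZMod q).val : ℕ) : ℤ) := fun n => hcongr _ _ (by simp)
  calc ∑ r ∈ Finset.range q, g (s r)
      = ∑ r ∈ Finset.range q, (fun x : ZMod q => g ((σ x).val : ℤ)) ((r : ℤ) : ZMod q) := by
        refine Finset.sum_congr rfl fun r _ => ?_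
        rw [hG, hs]
    _ = ∑ x : ZMod q, g ((σ x).val : ℤ) := key fun x : ZMod q => g ((σ x).val : ℤ)
    _ = ∑ x : ZMod q, g (x.val : ℤ) := Equiv.sum_comp σ (fun x => g (x.val : ℤ))
    _ = ∑ r ∈ Finset.range q, (fun x : ZMod q => g (x.val : ℤ)) ((r : ℤ) : ZMod q) :=
        (key fun x : ZMod q => g (x.val : ℤ)).symm
    _ = ∑ r ∈ Finset.range q, g r := Finset.sum_congr rfl fun r _ => (hG r).symm

lemma sum_range_add {q : ℕ} (hq : 0 < q) {g : ℤ → ℂ} (hg : ∀ n, g (n + q) = g n) (t : ℤ) :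
    ∑ r ∈ Finset.range q, g (r + t) = ∑ r ∈ Finset.range q, g r :=
  sum_range_comp_perm hq hg (Equiv.addRight (t : ZMod q)) (s := fun r => r + t) (fun r => by simp)

lemma sum_range_mul {q : ℕ} (hq : 0 < q) {g : ℤ → ℂ} (hg : ∀ n, g (n + q) = g n) {s : ℤ}
    (hs : IsCoprime s q) : ∑ r ∈ Finset.range q, g (s * r) = ∑ r ∈ Finset.range q, g r := by
  obtain ⟨x, y, hxy⟩ := hs
  have hx : (x : ZMod q) * s = 1 := by
    have := congrArg (fun n : ℤ => (n : ZMod q)) hxy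
    simpa using this
  let us : (ZMod q)ˣ := ⟨s, x, by rw [mul_comm, hx], hx⟩
  exact sum_range_comp_perm hq hg (Units.mulLeft us) (s := fun r => s * r) (fun r => by
    rw [Int.cast_mul]; rfl)

lemma e_eq_of_sub {x y : ℂ} {k : ℤ} (h : x = y + k) : e x = e y := e_eq_e_iff.mpr ⟨k, h⟩

/-- The quadratic Gauss sum `∑ X(r - 1) e(a r² / q)` over `r` modulo `q`. -/
def quadGauss (q : ℕ) (X : ℤ → ℂ) (a : ℤ) : ℂ :=
  ∑ r ∈ Finset.range q, X (r - 1) * e ((a : ℂ) * (r : ℂ) ^ 2 / q)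

lemma e_mul_sq_div_add (q : ℕ) (hq : 0 < q) (a n : ℤ) :
    e ((a : ℂ) * ((n + q : ℤ) : ℂ) ^ 2 / q) = e ((a : ℂ) * (n : ℂ) ^ 2 / q) := by
  have hq' : (q : ℂ) ≠ 0 := by exact_mod_cast hq.ne'
  refine e_eq_of_sub (k := a * (2 * n + q)) ?_
  push_cast
  field_simp
  ring

lemma periodic_of_add_twelve {X : ℤ → ℂ} (hX : ∀ n, X (n + 12) = X n) {q : ℤ} (hq : 12 ∣ q)
    (n : ℤ) : X (n + q) = X n := by
  obtain ⟨k, rfl⟩ := hq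
  have hp : Function.Periodic X (12 : ℤ) := hX
  rw [mul_comm]
  exact hp.int_mul k n

/-- The properties of the coefficients `X` that give a transformation law of the theta series
`∑ₙ X(n) e(n² τ / κ)` under matrices whose lower left entry is divisible by `24`. -/
structure IsThetaCoefficient (κ : ℕ) (X : ℤ → ℂ) : Prop where
  pos : 0 < κ
  norm_le : ∀ n, ‖X n‖ ≤ 1
  add_twelve : ∀ n, X (n + 12) = X n
  mul : ∀ m n, X (m * n) = X m * X n
  sum_sub : ∀ (c : ℕ) (a t : ℤ), 0 < c → 24 ∣ c → IsCoprime a 6 →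
    ∑ r ∈ Finset.range (κ * c), X (r - t) * e ((a : ℂ) * (r : ℂ) ^ 2 / (κ * c : ℕ)) =
      X t * quadGauss (κ * c) X a

lemma isThetaCoefficient_one : IsThetaCoefficient 1 fun _ => 1 where
  pos := one_pos
  norm_le := by simp
  add_twelve := by simp
  mul := by simp
  sum_sub := by simp [quadGauss]

lemma isThetaCoefficient_chi12 : IsThetaCoefficient 24 chi12 where
  pos := by norm_num
  norm_le := norm_chi12_le
  add_twelve := chi12_add_twelve
  mul := chi12_mul
  sum_sub := by
    intro c a t hc hc24 ha
    have hq : 0 < 24 * c := by positivity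
    obtain ⟨c', rfl⟩ := hc24
    have hc' : (c' : ℂ) ≠ 0 := by
      have : c' ≠ 0 := by rintro rfl; simp at hc
      exact_mod_cast this
    set q := 24 * (24 * c') with hqdef
    -- Averaging over the shifts of `r` by multiples of `48 c'` leaves the multiples of `6`.
    have key : ∀ t : ℤ, 6 * ∑ r ∈ Finset.range q, chi12 (r - t) * e ((a : ℂ) * (r : ℂ) ^ 2 / q) =
        ∑ r ∈ Finset.range q, chi12 (r - t) * e ((a : ℂ) * (r : ℂ) ^ 2 / q) *
          (if (6 : ℤ) ∣ r then 6 else 0) := by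
      intro t
      set g : ℤ → ℂ := fun r => chi12 (r - t) * e ((a : ℂ) * (r : ℂ) ^ 2 / q) with hg
      have hgp : ∀ n, g (n + q) = g n := by
        intro n
        simp only [hg]
        rw [e_mul_sq_div_add q hq, show n + (q : ℤ) - t = n - t + q by ring,
          periodic_of_add_twelve chi12_add_twelve (by rw [hqdef]; push_cast; omega)]
      have hshift : ∀ (i : ℕ) (r : ℤ), g (r + 48 * c' * i) = g r * e (((a * r : ℤ) : ℂ) * i / 6) := by
        intro i r
        simp only [hg]
        rw [show r + 48 * (c' : ℤ) * i - t = r - t + 48 * (c' : ℤ) * i by ring,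
          periodic_of_add_twelve chi12_add_twelve ⟨4 * c' * i, by ring⟩, mul_assoc (chi12 (r - t)), ← e_add]
        congr 1
        refine e_eq_of_sub (k := 4 * a * c' * i ^ 2) ?_
        rw [hqdef]
        push_cast
        field_simp
        ring
      have h6 : ∀ r : ℤ, ∑ i ∈ Finset.range 6, e (((a * r : ℤ) : ℂ) * i / 6) =
          if (6 : ℤ) ∣ r then 6 else 0 := by
        intro r
        have h := sum_e_mul_div (n := 6) (by norm_num) (a * r)
        have hiff : ((6 : ℕ) : ℤ) ∣ a * r ↔ (6 : ℤ) ∣ r :=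
          ⟨fun h => ha.symm.dvd_of_dvd_mul_left h, fun h => h.mul_left a⟩
        simp only [hiff] at h
        exact_mod_cast h
      have hsum : ∀ i ∈ Finset.range 6, ∑ r ∈ Finset.range q, g r =
          ∑ r ∈ Finset.range q, g r * e (((a * r : ℤ) : ℂ) * i / 6) := by
        intro i _
        rw [← sum_range_add hq hgp (48 * c' * i)]
        exact Finset.sum_congr rfl fun r _ => hshift i r
      have h7 := Finset.sum_congr (rfl : Finset.range 6 = Finset.range 6) hsum
      rw [Finset.sum_const, Finset.card_range, nsmul_eq_mul, Finset.sum_comm] at h7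
      simp only [← Finset.mul_sum, h6] at h7
      simpa only [hg, Int.cast_natCast, Nat.cast_ofNat] using h7
    have h1 := key t
    have h2 := key 1
    refine mul_left_cancel₀ (by norm_num : (6 : ℂ) ≠ 0) ?_
    rw [h1, mul_left_comm, quadGauss, h2, Finset.mul_sum]
    refine Finset.sum_congr rfl fun r _ => ?_
    split_ifs with h6
    · rw [chi12_sub_of_six_dvd h6]; ring
    · simp

namespace IsThetaCoefficient

variable {κ : ℕ} {X : ℤ → ℂ} (hX : IsThetaCoefficient κ X)
include hX

lemma quadGauss_eq {c : ℕ} (hc : 0 < c) (hc24 : 24 ∣ c) {a a' s : ℤ} (hs : IsCoprime s (κ * c : ℕ))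
    (hs12 : 12 ∣ s - 1) (ha : ((κ * c : ℕ) : ℤ) ∣ a' - a * s ^ 2) :
    quadGauss (κ * c) X a' = quadGauss (κ * c) X a := by
  have hq : 0 < κ * c := Nat.mul_pos hX.pos hc
  set q := κ * c with hqdef
  have hq' : (q : ℂ) ≠ 0 := by exact_mod_cast hq.ne'
  have h12 : (12 : ℤ) ∣ q := by
    have : (12 : ℕ) ∣ q := (Dvd.dvd.trans (by norm_num) hc24).mul_left κ
    exact_mod_cast this
  set g : ℤ → ℂ := fun r => X (r - 1) * e ((a : ℂ) * (r : ℂ) ^ 2 / q) with hg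
  have hgp : ∀ n, g (n + q) = g n := by
    intro n
    simp only [hg]
    rw [e_mul_sq_div_add q hq, show n + (q : ℤ) - 1 = n - 1 + q by ring,
      periodic_of_add_twelve hX.add_twelve h12]
  have h := sum_range_mul hq hgp hs
  have h1 : quadGauss q X a = ∑ r ∈ Finset.range q, g r := by
    simp [quadGauss, hg]
  rw [h1, ← h, quadGauss]
  refine Finset.sum_congr rfl fun r _ => ?_
  simp only [hg]
  congr 1
  · obtain ⟨k, hk⟩ := hs12
    rw [show s * (r : ℤ) - 1 = r - 1 + 12 * (k * r) by linear_combination (r : ℤ) * hk,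
      periodic_of_add_twelve hX.add_twelve (Dvd.intro _ rfl)]
  · obtain ⟨k, hk⟩ := ha
    refine e_eq_of_sub (k := k * r ^ 2) ?_
    have hk' : (a' : ℂ) = a * s ^ 2 + q * k := by
      have := congrArg (fun n : ℤ => (n : ℂ)) hk
      push_cast at this
      linear_combination this
    rw [hk']
    push_cast
    field_simp

/-- Completing the square in the finite Fourier transform of `X(r) e(a r² / q)`. -/
lemma sum_even {c : ℕ} (hc : 0 < c) (hc24 : 24 ∣ c) {a d : ℤ}
    (had : ((κ * c : ℕ) : ℤ) ∣ a * d - 1) (k : ℤ) :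
    ∑ r ∈ Finset.range (κ * c), X r * e ((a : ℂ) * (r : ℂ) ^ 2 / (κ * c : ℕ)) *
        e (((2 * k : ℤ) : ℂ) * r / (κ * c : ℕ)) =
      e (-(d * k ^ 2 / (κ * c : ℕ))) * (X d * X k * quadGauss (κ * c) X a) := by
  have hq : 0 < κ * c := Nat.mul_pos hX.pos hc
  have h24 : (24 : ℤ) ∣ a * d - 1 := by
    obtain ⟨c', hc'⟩ := hc24
    exact Dvd.dvd.trans ⟨κ * c', by rw [hc']; push_cast; ring⟩ had
  have ha6 : IsCoprime a 6 := by
    obtain ⟨k, hk⟩ := h24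
    exact ⟨d, -(4 * k), by linear_combination hk⟩
  have h12 : (12 : ℤ) ∣ (κ * c : ℕ) := by
    have : (12 : ℕ) ∣ κ * c := (Dvd.dvd.trans (by norm_num) hc24).mul_left κ
    exact_mod_cast this
  rw [← hX.mul, ← hX.sum_sub c a (d * k) hc hc24 ha6]
  generalize κ * c = q at *
  have hq' : (q : ℂ) ≠ 0 := by exact_mod_cast hq.ne'
  set g : ℤ → ℂ := fun r => X (r - d * k) * e ((a : ℂ) * (r : ℂ) ^ 2 / q) with hg
  have hgp : ∀ n, g (n + q) = g n := by
    intro n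
    simp only [hg]
    rw [e_mul_sq_div_add q hq, show n + (q : ℤ) - d * k = n - d * k + q by ring,
      periodic_of_add_twelve hX.add_twelve h12]
  have h := sum_range_add hq hgp (d * k)
  have h1 : ∑ r ∈ Finset.range q, X (r - d * k) * e ((a : ℂ) * (r : ℂ) ^ 2 / q) =
      ∑ r ∈ Finset.range q, g r := by simp [hg]
  rw [h1, ← h, Finset.mul_sum]
  refine Finset.sum_congr rfl fun r _ => ?_
  simp only [hg]
  rw [add_sub_cancel_right, mul_left_comm, ← e_add, mul_assoc, ← e_add]
  congr 1
  obtain ⟨j, hj⟩ := had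
  have hj' : (a : ℂ) * d = 1 + q * j := by
    have := congrArg (fun n : ℤ => (n : ℂ)) hj
    push_cast at this
    linear_combination this
  refine e_eq_of_sub (k := -(2 * r * k * j + d * k ^ 2 * j)) ?_
  push_cast
  field_simp
  linear_combination (-2 * r * k - d * k ^ 2) * hj'

lemma sum_odd {c : ℕ} (hc : 0 < c) (hc24 : 24 ∣ c) (a : ℤ) {n : ℤ} (hn : ¬ 2 ∣ n) :
    ∑ r ∈ Finset.range (κ * c), X r * e ((a : ℂ) * (r : ℂ) ^ 2 / (κ * c : ℕ)) *
        e ((n : ℂ) * r / (κ * c : ℕ)) = 0 := by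
  have hq : 0 < κ * c := Nat.mul_pos hX.pos hc
  have h24 : 24 ∣ κ * c := hc24.mul_left κ
  generalize κ * c = q at *
  obtain ⟨q', rfl⟩ := h24
  have hq' : (q' : ℂ) ≠ 0 := by
    have : q' ≠ 0 := by rintro rfl; simp at hq
    exact_mod_cast this
  set g : ℤ → ℂ := fun r => X r * e ((a : ℂ) * (r : ℂ) ^ 2 / (24 * q' : ℕ)) *
    e ((n : ℂ) * r / (24 * q' : ℕ)) with hg
  have hgp : ∀ n, g (n + (24 * q' : ℕ)) = g n := by
    intro r
    simp only [hg]
    rw [e_mul_sq_div_add _ hq, periodic_of_add_twelve hX.add_twelve ⟨2 * q', by push_cast; ring⟩]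
    congr 1
    refine e_eq_of_sub (k := n) ?_
    push_cast
    field_simp
  have hhalf : ∀ r, g (r + 12 * q') = -g r := by
    intro r
    simp only [hg]
    rw [periodic_of_add_twelve hX.add_twelve (Dvd.intro _ rfl), mul_assoc, mul_assoc, ← mul_neg,
      ← e_add, ← e_add]
    congr 1
    have h2 : e (1 / 2) = -1 := by
      rw [e, show 2 * (Real.pi : ℂ) * I * (1 / 2) = Real.pi * I by ring, Complex.exp_pi_mul_I]
    obtain ⟨m, hm⟩ : ∃ m, n = 2 * m + 1 := ⟨n / 2, by omega⟩
    rw [neg_eq_neg_one_mul, ← h2, ← e_add]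
    refine e_eq_of_sub (k := a * (r + 6 * q') + m) ?_
    rw [hm]
    push_cast
    field_simp
    ring
  have h := sum_range_add hq hgp (12 * q')
  simp only [hhalf, Finset.sum_neg_distrib] at h
  have h0 : ∑ r ∈ Finset.range (24 * q'), g r = 0 := by linear_combination -h / 2
  rw [← h0]
  simp [hg]

omit hX in
/-- Poisson summation over a residue class. -/
lemma _root_.RamanujanType.hasSum_exp_residue {q : ℕ} (hq : 0 < q) {t : ℂ} (ht : 0 < t.im)
    (r : ℂ) :
    HasSum (fun k : ℤ => cexp (Real.pi * I * t * ((r + q * k) / q) ^ 2))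
      (1 / (-I * t) ^ (1 / 2 : ℂ) * jacobiTheta₂ (r / q) (-1 / t)) := by
  have hq' : (q : ℂ) ≠ 0 := by exact_mod_cast hq.ne'
  have ht0 : t ≠ 0 := by rintro rfl; simp at ht
  have hfe := jacobiTheta₂_functional_equation (r * t / q) t
  have h1 := (hasSum_jacobiTheta₂_term (r * t / q) ht).mul_left
    (cexp (Real.pi * I * t * (r / q) ^ 2))
  have h3 : cexp (Real.pi * I * t * (r / q) ^ 2) *
      cexp (-Real.pi * I * (r * t / q) ^ 2 / t) = 1 := by
    rw [← Complex.exp_add, ← Complex.exp_zero]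
    congr 1
    field_simp
    ring
  have h4 : r * t / q / t = r / q := by field_simp
  have h2 : cexp (Real.pi * I * t * (r / q) ^ 2) * jacobiTheta₂ (r * t / q) t =
      1 / (-I * t) ^ (1 / 2 : ℂ) * jacobiTheta₂ (r / q) (-1 / t) := by
    rw [hfe, h4]
    linear_combination (1 / (-I * t) ^ (1 / 2 : ℂ) * jacobiTheta₂ (r / q) (-1 / t)) * h3
  rw [h2] at h1
  refine Eq.mp (congrArg (fun G => HasSum G _) (funext fun k => ?_)) h1
  rw [jacobiTheta₂_term, ← Complex.exp_add]
  congr 1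
  field_simp
  ring

/-- The transformation law of theta series, by Poisson summation in each residue class modulo
`κ c`. -/
lemma thetaSeries_transform {c : ℕ} (hc : 0 < c) (hc24 : 24 ∣ c) {a d : ℤ}
    (had : ((κ * c : ℕ) : ℤ) ∣ a * d - 1) {τ σ : ℂ} (hσ : 0 < σ.im)
    (hτ : τ = a / c - 1 / (c * (c * σ + d))) :
    thetaSeries κ X τ = 1 / (2 * (κ * c : ℕ) * I / (c * σ + d)) ^ (1 / 2 : ℂ) *
      (X d * quadGauss (κ * c) X a) * thetaSeries κ X σ := by
  have hq : 0 < κ * c := Nat.mul_pos hX.pos hc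
  have hκ' : (κ : ℂ) ≠ 0 := by exact_mod_cast hX.pos.ne'
  have hcc : (c : ℂ) ≠ 0 := by exact_mod_cast hc.ne'
  have h12 : (12 : ℤ) ∣ (κ * c : ℕ) := by
    have : (12 : ℕ) ∣ κ * c := (Dvd.dvd.trans (by norm_num) hc24).mul_left κ
    exact_mod_cast this
  have heven := hX.sum_even hc hc24 had
  have hodd := fun n : ℤ => hX.sum_odd hc hc24 a (n := n)
  have hqc : ((κ * c : ℕ) : ℂ) = κ * c := by push_cast; ring
  generalize κ * c = q at *
  have hq' : (q : ℂ) ≠ 0 := by exact_mod_cast hq.ne'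
  have hwim : (c * σ + d).im = c * σ.im := by
    rw [add_im, Complex.intCast_im, add_zero, ← Complex.ofReal_natCast, Complex.im_ofReal_mul]
  have hwpos : 0 < (c * σ + d).im := by
    rw [hwim]
    have : (0 : ℝ) < c := by exact_mod_cast hc
    positivity
  have hσw : c * σ = (c * σ + d) - d := by ring
  generalize hw : (c : ℂ) * σ + d = w at *
  have hw0 : w ≠ 0 := by rintro rfl; simp at hwpos
  set t : ℂ := -2 * q / w with ht
  have htim' : 0 < t.im := by
    have h1 : t = ((-(2 * q) : ℝ) : ℂ) * w⁻¹ := by rw [ht]; push_cast; ring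
    rw [h1, Complex.im_ofReal_mul, Complex.inv_im, neg_div]
    have h2 : 0 < w.im / normSq w := div_pos hwpos (normSq_pos.mpr hw0)
    have h3 : (0 : ℝ) < q := by exact_mod_cast hq
    nlinarith
  have htinv : -1 / t = w / (2 * q) := by rw [ht]; field_simp
  have htim : 0 < (w / (2 * q)).im := by
    have : w / (2 * q) = w / ((2 * q : ℕ) : ℂ) := by push_cast; rfl
    rw [this, Complex.div_natCast_im]
    positivity
  set R : ℂ := 1 / (2 * q * I / w) ^ (1 / 2 : ℂ) with hR
  have hRt : 1 / (-I * t) ^ (1 / 2 : ℂ) = R := by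
    rw [hR, ht]; congr 2; ring
  have hfib : ∀ r ∈ Finset.range q, HasSum (fun k : ℤ => X (r + q * k) *
      e (((r + q * k : ℤ) : ℂ) ^ 2 * τ / κ))
      (X r * e ((a : ℂ) * (r : ℂ) ^ 2 / q) * (R * jacobiTheta₂ ((r : ℂ) / q) (w / (2 * q)))) := by
    intro r _
    have h1 := (hasSum_exp_residue hq htim' r).mul_left (X r * e ((a : ℂ) * (r : ℂ) ^ 2 / q))
    rw [htinv, hRt] at h1
    refine Eq.mp (congrArg (fun G => HasSum G _) (funext fun k => ?_)) h1
    rw [periodic_of_add_twelve hX.add_twelve (h12.mul_right k), mul_assoc]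
    congr 1
    have h5 : cexp (Real.pi * I * t * ((r + q * k) / q) ^ 2) =
        e (-((r + q * k) ^ 2 / (q * w))) := by
      rw [e]
      congr 1
      rw [ht]
      field_simp
    rw [h5, ← e_add]
    refine (e_eq_of_sub (k := a * (2 * r * k + q * k ^ 2)) ?_).symm
    rw [hτ]
    push_cast
    rw [hqc]
    field_simp
    ring
  have hmain : thetaSeries κ X τ = ∑ r ∈ Finset.range q, X r * e ((a : ℂ) * (r : ℂ) ^ 2 / q) *
      (R * jacobiTheta₂ ((r : ℂ) / q) (w / (2 * q))) :=
    (hasSum_of_residues (F := fun n : ℤ => X n * e ((n : ℂ) ^ 2 * τ / κ)) hq hfib).tsum_eq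
  have hdual : HasSum (fun n : ℤ => (∑ r ∈ Finset.range q,
      X r * e ((a : ℂ) * (r : ℂ) ^ 2 / q) * e (n * r / q)) * e (n ^ 2 * w / (4 * q)))
      (∑ r ∈ Finset.range q, X r * e ((a : ℂ) * (r : ℂ) ^ 2 / q) *
        jacobiTheta₂ ((r : ℂ) / q) (w / (2 * q))) := by
    have h1 := hasSum_sum fun r (_ : r ∈ Finset.range q) =>
      (hasSum_jacobiTheta₂_term ((r : ℂ) / q) htim).mul_left (X r * e ((a : ℂ) * (r : ℂ) ^ 2 / q))
    refine Eq.mp (congrArg (fun G => HasSum G _) (funext fun n => ?_)) h1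
    rw [Finset.sum_mul]
    refine Finset.sum_congr rfl fun r _ => ?_
    have h2 : jacobiTheta₂_term n ((r : ℂ) / q) (w / (2 * q)) =
        e (n * r / q) * e (n ^ 2 * w / (4 * q)) := by
      rw [jacobiTheta₂_term, ← e_add, e]
      congr 1
      field_simp
      ring
    rw [h2, mul_assoc _ (e (n * r / q))]
  have hinj : Function.Injective fun k : ℤ => 2 * k := fun a b hab => by simpa using hab
  have hfin := (hinj.hasSum_iff (fun n hn => by
    rw [hodd n fun ⟨k, hk⟩ => hn ⟨k, hk.symm⟩, zero_mul])).mpr hdual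
  have hfin' : HasSum (fun k : ℤ => X d * quadGauss q X a * (X k * e (k ^ 2 * σ / κ)))
      (∑ r ∈ Finset.range q, X r * e ((a : ℂ) * (r : ℂ) ^ 2 / q) *
        jacobiTheta₂ ((r : ℂ) / q) (w / (2 * q))) := by
    refine Eq.mp (congrArg (fun G => HasSum G _) (funext fun k => ?_)) hfin
    simp only [Function.comp_apply]
    rw [heven]
    have : e (-(d * k ^ 2 / q)) * e (((2 * k : ℤ) : ℂ) ^ 2 * w / (4 * q)) = e (k ^ 2 * σ / κ) := by
      rw [← e_add]
      congr 1
      rw [hqc]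
      push_cast
      field_simp
      linear_combination (-4 * (k : ℂ) ^ 2) * hσw
    rw [← this]
    ring
  have htsum := hfin'.tsum_eq
  rw [tsum_mul_left] at htsum
  refine hmain.trans ?_
  rw [mul_assoc, thetaSeries, htsum, Finset.mul_sum]
  exact Finset.sum_congr rfl fun r _ => by ring

end IsThetaCoefficient


/-! ### The multiplier systems on matrices with the same lower left entry -/

lemma coe_smul_eq (γ : SL(2, ℤ)) (τ : ℍ) : ((γ • τ : ℍ) : ℂ) =
    (((γ 0 0 : ℤ) : ℂ) * τ + ((γ 0 1 : ℤ) : ℂ)) / (((γ 1 0 : ℤ) : ℂ) * τ + ((γ 1 1 : ℤ) : ℂ)) := by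
  rw [UpperHalfPlane.coe_specialLinearGroup_apply]
  simp

lemma SL2_det (γ : SL(2, ℤ)) : γ 0 0 * γ 1 1 - γ 0 1 * γ 1 0 = 1 := by
  rw [← Matrix.det_fin_two γ.1]
  exact γ.2

lemma im_natCast_mul_add_pos {c : ℕ} (hc : 0 < c) (d : ℤ) {t : ℂ} (ht : 0 < t.im) :
    0 < (c * t + d : ℂ).im := by
  rw [add_im, Complex.intCast_im, add_zero, ← Complex.ofReal_natCast, Complex.im_ofReal_mul]
  have : (0 : ℝ) < c := by exact_mod_cast hc
  positivity

lemma re_mul_I_div_pos {q : ℕ} (hq : 0 < q) {w : ℂ} (hw : 0 < w.im) :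
    0 < (2 * (q : ℂ) * I / w).re := by
  have hw0 : w ≠ 0 := by rintro rfl; simp at hw
  have h1 : 2 * (q : ℂ) * I / w = ((2 * q : ℝ) : ℂ) * (I * w⁻¹) := by push_cast; ring
  rw [h1, Complex.re_ofReal_mul, Complex.mul_re, Complex.I_re, Complex.I_im, Complex.inv_im,
    zero_mul, one_mul, zero_sub, neg_div, neg_neg]
  have h2 : 0 < w.im / normSq w := div_pos hw (normSq_pos.mpr hw0)
  have h3 : (0 : ℝ) < q := by exact_mod_cast hq
  positivity

lemma cpow_half_sq (x : ℂ) : (x ^ (1 / 2 : ℂ)) ^ 2 = x := by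
  have := Complex.cpow_nat_inv_pow x two_ne_zero
  rwa [Nat.cast_ofNat, ← one_div] at this

/-- The lift of a matrix `γ` with positive lower left entry `c` by the square root of `c τ + d`
that is adapted to the transformation law of theta series; the result is independent of the
auxiliary integer `q`. -/
def Mp.ofPos (γ : SL(2, ℤ)) {c q : ℕ} (hc : 0 < c) (hq : 0 < q) (hγ : γ 1 0 = c) : Mp where
  γ := γ
  ω := fun τ => e (1 / 8) * (2 * q : ℂ) ^ (1 / 2 : ℂ) /
    (2 * (q : ℂ) * I / (c * τ + ((γ 1 1 : ℤ) : ℂ))) ^ (1 / 2 : ℂ)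
  holo := by
    intro t ht
    have ht' : 0 < t.im := ht
    have hw := im_natCast_mul_add_pos hc (γ 1 1) ht'
    have hw0 : (c * t + ((γ 1 1 : ℤ) : ℂ)) ≠ 0 := fun h0 => by rw [h0] at hw; simp at hw
    have hre := re_mul_I_div_pos hq hw
    have hs : 2 * (q : ℂ) * I / (c * t + ((γ 1 1 : ℤ) : ℂ)) ∈ slitPlane := Or.inl hre
    have h1 : AnalyticAt ℂ (fun t : ℂ => 2 * (q : ℂ) * I / (c * t + ((γ 1 1 : ℤ) : ℂ))) t :=
      analyticAt_const.div ((analyticAt_const.mul analyticAt_id).add analyticAt_const) hw0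
    have h2 : AnalyticAt ℂ (fun t : ℂ => e (1 / 8) * (2 * q : ℂ) ^ (1 / 2 : ℂ) /
        (2 * (q : ℂ) * I / (c * t + ((γ 1 1 : ℤ) : ℂ))) ^ (1 / 2 : ℂ)) t := by
      refine analyticAt_const.div (h1.cpow analyticAt_const hs) ?_
      rw [Complex.cpow_ne_zero_iff]
      exact Or.inl (slitPlane_ne_zero hs)
    refine h2.congr ?_
    filter_upwards [(isOpen_upperHalfPlaneSet).mem_nhds ht] with s hs
    rw [coe_ofComplex hs]
  sq := by
    intro τ
    have hw := im_natCast_mul_add_pos hc (γ 1 1) τ.im_pos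
    have hw0 : (c * (τ : ℂ) + ((γ 1 1 : ℤ) : ℂ)) ≠ 0 := fun h0 => by
      have : (c * (τ : ℂ) + ((γ 1 1 : ℤ) : ℂ)).im = 0 := by rw [h0]; rfl
      exact hw.ne' this
    have hq' : (q : ℂ) ≠ 0 := by exact_mod_cast hq.ne'
    have h8 : e (1 / 8) ^ 2 = I := by
      rw [← e_natCast_mul, e, show 2 * (Real.pi : ℂ) * I * ((2 : ℕ) * (1 / 8)) = Real.pi / 2 * I by
        push_cast; ring, Complex.exp_pi_div_two_mul_I]
    rw [div_pow, mul_pow, cpow_half_sq, cpow_half_sq, h8, hγ]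
    push_cast
    have := Complex.I_ne_zero
    field_simp

namespace IsThetaCoefficient

variable {κ : ℕ} {X : ℤ → ℂ} (hX : IsThetaCoefficient κ X)
include hX

/-- The value of the multiplier system of a theta series on a matrix whose lower left entry is
divisible by `24`. -/
lemma charOf_ofPos {h : ℍ → ℂ} {A : ℂ} (hA : A ≠ 0) (hh : ∀ τ : ℍ, thetaSeries κ X τ = A * h τ)
    (γ : SL(2, ℤ)) {c : ℕ} (hc : 0 < c) (hq : 0 < κ * c) (hγ : γ 1 0 = c) (hc24 : 24 ∣ c)
    (hκ : (κ : ℤ) ∣ γ 0 1) :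
    charOf h (Mp.ofPos γ hc hq hγ) =
      (e (1 / 8) * (2 * (κ * c : ℕ) : ℂ) ^ (1 / 2 : ℂ))⁻¹ *
        (X (γ 1 1) * quadGauss (κ * c) X (γ 0 0)) * (h UpperHalfPlane.I / h UpperHalfPlane.I) := by
  have hdet := SL2_det γ
  rw [hγ] at hdet
  have hw := im_natCast_mul_add_pos hc (γ 1 1) UpperHalfPlane.I.im_pos
  have hw0 : (c * ((UpperHalfPlane.I : ℍ) : ℂ) + ((γ 1 1 : ℤ) : ℂ)) ≠ 0 := fun h0 => by
    have : (c * ((UpperHalfPlane.I : ℍ) : ℂ) + ((γ 1 1 : ℤ) : ℂ)).im = 0 := by rw [h0]; rfl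
    exact hw.ne' this
  have hcc : (c : ℂ) ≠ 0 := by exact_mod_cast hc.ne'
  have hroot : (2 * ((κ * c : ℕ) : ℂ) * I /
      (c * ((UpperHalfPlane.I : ℍ) : ℂ) + ((γ 1 1 : ℤ) : ℂ))) ^ (1 / 2 : ℂ) ≠ 0 := by
    rw [Complex.cpow_ne_zero_iff]
    refine Or.inl fun h0 => ?_
    have := re_mul_I_div_pos hq hw
    rw [h0] at this
    simp at this
  have had : ((κ * c : ℕ) : ℤ) ∣ γ 0 0 * γ 1 1 - 1 := by
    obtain ⟨k, hk⟩ := hκ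
    exact ⟨k, by push_cast; rw [hk] at hdet; linear_combination hdet⟩
  have htr := hX.thetaSeries_transform hc hc24 had (σ := (UpperHalfPlane.I : ℍ))
    (τ := ((γ • UpperHalfPlane.I : ℍ) : ℂ)) UpperHalfPlane.I.im_pos (by
      have hdet' : ((γ 0 0 : ℤ) : ℂ) * ((γ 1 1 : ℤ) : ℂ) - ((γ 0 1 : ℤ) : ℂ) * c = 1 := by
        exact_mod_cast congrArg (fun n : ℤ => (n : ℂ)) hdet
      rw [coe_smul_eq, hγ, Int.cast_natCast, div_eq_iff hw0, sub_mul, one_div, mul_inv, mul_assoc ((c : ℂ)⁻¹), inv_mul_cancel₀ hw0]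
      field_simp
      linear_combination -hdet')
  rw [hh, hh] at htr
  rw [charOf, slash, zpow_neg, zpow_one]
  change (e (1 / 8) * (2 * (κ * c : ℕ) : ℂ) ^ (1 / 2 : ℂ) /
    (2 * ((κ * c : ℕ) : ℂ) * I / (c * ((UpperHalfPlane.I : ℍ) : ℂ) +
      ((γ 1 1 : ℤ) : ℂ))) ^ (1 / 2 : ℂ))⁻¹ * h (γ • UpperHalfPlane.I) / _ = _
  generalize (2 * ((κ * c : ℕ) : ℂ) * I /
      (c * ((UpperHalfPlane.I : ℍ) : ℂ) + ((γ 1 1 : ℤ) : ℂ))) ^ (1 / 2 : ℂ) = R at *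
  have h1 : h (γ • UpperHalfPlane.I) = R⁻¹ * (X (γ 1 1) * quadGauss (κ * c) X (γ 0 0)) *
      h UpperHalfPlane.I := by
    refine mul_left_cancel₀ hA ?_
    rw [htr]
    ring
  rw [h1]
  field_simp

/-- Matrices with the same lower left entry `c`, whose upper left entries differ modulo `κ c` by
the square of a unit that is `1` modulo `12`, have the same multiplier. -/
lemma charOf_ofPos_eq {h : ℍ → ℂ} {A : ℂ} (hA : A ≠ 0)
    (hh : ∀ τ : ℍ, thetaSeries κ X τ = A * h τ) (γ γ' : SL(2, ℤ)) {c : ℕ} (hc : 0 < c)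
    (hq : 0 < κ * c) (hγ : γ 1 0 = c) (hγ' : γ' 1 0 = c) (hc24 : 24 ∣ c) (hκ : (κ : ℤ) ∣ γ 0 1)
    (hκ' : (κ : ℤ) ∣ γ' 0 1) (hd : 12 ∣ γ' 1 1 - γ 1 1) {s : ℤ} (hs : IsCoprime s (κ * c : ℕ))
    (hs12 : 12 ∣ s - 1) (ha : ((κ * c : ℕ) : ℤ) ∣ γ' 0 0 - γ 0 0 * s ^ 2) :
    charOf h (Mp.ofPos γ' hc hq hγ') = charOf h (Mp.ofPos γ hc hq hγ) := by
  rw [hX.charOf_ofPos hA hh γ hc hq hγ hc24 hκ, hX.charOf_ofPos hA hh γ' hc hq hγ' hc24 hκ',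
    hX.quadGauss_eq hc hc24 hs hs12 ha]
  congr 3
  have := periodic_of_add_twelve hX.add_twelve hd (γ 1 1)
  rwa [add_sub_cancel] at this

end IsThetaCoefficient

lemma slash_T (w : ℤ) (h : ℍ → ℂ) (τ : ℍ) : slash w h Mp.T τ = h ((1 : ℝ) +ᵥ τ) := by
  rw [slash]
  change (1 : ℂ) ^ (-w) * h (ModularGroup.T • τ) = _
  rw [one_zpow, one_mul, UpperHalfPlane.modular_T_smul]

/-- Both multiplier systems come from theta series. -/
lemma exists_isThetaCoefficient {v : Mp → ℂ} (hv : v = chiTheta ∨ v = chiEta) :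
    ∃ (κ : ℕ) (X : ℤ → ℂ) (h : ℍ → ℂ) (A : ℂ), IsThetaCoefficient κ X ∧ κ ∣ 24 ∧ A ≠ 0 ∧
      (∀ τ : ℍ, thetaSeries κ X τ = A * h τ) ∧ v = charOf h ∧
      (v Mp.T ≠ 0 → v Mp.T = e (1 / κ)) := by
  rcases hv with rfl | rfl
  · have hθ : ∀ τ : ℍ, thetaSeries 1 (fun _ => 1) τ = 1 * theta τ := by
      intro τ
      rw [one_mul, theta, thetaSeries, jacobiTheta]
      refine tsum_congr fun n => ?_
      rw [one_mul, e]
      congr 1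
      push_cast
      ring
    refine ⟨1, _, theta, 1, isThetaCoefficient_one, by norm_num, one_ne_zero, hθ, rfl,
      fun h0 => ?_⟩
    have hT := slash_T 1 theta UpperHalfPlane.I
    have h1 : theta ((1 : ℝ) +ᵥ UpperHalfPlane.I) = theta UpperHalfPlane.I := by
      rw [theta, theta, ← jacobiTheta_two_add (2 * (UpperHalfPlane.I : ℍ)),
        UpperHalfPlane.coe_vadd]
      congr 1
      push_cast
      ring
    rw [chiTheta, charOf, hT, h1] at h0 ⊢
    rw [div_self fun h2 => h0 (by rw [h2, div_zero])]
    rw [show 1 / ((1 : ℕ) : ℂ) = ((1 : ℤ) : ℂ) by norm_num, e_intCast]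
  · refine ⟨24, _, dedekindEta, 2, isThetaCoefficient_chi12, by norm_num, two_ne_zero,
      fun τ => thetaSeries_chi12 τ.im_pos, rfl,
      fun _ => ?_⟩
    have hne : dedekindEta UpperHalfPlane.I ≠ 0 := ModularForm.eta_ne_zero UpperHalfPlane.I.im_pos
    rw [chiEta, charOf, slash_T, div_eq_iff hne, dedekindEta, dedekindEta, ModularForm.eta,
      ModularForm.eta, ← mul_assoc, UpperHalfPlane.coe_vadd, Complex.ofReal_one]
    congr 1
    · simp only [Function.Periodic.qParam, e]
      rw [← Complex.exp_add]
      congr 1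
      push_cast
      ring
    · refine tprod_congr fun n => ?_
      rw [ModularForm.eta_q_eq_pow, ModularForm.eta_q_eq_pow]
      change 1 - e _ ^ _ = 1 - e _ ^ _
      rw [add_comm, ← Int.cast_one, e_add_intCast]


/-! ### Transfer of vanishing Fourier coefficients -/

lemma fourierInt_eq_zero_of_translate {D : ℕ} (hD : 0 < D) {F : ℂ → ℂ} {Y : ℝ} {β : ℚ}
    (hper : ∀ x : ℝ, F (x + Y * I + D) = F (x + Y * I))
    (htr : ∀ x : ℝ, F (x + Y * I + 1) = e β * F (x + Y * I)) {k : ℤ}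
    (hk : ¬ ∃ r : ℤ, (k / D : ℚ) = r + β) : fourierInt D F Y (k / D) = 0 := by
  have h1 := fourierInt_add_real hD hper 1 k
  have h2 : fourierInt D (fun z => F (z + (1 : ℝ))) Y (k / D) =
      e β * fourierInt D F Y (k / D) := by
    rw [← fourierInt_const_mul]
    exact fourierInt_congr _ fun x => by rw [Complex.ofReal_one, htr]
  rw [h2, Complex.ofReal_one, mul_one] at h1
  by_contra hne
  obtain ⟨r, hr⟩ := e_eq_e_iff.mp (mul_right_cancel₀ hne h1)
  refine hk ⟨-r, ?_⟩
  have : (β : ℂ) = ((k / D + r : ℚ) : ℂ) := by rw [hr]; push_cast; ring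
  have h3 : β = k / D + r := by exact_mod_cast this
  rw [h3]
  push_cast
  ring

lemma periodic_of_translate {F : ℂ → ℂ} {β : ℚ} {D : ℕ} (hβ : ∃ k : ℤ, β * D = k) {Y : ℝ}
    (htr : ∀ x : ℝ, F (x + Y * I + 1) = e β * F (x + Y * I)) (x : ℝ) :
    F (x + Y * I + D) = F (x + Y * I) := by
  have h : ∀ n : ℕ, F (x + Y * I + n) = e β ^ n * F (x + Y * I) := by
    intro n
    induction n with
    | zero => simp
    | succ n ih =>
      have := htr (x + n)
      push_cast at this
      rw [show (x : ℂ) + Y * I + (n + 1 : ℕ) = x + n + Y * I + 1 by push_cast; ring, this,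
        show (x : ℂ) + n + Y * I = x + Y * I + n by ring, ih, pow_succ]
      ring
  obtain ⟨k, hk⟩ := hβ
  have : (D : ℂ) * β = k := by rw [mul_comm]; exact_mod_cast congrArg (fun x : ℚ => (x : ℂ)) hk
  rw [h, ← e_natCast_mul, this, e_intCast, one_mul]

lemma fourierInt_sum_shift {D : ℕ} (hD : 0 < D) {F : ℂ → ℂ} {Y : ℝ}
    (hc : Continuous fun x : ℝ => F (x + Y * I))
    (hper : ∀ x : ℝ, F (x + Y * I + D) = F (x + Y * I)) (M : ℕ) (s : ℝ) (θ : ℂ) (k : ℤ) :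
    fourierInt D (fun t => ∑ j ∈ Finset.range M, e (j * θ) * F (t + (j * s : ℝ))) Y (k / D) =
      (∑ j ∈ Finset.range M, e (j * ((k / D : ℚ) * s + θ))) * fourierInt D F Y (k / D) := by
  rw [fourierInt_sum, Finset.sum_mul]
  · refine Finset.sum_congr rfl fun j _ => ?_
    rw [fourierInt_const_mul, fourierInt_add_real hD hper, ← mul_assoc, ← e_add]
    congr 2
    push_cast
    ring
  · intro j _
    have : (fun x : ℝ => e (j * θ) * F (x + Y * I + (j * s : ℝ))) =
        fun x : ℝ => e (j * θ) * F (((x + j * s : ℝ) : ℂ) + Y * I) := by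
      funext x
      congr 2
      push_cast
      ring
    rw [this]
    exact continuous_const.mul (hc.comp (continuous_id.add continuous_const))

/-- Suppose that translations of `F` by multiples of `a²/M` correspond to translations of `H` by
multiples of `1/M`. If the Fourier coefficients of `F` vanish on `M ℤ + β`, then those of `H`
vanish on `M ℤ + u² β`. -/
lemma fourierInt_eq_zero_of_shift {D M : ℕ} (hD : 0 < D) (hM : 0 < M) {F H : ℂ → ℂ} {β : ℚ}
    (hβ : ∃ k : ℤ, β * D = k)
    (hFc : ∀ Y : ℝ, 0 < Y → Continuous fun x : ℝ => F (x + Y * I))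
    (hFt : ∀ t : ℂ, 0 < t.im → F (t + 1) = e β * F t)
    (hHc : ∀ Y : ℝ, 0 < Y → Continuous fun x : ℝ => H (x + Y * I))
    (hHt : ∀ t : ℂ, 0 < t.im → H (t + 1) = e β * H t) {a u : ℤ}
    (hau : ∃ k : ℤ, ((a : ℚ) ^ 2 - u ^ 2) * β = M * k) (ha : IsCoprime a (M : ℤ))
    (hrel : ∀ t : ℂ, 0 < t.im → ∃ t' A : ℂ, 0 < t'.im ∧ A ≠ 0 ∧
      ∀ j : ℕ, F (t' + (j * (a ^ 2 / M) : ℝ)) = A * H (t + (j * (1 / M) : ℝ)))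
    (hvan : ∀ Y : ℝ, 0 < Y → ∀ k : ℤ, (k / D : ℚ) ∈ progression M β → fourierInt D F Y (k / D) = 0)
    {Y : ℝ} (hY : 0 < Y) {k : ℤ} (hk : (k / D : ℚ) ∈ progression M (u ^ 2 * β)) :
    fourierInt D H Y (k / D) = 0 := by
  have hM' : (M : ℂ) ≠ 0 := by exact_mod_cast hM.ne'
  have him : ∀ (Y x : ℝ), ((x : ℂ) + Y * I).im = Y := fun Y x => by simp
  have hsh : ∀ Y x s : ℝ, (x : ℂ) + Y * I + (s : ℝ) = ((x + s : ℝ) : ℂ) + Y * I := by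
    intro Y x s
    push_cast
    ring
  have hFt' : ∀ Y : ℝ, 0 < Y → ∀ x : ℝ, F (x + Y * I + 1) = e β * F (x + Y * I) :=
    fun Y hY x => hFt _ (by rwa [him])
  have hHt' : ∀ x : ℝ, H (x + Y * I + 1) = e β * H (x + Y * I) := fun x => hHt _ (by rwa [him])
  set θ : ℂ := -(u ^ 2 * β / M) with hθ
  have hS : ∀ t : ℂ, 0 < t.im →
      ∑ j ∈ Finset.range M, e (j * θ) * F (t + (j * (a ^ 2 / M) : ℝ)) = 0 := by
    intro t ht
    have hper := periodic_of_translate hβ (hFt' t.im ht)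
    have h := eq_zero_of_fourierInt_eq_zero hD
      (F := fun t => ∑ j ∈ Finset.range M, e (j * θ) * F (t + (j * (a ^ 2 / M) : ℝ))) (y := t.im)
      ?_ ?_ ?_ t.re
    · rwa [Complex.re_add_im] at h
    · refine continuous_finsetSum _ fun j _ => continuous_const.mul ?_
      have h1 := (hFc t.im ht).comp (continuous_id.add (continuous_const (y := (j * (a ^ 2 / M) : ℝ))))
      refine h1.congr fun x => ?_
      simp only [Function.comp_apply]
      rw [hsh]
      rfl
    · intro x
      refine Finset.sum_congr rfl fun j _ => ?_
      rw [hsh, ← hper, add_right_comm, hsh]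
    · intro i
      rw [fourierInt_sum_shift hD (hFc t.im ht) hper]
      by_cases hi : ∃ r : ℤ, (i / D : ℚ) = r + β
      · obtain ⟨r, hr⟩ := hi
        by_cases hMr : (M : ℤ) ∣ r
        · rw [hvan t.im ht i, mul_zero]
          obtain ⟨s, rfl⟩ := hMr
          exact ⟨s, by rw [hr]; push_cast; ring⟩
        · obtain ⟨s, hs⟩ := hau
          have hs' : ((a : ℂ) ^ 2 - u ^ 2) * β = M * s := by exact_mod_cast hs
          have h1 : ∀ j ∈ Finset.range M, e (j * (((i / D : ℚ) : ℂ) * (a ^ 2 / M : ℝ) + θ)) =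
              e (((a ^ 2 * r : ℤ) : ℂ) * j / M) := by
            intro j _
            refine e_eq_of_sub (k := j * s) ?_
            rw [hr, hθ]
            push_cast
            field_simp
            linear_combination (j : ℂ) * hs'
          rw [Finset.sum_congr rfl h1, sum_e_mul_div hM, if_neg, zero_mul]
          intro hdvd
          exact hMr ((ha.pow_left (m := 2)).symm.dvd_of_dvd_mul_left hdvd)
      · rw [fourierInt_eq_zero_of_translate hD hper (hFt' t.im ht) hi, mul_zero]
  have hS' : ∀ t : ℂ, 0 < t.im →
      ∑ j ∈ Finset.range M, e (j * θ) * H (t + (j * (1 / M) : ℝ)) = 0 := by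
    intro t ht
    obtain ⟨t', A, ht', hA, hj⟩ := hrel t ht
    have h1 := hS t' ht'
    simp only [hj] at h1
    refine (mul_eq_zero.mp (?_ : A * _ = 0)).resolve_left hA
    rw [← h1, Finset.mul_sum]
    exact Finset.sum_congr rfl fun j _ => by ring
  have hper := periodic_of_translate hβ hHt'
  have h2 := fourierInt_sum_shift hD (hHc Y hY) hper M (1 / M) θ k
  have h3 : fourierInt D (fun t => ∑ j ∈ Finset.range M, e (j * θ) * H (t + (j * (1 / M) : ℝ))) Y
      (k / D) = 0 := by
    rw [fourierInt_congr (G := fun _ => 0) _ fun x => hS' _ (by rwa [him])]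
    simp [fourierInt]
  obtain ⟨i, hi⟩ := hk
  have h4 : ∀ j ∈ Finset.range M, e (j * (((k / D : ℚ) : ℂ) * (1 / M : ℝ) + θ)) = 1 := by
    intro j _
    rw [e_eq_one_iff]
    refine ⟨j * i, ?_⟩
    rw [hi, hθ]
    push_cast
    field_simp
    ring
  rw [h3, Finset.sum_congr rfl h4, Finset.sum_const, Finset.card_range, nsmul_eq_mul, mul_one] at h2
  exact (mul_eq_zero.mp h2.symm).resolve_left hM'


/-! ### Torsion points and the modular transformation -/

lemma intCast_div_not_mem_lattice {ℓ : ℕ} (hℓ : 0 < ℓ) {h : ℤ} (hh : ¬ (ℓ : ℤ) ∣ h) (τ : ℍ) :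
    (h / ℓ : ℂ) ∉ lattice τ := by
  have hℓ' : (ℓ : ℂ) ≠ 0 := by exact_mod_cast hℓ.ne'
  rw [mem_lattice_iff_of_abs_im_lt, sinFactor_eq_zero_iff]
  · rintro ⟨k, hk⟩
    rw [div_eq_iff hℓ'] at hk
    exact hh ⟨k, by rw [mul_comm]; exact_mod_cast hk⟩
  · have : (h / ℓ : ℂ).im = 0 := by
      rw [Complex.div_natCast_im, Complex.intCast_im, zero_div]
    rw [this, abs_zero]
    exact τ.im_pos

lemma sinFactor_intCast_div_ne_zero {ℓ : ℕ} (hℓ : 0 < ℓ) {h : ℤ} (hh : ¬ (ℓ : ℤ) ∣ h) :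
    sinFactor (h / ℓ : ℂ) ≠ 0 := by
  have hℓ' : (ℓ : ℂ) ≠ 0 := by exact_mod_cast hℓ.ne'
  rw [Ne, sinFactor_eq_zero_iff]
  rintro ⟨k, hk⟩
  rw [div_eq_iff hℓ'] at hk
  exact hh ⟨k, by rw [mul_comm]; exact_mod_cast hk⟩

lemma denom_eq_ne_zero (γ : SL(2, ℤ)) (τ : ℍ) :
    ((γ 1 0 : ℤ) : ℂ) * (τ : ℂ) + ((γ 1 1 : ℤ) : ℂ) ≠ 0 := by
  have := UpperHalfPlane.denom_ne_zero (γ : GL (Fin 2) ℝ) τ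
  simpa [UpperHalfPlane.denom] using this

lemma Mp.ω_ne_zero (g : Mp) (τ : ℍ) : g.ω τ ≠ 0 := by
  intro h0
  have hsq := g.sq τ
  rw [h0] at hsq
  exact denom_eq_ne_zero g.γ τ (by rw [← hsq]; ring)

section Transformation

variable {φ : ℍ → ℂ → ℂ} {w m : ℤ}

/-- The action of a matrix with lower left entry divisible by `ℓ²` on the values of a Jacobi form
at `ℓ`-torsion points. The exponential factors of the modular and the elliptic transformation
cancel, since the index is an integer. -/
lemma apply_smul_torsion {g : Mp} {r : ℂ}
    (htr : ∀ (τ : ℍ) (z : ℂ), z ∉ lattice τ → jacobiSlash w m φ g τ z = r * φ τ z)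
    (hheis : ∀ (l μ κ : ℤ) (τ : ℍ) (z : ℂ), z ∉ lattice τ →
      heisenbergSlash m φ l μ κ τ z = φ τ z)
    {ℓ : ℕ} (hℓ : ℓ.Prime) (hc : ((ℓ ^ 2 : ℕ) : ℤ) ∣ g.γ 1 0) {h : ℤ} (hh : ¬ (ℓ : ℤ) ∣ h) (τ : ℍ) :
    φ (g.γ • τ) (h / ℓ) = g.ω τ ^ w * r * φ τ ((h * g.γ 1 1 : ℤ) / ℓ) := by
  have hℓ' : (ℓ : ℂ) ≠ 0 := by exact_mod_cast hℓ.ne_zero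
  have hdet := SL2_det g.γ
  obtain ⟨c', hc'⟩ := hc
  have hd : ¬ (ℓ : ℤ) ∣ h * g.γ 1 1 := by
    intro hdvd
    rcases (Nat.prime_iff_prime_int.mp hℓ).dvd_or_dvd hdvd with h1 | ⟨k, hk⟩
    · exact hh h1
    · apply (Nat.prime_iff_prime_int.mp hℓ).not_dvd_one
      rw [← hdet, hc', hk]
      exact ⟨g.γ 0 0 * k - g.γ 0 1 * ℓ * c', by push_cast; ring⟩
  have hz₁ := intCast_div_not_mem_lattice hℓ.pos hd τ
  have hden0 : ((g.γ 1 0 : ℤ) : ℂ) * (τ : ℂ) + ((g.γ 1 1 : ℤ) : ℂ) ≠ 0 :=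
    denom_eq_ne_zero g.γ τ
  have hω : g.ω τ ≠ 0 := g.ω_ne_zero τ
  set d := g.γ 1 1 with hddef
  set z : ℂ := (h / ℓ : ℂ) * (((g.γ 1 0 : ℤ) : ℂ) * (τ : ℂ) + ((d : ℤ) : ℂ)) with hz
  have hzz : z = ((h * d : ℤ) / ℓ : ℂ) + ((h * ℓ * c' : ℤ) : ℂ) * τ + ((0 : ℤ) : ℂ) := by
    rw [hz, hc']
    push_cast
    field_simp
    ring
  have hz₂ : z ∉ lattice τ := by
    rintro ⟨l, μ, hlμ⟩
    apply hz₁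
    refine ⟨l - h * ℓ * c', μ, ?_⟩
    rw [hzz] at hlμ
    push_cast at hlμ ⊢
    linear_combination hlμ
  have h1 := htr τ z hz₂
  have h2 := hheis (h * ℓ * c') 0 0 τ _ hz₁
  rw [heisenbergSlash, ← hzz] at h2
  rw [jacobiSlash, hz, mul_div_cancel_right₀ _ hden0, ← hz] at h1
  rw [← h2]
  have h3 : e (m * (-((g.γ 1 0 : ℤ) : ℂ) * z ^ 2 /
      (((g.γ 1 0 : ℤ) : ℂ) * (τ : ℂ) + ((d : ℤ) : ℂ)))) *
      e (m * (((h * ℓ * c' : ℤ) : ℂ) ^ 2 * (τ : ℂ) + 2 * ((h * ℓ * c' : ℤ) : ℂ) *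
        ((h * d : ℤ) / ℓ) + ((0 : ℤ) : ℂ))) = 1 := by
    rw [← e_add, e_eq_one_iff]
    refine ⟨m * c' * h ^ 2 * d, ?_⟩
    rw [hz]
    have : -((g.γ 1 0 : ℤ) : ℂ) * ((h / ℓ : ℂ) * (((g.γ 1 0 : ℤ) : ℂ) * (τ : ℂ) + ((d : ℤ) : ℂ))) ^ 2 /
      (((g.γ 1 0 : ℤ) : ℂ) * (τ : ℂ) + ((d : ℤ) : ℂ)) = -((g.γ 1 0 : ℤ) : ℂ) * (h / ℓ : ℂ) ^ 2 *
        (((g.γ 1 0 : ℤ) : ℂ) * (τ : ℂ) + ((d : ℤ) : ℂ)) := by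
      field_simp
    rw [this, hc']
    push_cast
    field_simp
    ring
  have h4 : g.ω τ ^ w * g.ω τ ^ (-w) = 1 := by
    rw [← zpow_add₀ hω, add_neg_cancel, zpow_zero]
  generalize e (m * (-((g.γ 1 0 : ℤ) : ℂ) * z ^ 2 /
      (((g.γ 1 0 : ℤ) : ℂ) * (τ : ℂ) + ((d : ℤ) : ℂ)))) = E₁ at *
  generalize e (m * (((h * ℓ * c' : ℤ) : ℂ) ^ 2 * (τ : ℂ) + 2 * ((h * ℓ * c' : ℤ) : ℂ) *
        ((h * d : ℤ) / ℓ) + ((0 : ℤ) : ℂ))) = E₂ at *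
  generalize g.ω τ ^ w = W at *
  generalize g.ω τ ^ (-w) = W' at *
  linear_combination W * E₂ * h1 - W * W' * φ (g.γ • τ) (h / ℓ) * h3 - φ (g.γ • τ) (h / ℓ) * h4

end Transformation

/-- The matrix `(1 a²j/M; 0 1) γ (1 -j/M; 0 1)`, where `γ = (a b; M²c d)`. -/
def shiftMatrix (γ : SL(2, ℤ)) {M c : ℤ} (hγ : γ 1 0 = M ^ 2 * c) (j : ℤ) : SL(2, ℤ) :=
  ⟨!![γ 0 0 + M * c * γ 0 0 ^ 2 * j,
      γ 0 1 + γ 0 0 * γ 0 1 * M * c * j - c * γ 0 0 ^ 2 * j ^ 2;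
      M ^ 2 * c, γ 1 1 - M * c * j], by
    have := SL2_det γ
    rw [hγ] at this
    rw [Matrix.det_fin_two_of]
    linear_combination (1 + M * c * γ 0 0 * j) * this⟩

lemma shiftMatrix_smul (γ : SL(2, ℤ)) {M : ℕ} (hM : 0 < M) {c : ℤ} (hγ : γ 1 0 = (M : ℤ) ^ 2 * c)
    (j : ℤ) (τ : ℍ) : shiftMatrix γ hγ j • ((j * (1 / M) : ℝ) +ᵥ τ) =
      (j * ((γ 0 0 : ℤ) ^ 2 / M) : ℝ) +ᵥ (γ • τ) := by
  have hM' : (M : ℂ) ≠ 0 := by exact_mod_cast hM.ne'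
  have hdet : ((γ 0 0 : ℤ) : ℂ) * ((γ 1 1 : ℤ) : ℂ) - ((γ 0 1 : ℤ) : ℂ) * ((γ 1 0 : ℤ) : ℂ) = 1 := by
    exact_mod_cast congrArg (fun n : ℤ => (n : ℂ)) (SL2_det γ)
  have hden0 : ((γ 1 0 : ℤ) : ℂ) * (τ : ℂ) + ((γ 1 1 : ℤ) : ℂ) ≠ 0 := denom_eq_ne_zero γ τ
  have hγ' : ((γ 1 0 : ℤ) : ℂ) = (M : ℂ) ^ 2 * c := by
    rw [hγ]; push_cast; ring
  apply UpperHalfPlane.ext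
  rw [coe_smul_eq, UpperHalfPlane.coe_vadd, UpperHalfPlane.coe_vadd, coe_smul_eq]
  simp only [shiftMatrix, Matrix.SpecialLinearGroup.coe_mk, Matrix.of_apply, Matrix.cons_val_zero,
    Matrix.cons_val_one, Matrix.cons_val']
  rw [hγ'] at hdet hden0 ⊢
  have h1 : ((M ^ 2 * c : ℤ) : ℂ) * ((j * (1 / M) : ℝ) + (τ : ℂ)) + ((γ 1 1 - M * c * j : ℤ) : ℂ) =
      (M : ℂ) ^ 2 * c * τ + ((γ 1 1 : ℤ) : ℂ) := by
    push_cast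
    field_simp
    ring
  rw [h1, div_eq_iff hden0, add_mul, div_mul_cancel₀ _ hden0]
  push_cast
  field_simp
  linear_combination (-(j : ℂ) * ((γ 0 0 : ℤ) : ℂ)) * hdet

lemma exists_coprime_lift {n m : ℕ} (hm : 0 < m) (hnm : n ∣ m) {u : ℤ} (hu : IsCoprime u n) :
    ∃ a : ℤ, (n : ℤ) ∣ a - u ∧ IsCoprime a m := by
  have : NeZero m := ⟨hm.ne'⟩
  have hunit : IsUnit (u : ZMod n) := (ZMod.coe_int_isUnit_iff_isCoprime u n).mpr hu.symm
  obtain ⟨x, hx⟩ := ZMod.unitsMap_surjective hnm hunit.unit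
  refine ⟨(x : ZMod m).val, ?_, ?_⟩
  · rw [← ZMod.intCast_eq_intCast_iff_dvd_sub]
    have := congrArg (fun y : (ZMod n)ˣ => (y : ZMod n)) hx
    simp only [IsUnit.unit_spec, ZMod.unitsMap_val] at this
    rw [← this]
    simp
  · refine ((ZMod.coe_int_isUnit_iff_isCoprime _ m).mp ?_).symm
    simp


/-! ### Vanishing at torsion points on the progression `M ℤ + u² β` -/

section Transfer

variable {φ : ℍ → ℂ → ℂ} {ν : ℤ} {f : ℍ → ℂ} {β : ℚ} {w m : ℤ} {N : ℕ}
  {χ : DirichletCharacter ℂ N} {v : Mp → ℂ} {κ : ℕ} {X : ℤ → ℂ} {h₀ : ℍ → ℂ} {A₀ : ℂ}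

lemma leadingTerm_vadd_torsion {ℓ : ℕ} (hℓ : 0 < ℓ) {h : ℤ} (hh : ¬ (ℓ : ℤ) ∣ h) (τ : ℍ) (x : ℝ) :
    leadingTerm φ ν f ((τ : ℂ) + x) (h / ℓ) = sinFactor (h / ℓ) ^ ν * φ (x +ᵥ τ) (h / ℓ) := by
  rw [leadingTerm_of_ne (sinFactor_intCast_div_ne_zero hℓ hh)]
  congr 2
  apply UpperHalfPlane.ext
  rw [coe_ofComplex (by simpa using τ.im_pos), UpperHalfPlane.coe_vadd, add_comm]

/-- Translations by multiples of `a²/M` on the leading term at one torsion point correspond, under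
a suitable element of `Γ₀(N)`, to translations by multiples of `1/M` at another one. The factors of
automorphy agree for all translations, since the multipliers do. -/
lemma HasLeadingTerm.exists_shift (h : HasLeadingTerm φ ν f β)
    (hX : IsThetaCoefficient κ X) (hκ : κ ∣ 24) (hA : A₀ ≠ 0)
    (hh₀ : ∀ τ : ℍ, thetaSeries κ X τ = A₀ * h₀ τ) (hv : v = charOf h₀) (hN : 0 < N)
    (htr : ∀ g ∈ Gamma0Tilde N, ∀ (τ : ℍ) (z : ℂ), z ∉ lattice τ →
      jacobiSlash w m φ g τ z = twist χ v g * φ τ z)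
    (hne : ∀ g ∈ Gamma0Tilde N, twist χ v g ≠ 0)
    (hheis : ∀ (l μ κ : ℤ) (τ : ℍ) (z : ℂ), z ∉ lattice τ →
      heisenbergSlash m φ l μ κ τ z = φ τ z)
    {ℓ : ℕ} (hℓ : ℓ.Prime) {M : ℕ} (hM : 0 < M) {a : ℤ}
    (ha : IsCoprime a (24 * (M ^ 2 * (96 * N * ℓ ^ 2)) : ℕ)) {h₁ : ℤ} (hh₁ : ¬ (ℓ : ℤ) ∣ h₁)
    {t : ℂ} (ht : 0 < t.im) :
    ∃ t' A : ℂ, 0 < t'.im ∧ A ≠ 0 ∧ ∀ j : ℕ,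
      leadingTerm φ ν f (t' + (j * (a ^ 2 / M) : ℝ)) ((a * h₁ : ℤ) / ℓ) =
        A * leadingTerm φ ν f (t + (j * (1 / M) : ℝ)) (h₁ / ℓ) := by
  have hℓ0 := hℓ.pos
  have hℓ' : (ℓ : ℂ) ≠ 0 := by exact_mod_cast hℓ.ne_zero
  obtain ⟨d, y, hdy⟩ := ha
  set c₁ : ℕ := 96 * N * ℓ ^ 2 with hc₁
  set c : ℕ := M ^ 2 * c₁ with hc
  have hc₁0 : 0 < c₁ := by positivity
  have hc0 : 0 < c := by positivity
  have hq : 0 < κ * c := Nat.mul_pos hX.pos hc0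
  have haℓ : ¬ (ℓ : ℤ) ∣ a * h₁ := by
    intro hdvd
    rcases (Nat.prime_iff_prime_int.mp hℓ).dvd_or_dvd hdvd with ⟨k, hk⟩ | h1
    · apply (Nat.prime_iff_prime_int.mp hℓ).not_dvd_one
      refine ⟨d * k + y * 24 * M ^ 2 * 96 * N * ℓ, ?_⟩
      rw [← hdy, hk, hc, hc₁]
      push_cast
      ring
    · exact hh₁ h1
  let γ : SL(2, ℤ) := ⟨!![a, -(24 * y); (M : ℤ) ^ 2 * (c₁ : ℤ), d], by
    rw [Matrix.det_fin_two_of, ← hdy, hc]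
    push_cast
    ring⟩
  have hγ : γ 1 0 = (M : ℤ) ^ 2 * (c₁ : ℤ) := rfl
  have hγ00 : γ 0 0 = a := rfl
  have hγ01 : γ 0 1 = -(24 * y) := rfl
  have hγ11 : γ 1 1 = d := rfl
  have hγc : γ 1 0 = c := by rw [hγ, hc]; push_cast; ring
  obtain ⟨κ', hκ'⟩ := hκ
  have hκ24 : (24 : ℤ) = κ * κ' := by exact_mod_cast hκ'
  set γj : ℤ → SL(2, ℤ) := fun j => shiftMatrix γ hγ j with hγj
  have hγjc : ∀ j, γj j 1 0 = c := fun j => hγc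
  have hγj00 : ∀ j, γj j 0 0 = a + M * c₁ * a ^ 2 * j := fun j => rfl
  have hγj01 : ∀ j, γj j 0 1 = -(24 * y) + a * -(24 * y) * M * c₁ * j - c₁ * a ^ 2 * j ^ 2 :=
    fun j => rfl
  have hγj11 : ∀ j, γj j 1 1 = d - M * c₁ * j := fun j => rfl
  have hc24 : 24 ∣ c := ⟨M ^ 2 * (4 * N * ℓ ^ 2), by rw [hc, hc₁]; ring⟩
  let g₀ : Mp := Mp.ofPos γ hc0 hq hγc
  let g : ℤ → Mp := fun j => Mp.ofPos (γj j) hc0 hq (hγjc j)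
  have hmem : ∀ g' : Mp, g'.γ 1 0 = c → g' ∈ Gamma0Tilde N := by
    intro g' hg'
    change g'.γ ∈ CongruenceSubgroup.Gamma0 N
    rw [CongruenceSubgroup.Gamma0_mem, hg', hc, hc₁]
    push_cast
    simp
  have hρ : ∀ j, twist χ v (g j) = twist χ v g₀ := by
    intro j
    have hd1 : (((g j).γ 1 1 : ℤ) : ZMod N) = ((g₀.γ 1 1 : ℤ) : ZMod N) := by
      change ((γj j 1 1 : ℤ) : ZMod N) = ((d : ℤ) : ZMod N)
      rw [hγj11, hc₁]
      push_cast
      simp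
    rw [twist, twist, hd1, hv]
    congr 1
    -- The square root of the quotient of the upper left entries modulo `κ c`.
    refine hX.charOf_ofPos_eq hA hh₀ γ (γj j) hc0 hq hγc (hγjc j) hc24 ?_ ?_ ?_
      (s := 1 + a * M * (48 * N * ℓ ^ 2) * j) ?_ ?_ ?_
    · rw [hγ01, hκ24]
      exact ⟨-(κ' * y), by ring⟩
    · rw [hγj01, hc₁]
      refine ⟨κ' * (-y - a * y * M * (96 * N * ℓ ^ 2) * j - 4 * N * ℓ ^ 2 * a ^ 2 * j ^ 2), ?_⟩
      rw [← mul_assoc, ← hκ24]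
      push_cast
      ring
    · rw [hγj11, hγ11, hc₁]
      exact ⟨-(M * (8 * N * ℓ ^ 2) * j), by push_cast; ring⟩
    · have h1 : IsCoprime (1 + a * M * (48 * N * ℓ ^ 2) * j) ((48 * M * N * ℓ ^ 2 : ℤ) ^ 2) := by
        refine IsCoprime.pow_right ⟨1, -(a * j), by ring⟩
      refine h1.of_isCoprime_of_dvd_right ⟨κ' * N * ℓ ^ 2, ?_⟩
      rw [hc, hc₁]
      push_cast
      linear_combination (96 * (M : ℤ) ^ 2 * N ^ 2 * ℓ ^ 4) * hκ24
    · exact ⟨a * M * (4 * N * ℓ ^ 2) * j, by ring⟩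
    · rw [hγj00, hγ00, hc, hc₁]
      refine ⟨-(κ' * N * ℓ ^ 2 * a ^ 3 * j ^ 2), ?_⟩
      push_cast
      linear_combination (-(96 * (M : ℤ) ^ 2 * N ^ 2 * ℓ ^ 4 * a ^ 3 * j ^ 2)) * hκ24
  set τ : ℍ := ofComplex t with hτ
  have hτt : (τ : ℂ) = t := coe_ofComplex ht
  have hω : ∀ j : ℤ, (g j).ω ((j * (1 / M) : ℝ) +ᵥ τ) = g₀.ω τ := by
    intro j
    have hM' : (M : ℂ) ≠ 0 := by exact_mod_cast hM.ne'
    have : (c : ℂ) * (((j * (1 / M) : ℝ) +ᵥ τ : ℍ) : ℂ) + ((γj j 1 1 : ℤ) : ℂ) =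
        c * (τ : ℂ) + ((γ 1 1 : ℤ) : ℂ) := by
      rw [UpperHalfPlane.coe_vadd, hγj11, hγ11, hc]
      push_cast
      field_simp
      ring
    change _ / (2 * ((κ * c : ℕ) : ℂ) * I / (c * (((j * (1 / M) : ℝ) +ᵥ τ : ℍ) : ℂ) +
      ((γj j 1 1 : ℤ) : ℂ))) ^ (1 / 2 : ℂ) = _
    rw [this]
    rfl
  have hω0 : g₀.ω τ ≠ 0 := g₀.ω_ne_zero τ
  refine ⟨(γ • τ : ℍ), sinFactor ((a * h₁ : ℤ) / ℓ) ^ ν * (g₀.ω τ ^ w * twist χ v g₀) *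
    (sinFactor (h₁ / ℓ) ^ ν)⁻¹, (γ • τ).im_pos, ?_, fun j => ?_⟩
  · exact mul_ne_zero (mul_ne_zero (zpow_ne_zero _ (sinFactor_intCast_div_ne_zero hℓ0 haℓ))
      (mul_ne_zero (zpow_ne_zero _ hω0) (hne _ (hmem _ hγc))))
      (inv_ne_zero (zpow_ne_zero _ (sinFactor_intCast_div_ne_zero hℓ0 hh₁)))
  · rw [← hτt, leadingTerm_vadd_torsion hℓ0 haℓ, leadingTerm_vadd_torsion hℓ0 hh₁]
    have h1 := shiftMatrix_smul γ hM hγ j τ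
    have h2 := apply_smul_torsion (g := g j) (htr _ (hmem _ (hγjc j))) hheis hℓ (by
      change ((ℓ ^ 2 : ℕ) : ℤ) ∣ γj j 1 0
      rw [hγjc, hc, hc₁]
      exact ⟨M ^ 2 * (96 * N), by push_cast; ring⟩) haℓ ((((j : ℤ) : ℝ) * (1 / M) : ℝ) +ᵥ τ)
    have h3 : (((a * h₁ * (g j).γ 1 1 : ℤ) : ℂ) / ℓ) = (h₁ / ℓ : ℂ) +
        ((-(24 * y * M ^ 2 * (96 * N * ℓ) * h₁) - a * h₁ * M * (96 * N * ℓ) * j : ℤ) : ℂ) := by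
      have h4 : (g j).γ 1 1 = d - M * c₁ * j := hγj11 j
      have hdy' : (d : ℂ) * a + y * (24 * (M ^ 2 * (96 * N * ℓ ^ 2))) = 1 := by
        have := congrArg (fun n : ℤ => (n : ℂ)) hdy
        rw [hc, hc₁] at this
        push_cast at this
        exact this
      rw [h4, hc₁]
      push_cast
      field_simp
      linear_combination (h₁ : ℂ) * hdy'
    rw [hω, hρ, h3, h.add_int _ _ (intCast_div_not_mem_lattice hℓ0 hh₁ _)] at h2
    have h5 : ((j : ℤ) * (((γ 0 0 : ℤ) : ℝ) ^ 2 / M) : ℝ) = (j * (a ^ 2 / M) : ℝ) := by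
      rw [hγ00, Int.cast_natCast]
    rw [h5] at h1
    have h6 : (((j : ℤ) : ℝ) * (1 / M) : ℝ) = (j * (1 / M) : ℝ) := by rw [Int.cast_natCast]
    rw [← h1]
    change φ (shiftMatrix γ hγ j • _) _ = _ at h2
    rw [h2, h6]
    have := zpow_ne_zero ν (sinFactor_intCast_div_ne_zero hℓ0 hh₁)
    field_simp

/-- If the Fourier coefficients of the leading term vanish at all nontrivial `ℓ`-torsion points on
the progression `M ℤ + β`, then also on `M ℤ + u² β`. -/
lemma HasLeadingTerm.tubeCoeff_eq_zero (h : HasLeadingTerm φ ν f β)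
    (hX : IsThetaCoefficient κ X) (hκ : κ ∣ 24) (hA : A₀ ≠ 0)
    (hh₀ : ∀ τ : ℍ, thetaSeries κ X τ = A₀ * h₀ τ) (hv : v = charOf h₀) (hN : 0 < N)
    (htr : ∀ g ∈ Gamma0Tilde N, ∀ (τ : ℍ) (z : ℂ), z ∉ lattice τ →
      jacobiSlash w m φ g τ z = twist χ v g * φ τ z)
    (hne : ∀ g ∈ Gamma0Tilde N, twist χ v g ≠ 0)
    (hheis : ∀ (l μ κ : ℤ) (τ : ℍ) (z : ℂ), z ∉ lattice τ →
      heisenbergSlash m φ l μ κ τ z = φ τ z)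
    {ℓ : ℕ} (hℓ : ℓ.Prime) {M : ℕ} (hM : 0 < M) (hβκ : ∃ r : ℤ, β = 1 / κ + r)
    {D : ℕ} (hD : 0 < D) (hβD : ∃ k : ℤ, β * D = k) {u : ℤ} (hu : IsCoprime (M : ℤ) u)
    (hvan : ∀ Y : ℝ, 0 < Y → ∀ k : ℤ, (k / D : ℚ) ∈ progression M β →
      ∀ h₁ : ℤ, ¬ (ℓ : ℤ) ∣ h₁ → tubeCoeff φ ν f D Y (k / D) (h₁ / ℓ) = 0)
    {Y : ℝ} (hY : 0 < Y) {k : ℤ} (hk : (k / D : ℚ) ∈ progression M (u ^ 2 * β))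
    {h₁ : ℤ} (hh₁ : ¬ (ℓ : ℤ) ∣ h₁) : tubeCoeff φ ν f D Y (k / D) (h₁ / ℓ) = 0 := by
  have him : ∀ h₁ : ℤ, (h₁ / ℓ : ℂ).im = 0 := fun h₁ => by
    rw [Complex.div_natCast_im, Complex.intCast_im, zero_div]
  have htrans : ∀ (h₁ : ℤ) (t : ℂ), 0 < t.im →
      leadingTerm φ ν f (t + 1) (h₁ / ℓ) = e β * leadingTerm φ ν f t (h₁ / ℓ) := fun h₁ t ht =>
    h.leadingTerm_translate (by rwa [him, abs_zero])
  have hcont : ∀ (h₁ : ℤ) (Y : ℝ), 0 < Y →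
      Continuous fun x : ℝ => leadingTerm φ ν f (x + Y * I) (h₁ / ℓ) := by
    intro h₁ Y hY
    have h1 := (h.continuous_lines (y := 0) (Y := Y) (by simpa using hY)).comp
      (continuous_id.prodMk (continuous_const (y := (h₁ / ℓ : ℝ))))
    refine h1.congr fun x => ?_
    simp
  have hκ0 : (κ : ℚ) ≠ 0 := by exact_mod_cast hX.pos.ne'
  obtain ⟨r, hr⟩ := hβκ
  by_cases hu2 : (κ : ℤ) ∣ u ^ 2 - 1
  · obtain ⟨x, hx⟩ := hu2
    have huκ : IsCoprime u (κ : ℤ) := ⟨u, -x, by linear_combination hx⟩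
    have huκM : IsCoprime u (κ * M : ℕ) := by
      push_cast
      exact huκ.mul_right hu.symm
    set c : ℕ := M ^ 2 * (96 * N * ℓ ^ 2) with hc
    have hℓ0 := hℓ.pos
    obtain ⟨a, ⟨b, hau⟩, hac⟩ := exists_coprime_lift (m := 24 * c) (by positivity) (by
      obtain ⟨κ', hκ'⟩ := hκ
      exact ⟨κ' * M * (96 * N * ℓ ^ 2), by rw [hc, hκ']; ring⟩) huκM
    refine fourierInt_eq_zero_of_shift (F := fun t => leadingTerm φ ν f t ((a * h₁ : ℤ) / ℓ))
      (H := fun t => leadingTerm φ ν f t (h₁ / ℓ)) (a := a) hD hM hβD (hcont _) (htrans _)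
      (hcont _) (htrans _) ?_ ?_ (fun t ht => h.exists_shift hX hκ hA hh₀ hv hN htr hne hheis hℓ hM
        hac hh₁ ht) (fun Y hY k hk => hvan Y hY k hk _ ?_) hY hk
    · have hau' : (a : ℚ) - u = κ * M * b := by exact_mod_cast congrArg (fun n : ℤ => (n : ℚ)) hau
      refine ⟨b * (a + u) * (1 + κ * r), ?_⟩
      rw [hr]
      push_cast
      have : (a : ℚ) ^ 2 - u ^ 2 = κ * M * b * (a + u) := by rw [← hau']; ring
      rw [this]
      field_simp
    · exact hac.of_isCoprime_of_dvd_right ⟨24 * (M * (96 * N * ℓ ^ 2)), by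
        rw [hc]; push_cast; ring⟩
    · intro hdvd
      obtain ⟨d, y, hdy⟩ := hac
      rcases (Nat.prime_iff_prime_int.mp hℓ).dvd_or_dvd hdvd with ⟨k, hk⟩ | h1
      · apply (Nat.prime_iff_prime_int.mp hℓ).not_dvd_one
        refine ⟨d * k + y * 24 * M ^ 2 * 96 * N * ℓ, ?_⟩
        rw [← hdy, hk, hc]
        push_cast
        ring
      · exact hh₁ h1
  · -- In this case the progression does not meet `ℤ + β`, which contains all frequencies.
    have hper : ∀ x : ℝ, leadingTerm φ ν f (x + Y * I + 1) (h₁ / ℓ) =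
        e β * leadingTerm φ ν f (x + Y * I) (h₁ / ℓ) := fun x => htrans _ _ (by simpa using hY)
    refine fourierInt_eq_zero_of_translate (F := fun t => leadingTerm φ ν f t (h₁ / ℓ)) hD
      (periodic_of_translate (F := fun t => leadingTerm φ ν f t (h₁ / ℓ)) hβD hper) hper ?_
    rintro ⟨s, hs⟩
    obtain ⟨j, hj⟩ := hk
    apply hu2
    refine ⟨s - M * j - r * (u ^ 2 - 1), ?_⟩
    rw [hj, hr] at hs
    have : ((u ^ 2 - 1 : ℤ) : ℚ) = ((κ * (s - M * j - r * (u ^ 2 - 1)) : ℤ) : ℚ) := by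
      push_cast
      field_simp at hs
      linear_combination hs
    exact_mod_cast this

end Transfer


/-! ### Divisibility by cyclotomic polynomials -/

lemma e_intCast_div_ne_one {ℓ : ℕ} (hℓ : 0 < ℓ) {h : ℤ} (hh : ¬ (ℓ : ℤ) ∣ h) :
    e (h / ℓ) ≠ 1 := by
  have hℓ' : (ℓ : ℂ) ≠ 0 := by exact_mod_cast hℓ.ne'
  rw [Ne, e_eq_one_iff]
  rintro ⟨k, hk⟩
  rw [div_eq_iff hℓ'] at hk
  exact hh ⟨k, by rw [mul_comm]; exact_mod_cast hk⟩

lemma eval_cyclotomic_eq_zero_iff {ℓ : ℕ} (hℓ : ℓ.Prime) (x : ℂ) :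
    (Polynomial.cyclotomic ℓ ℂ).eval x = 0 ↔ x ^ ℓ = 1 ∧ x ≠ 1 := by
  have := Fact.mk hℓ
  have hmul : (Polynomial.cyclotomic ℓ ℂ).eval x * (x - 1) = x ^ ℓ - 1 := by
    rw [Polynomial.cyclotomic_prime, Polynomial.eval_geom_sum]
    exact geom_sum_mul x ℓ
  constructor
  · intro h0
    rw [h0, zero_mul] at hmul
    refine ⟨(sub_eq_zero.mp hmul.symm), ?_⟩
    rintro rfl
    rw [Polynomial.eval_one_cyclotomic_prime] at h0
    exact hℓ.ne_zero (by exact_mod_cast h0)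
  · rintro ⟨h1, h2⟩
    rw [h1, sub_self, mul_eq_zero] at hmul
    exact hmul.resolve_right (sub_ne_zero.mpr h2)

lemma eval_cyclotomic_e {ℓ : ℕ} (hℓ : ℓ.Prime) {h : ℤ} (hh : ¬ (ℓ : ℤ) ∣ h) :
    (Polynomial.cyclotomic ℓ ℂ).eval (e (h / ℓ)) = 0 := by
  have hℓ' : (ℓ : ℂ) ≠ 0 := by exact_mod_cast hℓ.ne_zero
  rw [eval_cyclotomic_eq_zero_iff hℓ]
  refine ⟨?_, e_intCast_div_ne_one hℓ.pos hh⟩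
  rw [← e_natCast_mul, mul_div_cancel₀ _ hℓ', e_intCast]

/-- A polynomial that vanishes at the square roots of all primitive `ℓ`-th roots of unity is
divisible by `Φ_ℓ(X²)`, since the latter is separable. -/
lemma expand_cyclotomic_dvd {ℓ : ℕ} (hℓ : ℓ.Prime) {p : Polynomial ℂ}
    (hp : ∀ h : ℤ, ¬ (ℓ : ℤ) ∣ h → p.eval (e (h / ℓ / 2)) = 0) :
    Polynomial.expand ℂ 2 (Polynomial.cyclotomic ℓ ℂ) ∣ p := by
  by_cases hp0 : p = 0
  · rw [hp0]; exact dvd_zero _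
  have hℓ' : (ℓ : ℂ) ≠ 0 := by exact_mod_cast hℓ.ne_zero
  set q := Polynomial.expand ℂ 2 (Polynomial.cyclotomic ℓ ℂ) with hq
  have hq0 : q ≠ 0 := by
    rw [hq, Polynomial.expand_ne_zero two_pos]
    exact Polynomial.cyclotomic_ne_zero ℓ ℂ
  have hsep : q.Separable := by
    have h1 : (Polynomial.X ^ (2 * ℓ) - 1 : Polynomial ℂ).Separable := by
      rw [Polynomial.X_pow_sub_one_separable_iff]
      exact_mod_cast (mul_ne_zero two_ne_zero hℓ.ne_zero)
    refine h1.of_dvd ?_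
    have h2 := map_dvd (Polynomial.expand ℂ 2) (Polynomial.cyclotomic.dvd_X_pow_sub_one ℓ ℂ)
    rwa [map_sub, map_pow, Polynomial.expand_X, map_one, ← pow_mul] at h2
  rw [IsAlgClosed.dvd_iff_roots_le_roots hq0 hp0, Multiset.le_iff_subset
    (Polynomial.nodup_roots hsep)]
  intro x hx
  rw [Polynomial.mem_roots hq0, Polynomial.IsRoot, hq, Polynomial.expand_eval,
    eval_cyclotomic_eq_zero_iff hℓ] at hx
  rw [Polynomial.mem_roots hp0, Polynomial.IsRoot]
  obtain ⟨h1, h2⟩ := hx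
  have hx0 : x ≠ 0 := by
    rintro rfl
    rw [zero_pow two_ne_zero, zero_pow hℓ.ne_zero] at h1
    exact zero_ne_one h1
  -- Write `x = e(y)`; then `2 ℓ y` is an integer.
  set y : ℂ := Complex.log x / (2 * Real.pi * I) with hy
  have hey : e y = x := by
    rw [e, hy, mul_div_cancel₀ _ Complex.two_pi_I_ne_zero, Complex.exp_log hx0]
  have h3 : e ((2 * ℓ : ℕ) * y) = 1 := by
    rw [e_natCast_mul, hey, pow_mul, h1]
  obtain ⟨h, hh⟩ := e_eq_one_iff.mp h3
  have hyh : y = h / ℓ / 2 := by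
    rw [← hh]; push_cast; field_simp
  rw [← hey, hyh]
  refine hp h ?_
  rintro ⟨k, hk⟩
  apply h2
  rw [← hey, hyh, ← e_natCast_mul, hk, e_eq_one_iff]
  exact ⟨k, by push_cast; field_simp⟩

lemma eval₂_eUnit_toLaurent_mul_T (p : Polynomial ℂ) (a : ℕ) (z : ℂ) :
    LaurentPolynomial.eval₂ (RingHom.id ℂ) (eUnit z) (Polynomial.toLaurent p * T (-(a : ℤ))) =
      e (-(a * z)) * p.eval (e z) := by
  rw [map_mul, eval₂_toLaurent, eval₂_T, Polynomial.eval₂_id, Units.val_zpow_eq_zpow_val]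
  change p.eval (e z) * e z ^ (-(a : ℤ)) = _
  rw [← e_intCast_mul, mul_comm]
  congr 2
  push_cast
  ring

lemma cyclotomicDvd_of_dvd {ℓ : ℕ} {F : ℂ → ℂ} {p : Polynomial ℂ} {a : ℕ}
    (hF : ∀ z : ℂ, 0 < z.im → F z = e (-(a * (z / 2))) * p.eval (e (z / 2)))
    (hp : Polynomial.expand ℂ 2 (Polynomial.cyclotomic ℓ ℂ) ∣ p) : CyclotomicDvd ℓ F := by
  refine ⟨2, two_pos, Polynomial.toLaurent p * T (-(a : ℤ)), fun z hz => ?_, ?_⟩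
  · rw [Nat.cast_ofNat, eval₂_eUnit_toLaurent_mul_T, hF z hz]
  · exact (map_dvd Polynomial.toLaurent hp).mul_right _

/-- A continuous function that agrees with `F` on the upper half plane vanishes at the nontrivial
`ℓ`-torsion points if `F` is divisible by the `ℓ`-th cyclotomic polynomial. -/
lemma CyclotomicDvd.eq_zero {ℓ : ℕ} (hℓ : ℓ.Prime) {F G : ℂ → ℂ} (hF : CyclotomicDvd ℓ F)
    (hG : Continuous G) (hFG : ∀ z : ℂ, 0 < z.im → F z = G z) {h : ℤ} (hh : ¬ (ℓ : ℤ) ∣ h) :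
    G (h / ℓ) = 0 := by
  obtain ⟨D, hD, P, hP, ⟨Q, hQ⟩⟩ := hF
  have hD' : (D : ℂ) ≠ 0 := by exact_mod_cast hD.ne'
  obtain ⟨a, q, hq⟩ := exists_T_pow Q
  have hQq : Q = Polynomial.toLaurent q * T (-(a : ℤ)) := by
    rw [hq, mul_T_assoc, add_neg_cancel, T_zero, mul_one]
  set G' : ℂ → ℂ := fun z => (Polynomial.cyclotomic ℓ ℂ).eval (e z) *
    (e (-(a * (z / D))) * q.eval (e (z / D))) with hG'
  have hFG' : ∀ z : ℂ, 0 < z.im → F z = G' z := by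
    intro z hz
    rw [hP z hz, hQ, map_mul, hQq, eval₂_eUnit_toLaurent_mul_T, eval₂_toLaurent,
      Polynomial.eval₂_id]
    change Polynomial.eval (e (z / D)) _ * _ = _
    rw [Polynomial.expand_eval, ← e_natCast_mul, mul_div_cancel₀ _ hD']
  have hG'c : Continuous G' := by
    have h1 := (Polynomial.cyclotomic ℓ ℂ).continuous
    have h2 := q.continuous
    fun_prop
  have hpath : Tendsto (fun t : ℝ => (h / ℓ + t * I : ℂ)) (𝓝[>] 0) (𝓝 (h / ℓ)) := by
    have : Continuous fun t : ℝ => (h / ℓ + t * I : ℂ) := by fun_prop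
    have h1 := (this.tendsto 0).mono_left (nhdsWithin_le_nhds (s := Set.Ioi 0))
    simpa using h1
  have h1 := (hG.tendsto _).comp hpath
  have h2 := (hG'c.tendsto _).comp hpath
  have heq : (G ∘ fun t : ℝ => (h / ℓ + t * I : ℂ)) =ᶠ[𝓝[>] 0]
      (G' ∘ fun t : ℝ => (h / ℓ + t * I : ℂ)) := by
    filter_upwards [self_mem_nhdsWithin] with t ht
    have him : 0 < (h / ℓ + t * I : ℂ).im := by
      have h3 : (h / ℓ : ℂ).im = 0 := by rw [Complex.div_natCast_im, Complex.intCast_im, zero_div]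
      simpa [add_im, h3] using ht
    simp only [Function.comp_apply]
    rw [← hFG _ him, hFG' _ him]
  rw [tendsto_nhds_unique h1 (h2.congr' heq.symm), hG']
  simp only
  rw [eval_cyclotomic_e hℓ hh, zero_mul]

/-! ### Integrality -/

/-- The ring `𝓞_{K,ℓ}`. -/
def locallyIntegral (K : IntermediateField ℚ ℂ) {ℓ : ℕ} (hℓ : ℓ.Prime) : Subring ℂ where
  carrier := {x | IsLocallyIntegral K ℓ x}
  zero_mem' := ⟨zero_mem _, 1, hℓ.one_lt.ne' ∘ Nat.dvd_one.mp, by simpa using isIntegral_zero⟩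
  one_mem' := ⟨one_mem _, 1, hℓ.one_lt.ne' ∘ Nat.dvd_one.mp, by simpa using isIntegral_one⟩
  add_mem' := by
    rintro x y ⟨hx, s, hs, hsx⟩ ⟨hy, t, ht, hty⟩
    refine ⟨add_mem hx hy, s * t, hℓ.prime.not_dvd_mul hs ht, ?_⟩
    have h1 : ((s * t : ℕ) : ℂ) * (x + y) = ((t : ℤ) : ℂ) * (s * x) + ((s : ℤ) : ℂ) * (t * y) := by
      push_cast; ring
    rw [h1]
    exact ((isIntegral_algebraMap (R := ℤ)).mul hsx).add ((isIntegral_algebraMap (R := ℤ)).mul hty)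
  mul_mem' := by
    rintro x y ⟨hx, s, hs, hsx⟩ ⟨hy, t, ht, hty⟩
    refine ⟨mul_mem hx hy, s * t, hℓ.prime.not_dvd_mul hs ht, ?_⟩
    have h1 : ((s * t : ℕ) : ℂ) * (x * y) = (s * x) * (t * y) := by push_cast; ring
    rw [h1]
    exact hsx.mul hty
  neg_mem' := by
    rintro x ⟨hx, s, hs, hsx⟩
    refine ⟨neg_mem hx, s, hs, ?_⟩
    rw [mul_neg]
    exact hsx.neg

/-- Division by a monic polynomial does not leave the ring of coefficients. -/
lemma coeff_mem_of_monic_mul {R : Subring ℂ} {B q : Polynomial ℂ} (hB : B.Monic)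
    (hBR : ∀ n, B.coeff n ∈ R) (hq : ∀ n, (B * q).coeff n ∈ R) (n : ℕ) : q.coeff n ∈ R := by
  have hlift : ∀ p : Polynomial ℂ, (∀ n, p.coeff n ∈ R) → p ∈ Polynomial.lifts R.subtype := by
    intro p hp
    rw [Polynomial.lifts_iff_coeff_lifts]
    exact fun n => ⟨⟨p.coeff n, hp n⟩, rfl⟩
  obtain ⟨B', hB', -, hB'm⟩ := Polynomial.lifts_and_degree_eq_and_monic (hlift B hBR) hB
  obtain ⟨p', hp'⟩ := (Polynomial.mem_lifts _).mp (hlift _ hq)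
  have h := Polynomial.map_divByMonic R.subtype (p := p') hB'm
  rw [hB', hp', Polynomial.mul_divByMonic_cancel_left _ hB] at h
  rw [← h, Polynomial.coeff_map]
  exact ((Polynomial.divByMonic p' B').coeff n).2

lemma fourierInt_e {D : ℕ} (hD : 0 < D) (y : ℝ) (j k : ℤ) :
    fourierInt D (fun z => e ((j / D : ℚ) * z)) y (k / D) = if j = k then 1 else 0 := by
  refine fourierInt_of_hasSum hD (c := fun i => if j = i then 1 else 0) (fun x => ?_) k
  have := hasSum_ite_eq j (e ((j / D : ℚ) * (x + y * I)))
  refine Eq.mp (congrArg (fun F => HasSum F _) (funext fun i => ?_)) this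
  by_cases hij : i = j
  · subst hij; simp
  · rw [if_neg hij, if_neg (Ne.symm hij), zero_mul]

lemma fourierInt_eval_e {D : ℕ} (hD : 0 < D) (y : ℝ) (p : Polynomial ℂ) (j : ℕ) :
    fourierInt (2 * D) (fun z => p.eval (e (z / 2))) y ((D * j : ℤ) / (2 * D : ℕ)) = p.coeff j := by
  have hD' : (D : ℂ) ≠ 0 := by exact_mod_cast hD.ne'
  have h1 : (fun z => p.eval (e (z / 2))) = fun z => ∑ i ∈ p.support,
      p.coeff i * e ((((D * i : ℤ) / (2 * D : ℕ) : ℚ) : ℂ) * z) := by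
    funext z
    rw [Polynomial.eval_eq_sum, Polynomial.sum_def]
    refine Finset.sum_congr rfl fun i _ => ?_
    rw [← e_natCast_mul]
    congr 2
    push_cast
    field_simp
  rw [h1, fourierInt_sum _ _ _ _ _ (fun i _ => by fun_prop)]
  simp only [fourierInt_const_mul, fourierInt_e (Nat.mul_pos two_pos hD)]
  have h2 : ∀ i : ℕ, ((D : ℤ) * i = D * j) = (i = j) := by
    intro i
    simp [hD.ne']
  simp only [h2, mul_ite, mul_one, mul_zero]
  rw [Finset.sum_ite_eq']
  split_ifs with h
  · rfl
  · exact (Polynomial.notMem_support_iff.mp h).symm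

/-- Multiplication by `e(j z / D)` shifts Fourier coefficients. -/
lemma fourierInt_e_mul {D : ℕ} (F : ℂ → ℂ) (y : ℝ) (j k : ℤ) :
    fourierInt D (fun z => e ((j / D : ℚ) * z) * F z) y (k / D) =
      fourierInt D F y ((k - j : ℤ) / D) := by
  rw [fourierInt, fourierInt]
  congr 2
  funext x
  rw [mul_right_comm, mul_comm, ← e_add]
  congr 2
  push_cast
  ring

lemma fourierInt_sinFactor_pow_mul_mem {R : Subring ℂ} {D : ℕ} (hD : 0 < D) {F : ℂ → ℂ} {y : ℝ}
    (hc : Continuous fun x : ℝ => F (x + y * I))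
    (hF : ∀ k : ℤ, fourierInt (2 * D) F y (k / (2 * D : ℕ)) ∈ R) (n : ℕ) :
    ∀ k : ℤ, fourierInt (2 * D) (fun z => sinFactor z ^ n * F z) y (k / (2 * D : ℕ)) ∈ R := by
  have hD' : (D : ℂ) ≠ 0 := by exact_mod_cast hD.ne'
  induction n with
  | zero => simpa using hF
  | succ n ih =>
    intro k
    have hcn : Continuous fun x : ℝ => sinFactor (x + y * I) ^ n * F (x + y * I) := by
      have : Continuous fun x : ℝ => sinFactor (x + y * I) ^ n := by fun_prop
      exact this.mul hc
    have h1 : fourierInt (2 * D) (fun z => sinFactor z ^ (n + 1) * F z) y (k / (2 * D : ℕ)) =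
        ∑ i ∈ Finset.range 2, fourierInt (2 * D) (fun z => (-1) ^ i *
          (e (((((-1) ^ i * D : ℤ) : ℚ) / (2 * D : ℕ) : ℚ) * z) * (sinFactor z ^ n * F z))) y
          (k / (2 * D : ℕ)) := by
      rw [← fourierInt_sum]
      · refine fourierInt_congr _ fun x => ?_
        rw [Finset.sum_range_succ, Finset.sum_range_one, pow_succ]
        have h2 : ∀ z : ℂ, sinFactor z = e (((((-1) ^ 0 * D : ℤ) : ℚ) / (2 * D : ℕ) : ℚ) * z) -
            e (((((-1) ^ 1 * D : ℤ) : ℚ) / (2 * D : ℕ) : ℚ) * z) := by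
          intro z
          rw [sinFactor]
          congr 2
          · push_cast; field_simp
          · push_cast; field_simp
        nth_rewrite 2 [h2]
        ring
      · intro i _
        exact continuous_const.mul ((continuous_e.comp (by fun_prop)).mul hcn)
    rw [h1]
    refine R.sum_mem fun i _ => ?_
    rw [fourierInt_const_mul, fourierInt_e_mul]
    exact R.mul_mem (R.pow_mem (R.neg_mem R.one_mem) _) (ih _)


/-! ### Fourier expansions of Jacobi forms and of their leading terms -/

section Expansion

variable {φ : ℍ → ℂ → ℂ} {ν : ℤ} {f : ℍ → ℂ} {β : ℚ} {c : ℚ → ℚ → ℂ}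

lemma summable_coeffAt {ε : ℝ} (hε : 0 < ε)
    (hc : ∀ (τ : ℍ) (z : ℂ), 0 < z.im / τ.im → z.im / τ.im < ε →
      HasSum (fun p : ℚ × ℚ => c p.1 p.2 * e ((p.1 : ℂ) * (τ : ℂ) + (p.2 : ℂ) * z)) (φ τ z))
    (n : ℚ) {z : ℂ} (hz : 0 < z.im) : Summable fun r : ℚ => c n r * e (r * z) := by
  obtain ⟨Y, hY⟩ := exists_gt (z.im / ε)
  have hY0 : 0 < Y := (div_pos hz hε).trans hY
  let τ : ℍ := ⟨Y * I, by simpa using hY0⟩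
  have hτ : τ.im = Y := by change (Y * I : ℂ).im = Y; simp
  have h := ((hc τ z (by rw [hτ]; positivity) (by rw [hτ]; rwa [div_lt_comm₀ hY0 hε])).summable.prod_factor n).mul_left
    (e (-(n * τ)))
  refine h.congr fun r => ?_
  rw [mul_left_comm, ← e_add]
  congr 2
  ring

/-- The coefficients `c(n; z)` are the Fourier coefficients of `φ` with respect to `τ`. -/
lemma fourierInt_eq_coeffAt {ε : ℝ} (hε : 0 < ε)
    (hc : ∀ (τ : ℍ) (z : ℂ), 0 < z.im / τ.im → z.im / τ.im < ε →
      HasSum (fun p : ℚ × ℚ => c p.1 p.2 * e ((p.1 : ℂ) * (τ : ℂ) + (p.2 : ℂ) * z)) (φ τ z))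
    {D : ℕ} (hD : 0 < D) (hcD : ∀ n r, c n r ≠ 0 → ∃ k : ℤ, n = k / D) {z : ℂ} (hz : 0 < z.im)
    {Y : ℝ} (hY : z.im / ε < Y) (k : ℤ) :
    fourierInt D (fun t => φ (ofComplex t) z) Y (k / D) = coeffAt c (k / D) z := by
  have hY0 : 0 < Y := (div_pos hz hε).trans hY
  have hsupp : ∀ n, coeffAt c n z ≠ 0 → ∃ k : ℤ, n = k / D := by
    intro n hn
    by_contra hno
    apply hn
    rw [coeffAt]
    have : ∀ r, c n r = 0 := fun r => by
      by_contra h0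
      exact hno (hcD n r h0)
    simp [this]
  refine fourierInt_of_hasSum hD (c := fun k : ℤ => coeffAt c (k / D) z) (fun x => ?_) k
  have him : ((x : ℂ) + Y * I).im = Y := by simp
  have ht : 0 < ((x : ℂ) + Y * I).im := by rwa [him]
  set τ := ofComplex ((x : ℂ) + Y * I) with hτ
  have hτi : τ.im = Y := by rw [hτ, ofComplex_im ht, him]
  have hτc : (τ : ℂ) = x + Y * I := coe_ofComplex ht
  have h1 := hc τ z (by rw [hτi]; positivity) (by rw [hτi]; rwa [div_lt_comm₀ hY0 hε])
  have h2 : HasSum (fun n : ℚ => coeffAt c n z * e (n * (τ : ℂ))) (φ τ z) := by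
    refine h1.prod_fiberwise fun n => ?_
    have h3 := (summable_coeffAt hε hc n hz).hasSum.mul_right (e (n * (τ : ℂ)))
    refine Eq.mp (congrArg (fun F => HasSum F _) (funext fun r => ?_)) h3
    rw [mul_assoc, ← e_add, add_comm]
  rw [hasSum_rat_iff hD hsupp (fun n => e (n * (τ : ℂ))), hτc] at h2
  exact_mod_cast h2

lemma leadingCoeff_eq_tubeCoeff {ε : ℝ} (hε : 0 < ε)
    (hc : ∀ (τ : ℍ) (z : ℂ), 0 < z.im / τ.im → z.im / τ.im < ε →
      HasSum (fun p : ℚ × ℚ => c p.1 p.2 * e ((p.1 : ℂ) * (τ : ℂ) + (p.2 : ℂ) * z)) (φ τ z))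
    {D : ℕ} (hD : 0 < D) (hcD : ∀ n r, c n r ≠ 0 → ∃ k : ℤ, n = k / D) {z : ℂ} (hz : 0 < z.im)
    {Y : ℝ} (hY : z.im / ε < Y) (k : ℤ) :
    leadingCoeff ν c (k / D) z = tubeCoeff φ ν f D Y (k / D) z := by
  have hs : sinFactor z ≠ 0 := sinFactor_ne_zero_of_im_ne_zero hz.ne'
  rw [leadingCoeff, ← fourierInt_eq_coeffAt hε hc hD hcD hz hY, tubeCoeff]
  simp only [leadingTerm_of_ne hs]
  rw [fourierInt_const_mul]
  rfl

/-- The Fourier coefficients of the leading term as polynomials in `e(z/2)`. -/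
lemma HasLeadingTerm.exists_polynomial (h : HasLeadingTerm φ ν f β)
    (hg : ∃ x : ℝ, 0 < x ∧ x < 1 ∧ ∃ C a Y : ℝ, ∀ τ : ℍ, Y ≤ τ.im → ∀ z : ℂ,
      (z.im = x * τ.im ∨ z.im = (x - 1) * τ.im) → ‖φ τ z‖ ≤ C * Real.exp (a * τ.im))
    {D : ℕ} (hD : 0 < D) (hβ : ∃ k : ℤ, β * D = k) (j : ℤ) :
    ∃ (p : Polynomial ℂ) (a : ℕ), ∀ (Y : ℝ) (z : ℂ), |z.im| < Y →
      tubeCoeff φ ν f D Y (j / D) z = e (-(a * (z / 2))) * p.eval (e (z / 2)) := by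
  obtain ⟨P, hP⟩ := h.exists_laurent hg hD hβ j
  obtain ⟨a, p, hp⟩ := exists_T_pow P
  have hPp : P = Polynomial.toLaurent p * T (-(a : ℤ)) := by
    rw [hp, mul_T_assoc, add_neg_cancel, T_zero, mul_one]
  exact ⟨p, a, fun Y z hz => by rw [hP Y z hz, hPp, eval₂_eUnit_toLaurent_mul_T]⟩

/-- If the Fourier coefficients `c(n, r)` lie in a ring `R` and `Φ_ℓ(X²)` divides `p`, then
`p(1)` lies in `ℓ R`: division by monic polynomials preserves integrality, and `Φ_ℓ(1) = ℓ`. -/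
lemma exists_eval_one_eq {R : Subring ℂ} {ε : ℝ} (hε : 0 < ε)
    (hc : ∀ (τ : ℍ) (z : ℂ), 0 < z.im / τ.im → z.im / τ.im < ε →
      HasSum (fun p : ℚ × ℚ => c p.1 p.2 * e ((p.1 : ℂ) * (τ : ℂ) + (p.2 : ℂ) * z)) (φ τ z))
    {D : ℕ} (hD : 0 < D) (hcD : ∀ n r, c n r ≠ 0 → ∃ k : ℤ, r = k / D)
    (hcR : ∀ n r, c n r ∈ R) {n : ℚ} {p : Polynomial ℂ} {a : ℕ}
    (hp : ∀ z : ℂ, 0 < z.im → leadingCoeff ν c n z = e (-(a * (z / 2))) * p.eval (e (z / 2)))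
    {ℓ : ℕ} (hℓ : ℓ.Prime)
    (hdvd : Polynomial.expand ℂ 2 (Polynomial.cyclotomic ℓ ℂ) ∣ p) :
    ∃ y ∈ R, p.eval 1 = ℓ * y := by
  have := Fact.mk hℓ
  have hD' : (D : ℂ) ≠ 0 := by exact_mod_cast hD.ne'
  obtain ⟨q, hq⟩ := hdvd
  set μ := ν.natAbs with hμ
  obtain ⟨ν', hν'⟩ : ∃ ν' : ℕ, (ν' : ℤ) = μ + ν := ⟨(μ + ν).toNat, by omega⟩
  set B₀ : Polynomial ℤ := (Polynomial.X ^ 2 - 1) ^ μ *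
    Polynomial.expand ℤ 2 (Polynomial.cyclotomic ℓ ℤ) with hB₀
  have hB₀m : B₀.Monic := by
    refine Polynomial.Monic.mul (Polynomial.Monic.pow ?_ _)
      (Polynomial.Monic.expand two_pos (Polynomial.cyclotomic.monic ℓ ℤ))
    simpa using Polynomial.monic_X_pow_sub_C (1 : ℤ) two_ne_zero
  set B := B₀.map (Int.castRingHom ℂ) with hB
  have hBq : B * q = (Polynomial.X ^ 2 - 1) ^ μ * p := by
    rw [hB, hB₀, hq]
    simp only [Polynomial.map_mul, Polynomial.map_pow, Polynomial.map_sub, Polynomial.map_X,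
      Polynomial.map_one, Polynomial.map_expand, Polynomial.map_cyclotomic]
    ring
  have hBR : ∀ n, B.coeff n ∈ R := fun n => by
    rw [hB, Polynomial.coeff_map]
    exact intCast_mem R _
  set g : ℂ → ℂ := coeffAt c n with hg
  have hgF : ∀ k : ℤ, fourierInt (2 * D) g (1 : ℝ) (k / (2 * D : ℕ)) ∈ R := by
    intro k
    have hsupp : ∀ r, c n r ≠ 0 → ∃ k : ℤ, r = k / (2 * D : ℕ) := by
      intro r hr
      obtain ⟨k, hk⟩ := hcD n r hr
      refine ⟨2 * k, ?_⟩
      rw [hk]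
      push_cast
      rw [mul_div_mul_left _ _ two_ne_zero]
    rw [fourierInt_of_hasSum (Nat.mul_pos two_pos hD)
      (c := fun k : ℤ => c n ((k : ℚ) / (2 * D : ℕ))) (fun x => ?_)]
    · exact hcR _ _
    · have h1 := (summable_coeffAt hε hc n (z := x + (1 : ℝ) * I) (by simp)).hasSum
      rw [hasSum_rat_iff (Nat.mul_pos two_pos hD) hsupp
        (fun r => e (r * (x + (1 : ℝ) * I)))] at h1
      exact_mod_cast h1
  have hs : ∀ x : ℝ, sinFactor (x + (1 : ℝ) * I) ≠ 0 := fun x =>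
    sinFactor_ne_zero_of_im_ne_zero (by simp)
  have hline : ∀ x : ℝ, sinFactor (x + (1 : ℝ) * I) ^ ν * g (x + (1 : ℝ) * I) =
      e (-(a * ((x + (1 : ℝ) * I) / 2))) * p.eval (e ((x + (1 : ℝ) * I) / 2)) := fun x =>
    hp _ (by simp)
  have hgc : Continuous fun x : ℝ => g (x + (1 : ℝ) * I) := by
    have h1 : (fun x : ℝ => g (x + (1 : ℝ) * I)) = fun x : ℝ =>
        (sinFactor (x + (1 : ℝ) * I) ^ ν)⁻¹ *
          (e (-(a * ((x + (1 : ℝ) * I) / 2))) * p.eval (e ((x + (1 : ℝ) * I) / 2))) := by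
      funext x
      rw [← hline, inv_mul_cancel_left₀ (zpow_ne_zero _ (hs x))]
    rw [h1]
    have h2 : Continuous fun x : ℝ => sinFactor (x + (1 : ℝ) * I) := by fun_prop
    have h3 := p.continuous
    refine ((h2.zpow₀ ν fun x => Or.inl (hs x)).inv₀ fun x => zpow_ne_zero _ (hs x)).mul ?_
    fun_prop
  have hBqR : ∀ j, (B * q).coeff j ∈ R := by
    intro j
    rw [hBq, ← fourierInt_eval_e hD 1]
    have h1 := fourierInt_sinFactor_pow_mul_mem hD hgc hgF ν' (D * j - (μ + a : ℕ) * D)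
    rw [← fourierInt_e_mul] at h1
    rw [fourierInt_congr (G := fun z => e (((((μ + a : ℕ) * D : ℤ) : ℚ) / (2 * D : ℕ) : ℚ) * z) *
      (sinFactor z ^ ν' * g z)) _ fun x => ?_]
    · exact_mod_cast h1
    · have h2 : e (x + (1 : ℝ) * I) - 1 = e ((x + (1 : ℝ) * I) / 2) * sinFactor (x + (1 : ℝ) * I) := by
        rw [sinFactor, mul_sub, ← e_add, ← e_add, add_halves, neg_div, add_neg_cancel, e_zero]
      have h3 : sinFactor (x + (1 : ℝ) * I) ^ ν' =
          sinFactor (x + (1 : ℝ) * I) ^ μ * sinFactor (x + (1 : ℝ) * I) ^ ν := by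
        rw [← zpow_natCast, ← zpow_natCast, hν', zpow_add₀ (hs x)]
      have h4 : e (((((μ + a : ℕ) * D : ℤ) : ℚ) / (2 * D : ℕ) : ℚ) * (x + (1 : ℝ) * I)) =
          e ((x + (1 : ℝ) * I) / 2) ^ μ * e (a * ((x + (1 : ℝ) * I) / 2)) := by
        rw [← e_natCast_mul, ← e_add]
        congr 1
        push_cast
        field_simp
      have h5 : e (a * ((x + (1 : ℝ) * I) / 2)) * e (-(a * ((x + (1 : ℝ) * I) / 2))) = 1 := by
        rw [← e_add, add_neg_cancel, e_zero]
      have h6 : e ((x + (1 : ℝ) * I) / 2) ^ 2 = e (x + (1 : ℝ) * I) := by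
        rw [← e_natCast_mul]
        congr 1
        push_cast
        ring
      rw [h3, h4, mul_assoc (sinFactor (x + (1 : ℝ) * I) ^ μ), hline]
      simp only [Polynomial.eval_mul, Polynomial.eval_pow, Polynomial.eval_sub, Polynomial.eval_X,
        Polynomial.eval_one]
      rw [h6, h2, mul_pow]
      linear_combination (-(e ((x + (1 : ℝ) * I) / 2) ^ μ * sinFactor (x + (1 : ℝ) * I) ^ μ *
        p.eval (e ((x + (1 : ℝ) * I) / 2)))) * h5
  have hqR := coeff_mem_of_monic_mul (hB₀m.map _) hBR hBqR
  refine ⟨q.eval 1, ?_, ?_⟩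
  · rw [Polynomial.eval_eq_sum, Polynomial.sum_def]
    exact R.sum_mem fun i _ => by
      rw [one_pow, mul_one]
      exact hqR i
  · rw [hq, Polynomial.eval_mul, Polynomial.expand_eval, one_pow,
      Polynomial.eval_one_cyclotomic_prime]

end Expansion


/-! ### Jacobi forms that specialize to modular forms -/

/-- The neutral element of `Mp₁(ℤ)`. -/
def Mp.one : Mp where
  γ := 1
  ω := fun _ => 1
  holo := fun _ _ => analyticAt_const
  sq := fun τ => by simp

lemma jacobiSlash_one (w : ℤ) (m : ℂ) (φ : ℍ → ℂ → ℂ) (τ : ℍ) (z : ℂ) :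
    jacobiSlash w m φ Mp.one τ z = φ τ z := by
  simp [jacobiSlash, Mp.one]

lemma jacobiSlash_T (w : ℤ) (m : ℂ) (φ : ℍ → ℂ → ℂ) (τ : ℍ) (z : ℂ) :
    jacobiSlash w m φ Mp.T τ z = φ ((1 : ℝ) +ᵥ τ) z := by
  have h1 : (ModularGroup.T 1 0 : ℤ) = 0 := by simp [ModularGroup.T]
  have h2 : (ModularGroup.T 1 1 : ℤ) = 1 := by simp [ModularGroup.T]
  rw [jacobiSlash]
  simp only [Mp.T, h1, h2, UpperHalfPlane.modular_T_smul]
  simp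

lemma Mp.T_mem_Gamma0Tilde (N : ℕ) : Mp.T ∈ Gamma0Tilde N := by
  change ModularGroup.T ∈ CongruenceSubgroup.Gamma0 N
  rw [CongruenceSubgroup.Gamma0_mem]
  simp [ModularGroup.T]

variable {Γ : Set Mp} {ρ : Mp → ℂ} {w w' ν : ℤ} {m : ℂ} {f : ℍ → ℂ} {φ : ℍ → ℂ → ℂ} {β : ℚ}

lemma IsWeaklyHolomorphicModularForm.char_ne_zero
    (hf : IsWeaklyHolomorphicModularForm Γ ρ w' f) (hf0 : f ≠ 0) {g : Mp} (hg : g ∈ Γ) :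
    ρ g ≠ 0 := by
  intro h0
  apply hf0
  funext τ
  have h1 := hf.transform g hg (g.γ⁻¹ • τ)
  rw [h0, zero_mul, slash, smul_inv_smul] at h1
  exact (mul_eq_zero.mp h1).resolve_left (zpow_ne_zero _ (g.ω_ne_zero _))

lemma IsWeaklyHolomorphicJacobiForm.index_eq_intCast
    (hφ : IsWeaklyHolomorphicJacobiForm Γ ρ w m φ) (hs : SpecializesTo φ ν f) :
    ∃ m' : ℤ, m = m' := by
  obtain ⟨τ, hτ⟩ := Function.ne_iff.mp hs.1
  have h1 : ∀ᶠ z in 𝓝[≠] (0 : ℂ), (e (z / 2) - e (-z / 2)) ^ ν * φ τ z ≠ 0 :=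
    (hs.2 τ).eventually_ne hτ
  have h2 := eventually_sinFactor_ne_zero 0
  have h3 : ∀ᶠ z in 𝓝[≠] (0 : ℂ), |z.im| < τ.im := by
    refine (Continuous.tendsto (by fun_prop : Continuous fun z : ℂ => |z.im|) 0).eventually_lt_const
      (by simpa using τ.im_pos) |>.filter_mono nhdsWithin_le_nhds
  rw [Int.cast_zero] at h2
  obtain ⟨z, hz1, hz2, hz3⟩ := (h1.and (h2.and h3)).exists
  have hz : z ∉ lattice τ := by rwa [mem_lattice_iff_of_abs_im_lt hz3]
  have h4 := hφ.transform_heisenberg 0 0 1 τ z hz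
  simp only [heisenbergSlash, Int.cast_zero, Int.cast_one, zero_mul, add_zero, mul_zero, zero_add,
    mul_one, ne_eq, OfNat.ofNat_ne_zero, not_false_eq_true, zero_pow] at h4
  have h5 : e m = 1 := mul_right_cancel₀ (right_ne_zero_of_mul hz1) (h4.trans (one_mul _).symm)
  exact e_eq_one_iff.mp h5

lemma IsWeaklyHolomorphicJacobiForm.hasLeadingTerm
    (hφ : IsWeaklyHolomorphicJacobiForm Γ ρ w m φ) (hf : IsWeaklyHolomorphicModularForm Γ ρ w' f)
    (hs : SpecializesTo φ ν f) (hT : Mp.T ∈ Γ) (hβ : ρ Mp.T = e β) : HasLeadingTerm φ ν f β where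
  regular := hφ.regular
  holo := hf.holo
  tendsto := hs.2
  add_int := by
    intro τ z hz k
    have h := hφ.transform_heisenberg 0 k 0 τ z hz
    simpa [heisenbergSlash] using h
  translate := by
    intro τ z hz
    rw [← jacobiSlash_T w m φ τ z, hφ.transform _ hT τ z hz, hβ]
  translate_leading := by
    intro τ
    rw [← slash_T w' f τ, hf.transform _ hT τ, hβ]

lemma not_mem_lattice_of_rat {x : ℚ} (hx0 : 0 < x) (hx1 : x < 1) (y : ℚ) (τ : ℍ) :
    (x * τ + y : ℂ) ∉ lattice τ := by
  rintro ⟨l, μ, h⟩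
  have him := congrArg Complex.im h
  have h1 : ((x : ℂ) * τ + y).im = x * τ.im := by simp
  have h2 : ((l : ℂ) * τ + μ).im = l * τ.im := by simp
  rw [h1, h2] at him
  have h3 : (x : ℝ) = l := mul_right_cancel₀ τ.im_pos.ne' him
  have h4 : x = l := by exact_mod_cast h3
  rw [h4] at hx0 hx1
  have h5 : (0 : ℤ) < l := by exact_mod_cast hx0
  have h6 : l < (1 : ℤ) := by exact_mod_cast hx1
  omega

lemma IsWeaklyHolomorphicJacobiForm.isBigO_torsion
    (hφ : IsWeaklyHolomorphicJacobiForm Γ ρ w m φ) (x y : ℚ) (hx0 : 0 < x) (hx1 : x < 1) :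
    ∃ a : ℝ, (fun τ : ℍ => φ τ (x * τ + y)) =O[atImInfty] (fun τ : ℍ => Real.exp (a * τ.im)) := by
  refine hφ.growth Mp.one x y _ fun τ => ?_
  simp only [jacobiSlash_one]
  have h1 := (hφ.regular τ _ (not_mem_lattice_of_rat hx0 hx1 y τ)).continuousAt
  have h2 : ContinuousAt (fun z : ℂ => ((τ : ℂ), z)) (x * τ + y) := by fun_prop
  have h3 := ContinuousAt.comp (g := fun p : ℂ × ℂ => φ (ofComplex p.1) p.2) h1 h2
  have h4 := h3.tendsto.mono_left (nhdsWithin_le_nhds (s := {(x * τ + y : ℂ)}ᶜ))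
  simpa [Function.comp_def] using h4

/-- The Fourier expansion of the leading term at `z = 0`. -/
lemma HasLeadingTerm.isFourierExpansion (h : HasLeadingTerm φ ν f β) {D : ℕ} (hD : 0 < D)
    (hβ : ∃ k : ℤ, β * D = k) : ∃ c : ℚ → ℂ, IsFourierExpansion f c ∧
      ∀ k : ℤ, c (k / D) = tubeCoeff φ ν f D 1 (k / D) 0 := by
  classical
  have hlead : ∀ t : ℂ, leadingTerm φ ν f t 0 = f (ofComplex t) := by
    intro t
    have := leadingTerm_intCast (φ := φ) (ν := ν) (f := f) 0 t
    simpa using this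
  set c : ℚ → ℂ := fun n => if ∃ k : ℤ, n = k / D then tubeCoeff φ ν f D 1 n 0 else 0 with hc
  have hck : ∀ k : ℤ, c (k / D) = tubeCoeff φ ν f D 1 (k / D) 0 := fun k => if_pos ⟨k, rfl⟩
  have hsupp : ∀ n, c n ≠ 0 → ∃ k : ℤ, n = k / D := by
    intro n hn
    by_contra hno
    exact hn (if_neg hno)
  refine ⟨c, ⟨⟨D, hD, hsupp⟩, fun τ => ?_⟩, hck⟩
  rw [hasSum_rat_iff hD hsupp (fun n => e (n * (τ : ℂ)))]
  have h1 := hasSum_fourierInt hD (F := fun t => leadingTerm φ ν f t 0) (y₁ := 0)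
    (y₂ := τ.im + 2) (y := 1) (z := τ) (fun z hz _ => h.differentiableAt_fst (by simpa using hz))
    (fun z hz _ => h.leadingTerm_add_nat hβ (by simpa using hz)) one_pos
    (by linarith [τ.im_pos]) τ.im_pos (by change τ.im < τ.im + 2; linarith)
  rw [hlead, ofComplex_apply] at h1
  refine Eq.mp (congrArg (fun F => HasSum F _) (funext fun k => ?_)) h1
  rw [hck]
  push_cast
  rfl

lemma exists_intCast_div {β n : ℚ} {D M : ℕ} {u : ℤ} (hD : 0 < D) (hβ : ∃ k : ℤ, β * D = k)
    (hn : n ∈ progression M (u ^ 2 * β)) : ∃ k : ℤ, n = k / D := by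
  obtain ⟨k, hk⟩ := hβ
  obtain ⟨j, rfl⟩ := hn
  have hD' : (D : ℚ) ≠ 0 := by exact_mod_cast hD.ne'
  refine ⟨M * j * D + u ^ 2 * k, ?_⟩
  push_cast
  rw [← hk]
  field_simp

end RamanujanType

end

theorem mainTheorem1 (K : IntermediateField ℚ ℂ) [FiniteDimensional ℚ K]
    (N M ℓ : ℕ) (hN : 0 < N) (hM : 0 < M) (hℓ : ℓ.Prime)
    (χ : DirichletCharacter ℂ N) (v : Mp → ℂ)
    (hv : (4 ∣ N ∧ v = chiTheta) ∨ v = chiEta)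
    (w w' : ℤ) (m : ℂ) (f : UpperHalfPlane → ℂ) (φ : UpperHalfPlane → ℂ → ℂ)
    (hf : IsWeaklyHolomorphicModularForm (Gamma0Tilde N) (twist χ v) w' f)
    (hφ : IsWeaklyHolomorphicJacobiForm (Gamma0Tilde N) (twist χ v) w m φ)
    (β : ℚ) (hβ : twist χ v Mp.T = e (β : ℂ))
    (hexp : Explains K ℓ φ f M β) (u : ℤ) (hu : Int.gcd (M : ℤ) u = 1) :
    HasRamanujanTypeCongruence K ℓ f M ((u : ℚ) ^ 2 * β) ∧
      Explains K ℓ φ f M ((u : ℚ) ^ 2 * β) := by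
  obtain ⟨ν, c, hs, ⟨⟨D₀, hD₀, hcD₀⟩, ε, hε, hc⟩, hcR, hcyc⟩ := hexp
  obtain ⟨m, rfl⟩ := hφ.index_eq_intCast hs
  have hlt := hφ.hasLeadingTerm hf hs (Mp.T_mem_Gamma0Tilde N) hβ
  obtain ⟨κ, X, h₀, A₀, hX, hκ, hA₀, hh₀, hvh, hvT⟩ :=
    exists_isThetaCoefficient (hv.imp_left And.right)
  have hβκ : ∃ r : ℤ, β = 1 / κ + r := by
    have h1 : v Mp.T = e β := by
      rw [← hβ, twist]
      have : (Mp.T.γ 1 1 : ℤ) = 1 := by simp [Mp.T, ModularGroup.T]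
      rw [this, Int.cast_one, map_one, one_mul]
    have h2 : e (β : ℂ) = e (1 / κ) := by
      rw [← h1, hvT (by rw [h1]; exact e_ne_zero _)]
    obtain ⟨r, hr⟩ := e_eq_e_iff.mp h2
    refine ⟨r, ?_⟩
    have h3 : (β : ℂ) = ((1 / κ + r : ℚ) : ℂ) := by rw [hr]; push_cast; rfl
    exact_mod_cast h3
  have hell : ∀ (τ : UpperHalfPlane) (z : ℂ), z ∉ lattice τ →
      e (m * (τ + 2 * z)) * φ τ (z + τ) = φ τ z := by
    intro τ z hz
    have h := hφ.transform_heisenberg 1 0 0 τ z hz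
    simpa [heisenbergSlash] using h
  have hgrow := hlt.exists_growth hell hφ.isBigO_torsion
  -- A common denominator of all exponents.
  set D : ℕ := D₀ * β.den with hDdef
  have hD : 0 < D := Nat.mul_pos hD₀ β.den_pos
  have hD₀' : (D₀ : ℚ) ≠ 0 := by exact_mod_cast hD₀.ne'
  have hβden : (β.den : ℚ) ≠ 0 := by exact_mod_cast β.den_ne_zero
  have hβD : ∃ k : ℤ, β * D = k := by
    refine ⟨D₀ * β.num, ?_⟩
    rw [hDdef]
    push_cast
    rw [mul_left_comm, Rat.mul_den_eq_num]
  have hfrac : ∀ x : ℚ, (∃ a : ℤ, x = a / D₀) → ∃ k : ℤ, x = k / D := by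
    rintro x ⟨a, rfl⟩
    refine ⟨a * β.den, ?_⟩
    rw [hDdef]
    push_cast
    field_simp
  have hcD : ∀ n r, c n r ≠ 0 → ∃ k : ℤ, n = k / D := fun n r h => hfrac n (hcD₀ n r h).1
  have hcD' : ∀ n r, c n r ≠ 0 → ∃ k : ℤ, r = k / D := fun n r h => hfrac r (hcD₀ n r h).2
  have him : ∀ h : ℤ, (h / ℓ : ℂ).im = 0 := fun h => by
    rw [Complex.div_natCast_im, Complex.intCast_im, zero_div]
  choose p a hp using hlt.exists_polynomial hgrow hD hβD
  have hlead : ∀ (k : ℤ) (z : ℂ), 0 < z.im →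
      leadingCoeff ν c (k / D) z = e (-(a k * (z / 2))) * (p k).eval (e (z / 2)) := by
    intro k z hz
    obtain ⟨Y, hY⟩ := exists_gt (max (z.im / ε) |z.im|)
    rw [leadingCoeff_eq_tubeCoeff (f := f) hε hc hD hcD hz ((le_max_left _ _).trans_lt hY),
      hp k Y z ((le_max_right _ _).trans_lt hY)]
  have hvan : ∀ Y : ℝ, 0 < Y → ∀ k : ℤ, (k / D : ℚ) ∈ progression M β →
      ∀ h : ℤ, ¬ (ℓ : ℤ) ∣ h → tubeCoeff φ ν f D Y (k / D) (h / ℓ) = 0 := by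
    intro Y hY k hk h hh
    rw [hp k Y _ (by rwa [him, abs_zero])]
    refine (hcyc _ hk).eq_zero hℓ (G := fun z => e (-(a k * (z / 2))) * (p k).eval (e (z / 2)))
      ?_ (hlead k) hh
    have := (p k).continuous
    fun_prop
  have hdvd : ∀ k : ℤ, (k / D : ℚ) ∈ progression M (u ^ 2 * β) →
      Polynomial.expand ℂ 2 (Polynomial.cyclotomic ℓ ℂ) ∣ p k := by
    intro k hk
    refine expand_cyclotomic_dvd hℓ fun h hh => ?_
    have h1 := hlt.tubeCoeff_eq_zero hX hκ hA₀ hh₀ hvh hN hφ.transform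
      (fun g hg => hf.char_ne_zero hs.1 hg) hφ.transform_heisenberg hℓ hM hβκ hD hβD
      (Int.isCoprime_iff_gcd_eq_one.mpr hu) hvan one_pos hk hh
    rw [hp k 1 _ (by rw [him, abs_zero]; exact one_pos), mul_eq_zero] at h1
    exact h1.resolve_left (e_ne_zero _)
  constructor
  · obtain ⟨b, hb, hbk⟩ := hlt.isFourierExpansion hD hβD
    refine ⟨b, hb, fun n hn => ?_⟩
    obtain ⟨k, rfl⟩ := exists_intCast_div hD hβD hn
    obtain ⟨y, hy, hpy⟩ := exists_eval_one_eq (R := locallyIntegral K hℓ) hε hc hD hcD' hcR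
      (hlead k) hℓ (hdvd k hn)
    refine ⟨y, hy, ?_⟩
    rw [hbk, hp k 1 0 (by simp), ← hpy]
    simp
  · refine ⟨ν, c, hs, ⟨⟨D₀, hD₀, hcD₀⟩, ε, hε, hc⟩, hcR, fun n hn => ?_⟩
    obtain ⟨k, rfl⟩ := exists_intCast_div hD hβD hn
    exact cyclotomicDvd_of_dvd (hlead k) (hdvd k hn)
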